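/- **Setting.** Let $p_1,p_2\in\mathbb N$ and $p=p_1p_2$. A weighted graph on $p_i$ vertices without self-loops is given by a vector $w_i\ge 0$ of $p_i(p_i-1)/2$ edge weights; $W_i$ is its symmetric weighted adjacency matrix and $D_i$ its diagonal matrix of weighted degrees. The Laplacian of the Kronecker product graph is $L(w_1,w_2)=D_1\otimes D_2-W_1\otimes W_2\in\mathbb R^{p\times p}$. Let $w_1^*,w_2^*\ge 0$ be the true factor graphs, $L^*=L(w_1^*,w_2^*)$, and assume, with constants $s_1,s_2>0$, $d>1$, $z>1$: * (A1) $w_1^*$ and $w_2^*$ have at most $s_1p_1$ and $s_2p_2$ nonzero entries, respectively; * (A2) all weighted degrees of both factor graphs lie in $[1/d,d]$; * (A3) the eigenvalues of $L^*$, with multiplicity, are $0,\lambda_2,\dots,\lambda_p$ with $1/z\le\lambda_k\le z$ for $2\le k\le p$. Let $x_1,\dots,x_n$ be i.i.d. $N(0,(L^*)^\dagger)$ vectors in $\mathbb R^{p}$, where $\dagger$ is the Moore–Penrose inverse, and $S=\frac1n\sum_k x_kx_k^T$. For penalties $\alpha_1,\alpha_2>0$, a penalized maximum likelihood estimator is a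 global minimizer $(\hat w_1,\hat w_2)$ of $$\operatorname{Tr}\bigl(L(w_1,w_2)S\bigr)-\log{\det}^\dagger L(w_1,w_2)+\alpha_1\|w_1\|_1+\alpha_2\|w_2\|_1$$ over all $w_1,w_2\ge0$ whose product graph is connected, i.e. $L(w_1,w_2)+\frac1p\mathbf 1\mathbf 1^T\succ0$; here ${\det}^\dagger$ is the product of the nonzero eigenvalues. Put $\hat L=L(\hat w_1,\hat w_2)$. **Theorem (high-dimensional consistency).** Fix $s_1,s_2,d,z$ and a constant $a>0$. 1. For every $\tau>0$ there are constants $c,C>0$ depending only on $s_1,s_2,d,z,a,\tau$ such that, for all $p_1,p_2,n$ and all true graphs satisfying (A1)–(A3), if $n\ge C\bigl(\frac{p_1}{p_2}+\frac{p_2}{p_1}\bigr)\log p$ and $0<\alpha_1\le a\sqrt{p_2\log p/n}$, $0<\alpha_2\le a\sqrt{p_1\log p/n}$, then with probability at least $1-p^{-\tau}$ a penalized maximum likelihood estimator exists and every such estimator satisfies $$\|\hat L-L^*\|_F\le c\sqrt{\frac{(p_1+p_2)\log p}{n}}.$$ 2. Consequently the estimator is asymptotically consistent: for all $\varepsilon,\delta>0$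 there is $\rho>0$, depending only on $\varepsilon,\delta,s_1,s_2,d,z,a$, such that whenever (A1)–(A3) hold, $(p_1+p_2)\log p\le\rho n$ and the penalties are in the above range, then with probability at least $1-\delta$ a penalized maximum likelihood estimator exists and every such estimator satisfies $\|\hat L-L^*\|_F\le\varepsilon$. -/

import Mathlib

open MeasureTheory ProbabilityTheory Matrix
open scoped Kronecker

universe u

namespace KSGL

noncomputable section

/-- Unordered pairs of distinct vertices, listed as `(i, j)` with `j < i`; there are
`p (p - 1) / 2` of them. -/
abbrev Edge (p : ℕ) : Type := {e : Fin p × Fin p // e.2 < e.1}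

/-- Weighted adjacency matrix (symmetric, zero diagonal) of a weight vector. -/
def adj {p : ℕ} (w : Edge p → ℝ) : Matrix (Fin p) (Fin p) ℝ :=
  Matrix.of fun i j =>
    if h : j < i then w ⟨(i, j), h⟩ else if h : i < j then w ⟨(j, i), h⟩ else 0

/-- Weighted degree of a vertex. -/
def degree {p : ℕ} (w : Edge p → ℝ) (i : Fin p) : ℝ := ∑ j, adj w i j

/-- Laplacian `D₁ ⊗ D₂ - W₁ ⊗ W₂` of the Kronecker product of two weighted graphs. -/
def kronLaplacian {p₁ p₂ : ℕ} (w₁ : Edge p₁ → ℝ) (w₂ : Edge p₂ → ℝ) :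
    Matrix (Fin p₁ × Fin p₂) (Fin p₁ × Fin p₂) ℝ :=
  Matrix.diagonal (degree w₁) ⊗ₖ Matrix.diagonal (degree w₂) - adj w₁ ⊗ₖ adj w₂

/-- The averaging matrix `J = (1/p) 1 1ᵀ`. -/
def avgMatrix (ι : Type*) [Fintype ι] : Matrix ι ι ℝ :=
  Matrix.of fun _ _ => (Fintype.card ι : ℝ)⁻¹

/-- Pseudo-determinant: the product, with multiplicity, of the nonzero (real) eigenvalues. -/
def pseudoDet {ι : Type*} [Fintype ι] [DecidableEq ι] (A : Matrix ι ι ℝ) : ℝ :=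
  (A.charpoly.roots.filter (fun x => x ≠ 0)).prod

/-- `B` is the Moore–Penrose pseudo-inverse of the real matrix `A`. -/
structure IsMoorePenroseInverse {ι : Type*} [Fintype ι] (A B : Matrix ι ι ℝ) : Prop where
  mul_mul_left : A * B * A = A
  mul_mul_right : B * A * B = B
  symm_left : (A * B)ᵀ = A * B
  symm_right : (B * A)ᵀ = B * A

/-- Frobenius norm. -/
def frobNorm {ι : Type*} [Fintype ι] (A : Matrix ι ι ℝ) : ℝ :=
  Real.sqrt (∑ i, ∑ j, A i j ^ 2)

/-- Sample covariance matrix `S = (1/n) ∑ₖ xₖ xₖᵀ` (no centering). -/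
def sampleCov {ι : Type*} {n : ℕ} (x : Fin n → EuclideanSpace ℝ ι) : Matrix ι ι ℝ :=
  Matrix.of fun i j => (n : ℝ)⁻¹ * ∑ k, x k i * x k j

/-- Penalized negative log-likelihood
`⟨L, S⟩ - log det† L + α₁ ‖w₁‖₁ + α₂ ‖w₂‖₁` with `L = D₁ ⊗ D₂ - W₁ ⊗ W₂`
(the weights are nonnegative on the feasible set). -/
def penNegLogLik {p₁ p₂ : ℕ} (α₁ α₂ : ℝ)
    (S : Matrix (Fin p₁ × Fin p₂) (Fin p₁ × Fin p₂) ℝ)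
    (w₁ : Edge p₁ → ℝ) (w₂ : Edge p₂ → ℝ) : ℝ :=
  (kronLaplacian w₁ w₂ * S).trace - Real.log (pseudoDet (kronLaplacian w₁ w₂))
    + α₁ * ∑ e, w₁ e + α₂ * ∑ e, w₂ e

/-- Feasible weights: nonnegative, with connected product graph, i.e. `L + J` positive definite
(this forces both factor graphs to be connected). -/
def Feasible {p₁ p₂ : ℕ} (w₁ : Edge p₁ → ℝ) (w₂ : Edge p₂ → ℝ) : Prop :=
  (∀ e, 0 ≤ w₁ e) ∧ (∀ e, 0 ≤ w₂ e) ∧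
    (kronLaplacian w₁ w₂ + avgMatrix (Fin p₁ × Fin p₂)).PosDef

/-- `(v₁, v₂)` is a global minimizer of the penalized negative log-likelihood. -/
def IsPenalizedMLE {p₁ p₂ : ℕ} (α₁ α₂ : ℝ)
    (S : Matrix (Fin p₁ × Fin p₂) (Fin p₁ × Fin p₂) ℝ)
    (v₁ : Edge p₁ → ℝ) (v₂ : Edge p₂ → ℝ) : Prop :=
  Feasible v₁ v₂ ∧
    ∀ u₁ u₂, Feasible u₁ u₂ → penNegLogLik α₁ α₂ S v₁ v₂ ≤ penNegLogLik α₁ α₂ S u₁ u₂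

/-- Assumptions on the true factor graphs: nonnegative weights, at most `sᵢ pᵢ` edges, weighted
degrees in `[1/d, d]`, and product-Laplacian spectrum `0, λ₂, …, λₚ` (with multiplicity) with
`λ₂, …, λₚ` in `[1/z, z]`. -/
structure TrueGraphs (s₁ s₂ d z : ℝ) {p₁ p₂ : ℕ} (w₁ : Edge p₁ → ℝ) (w₂ : Edge p₂ → ℝ) :
    Prop where
  nonneg₁ : ∀ e, 0 ≤ w₁ e
  nonneg₂ : ∀ e, 0 ≤ w₂ e
  sparse₁ : ((Finset.univ.filter fun e => w₁ e ≠ 0).card : ℝ) ≤ s₁ * p₁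
  sparse₂ : ((Finset.univ.filter fun e => w₂ e ≠ 0).card : ℝ) ≤ s₂ * p₂
  degree₁ : ∀ i, 1 / d ≤ degree w₁ i ∧ degree w₁ i ≤ d
  degree₂ : ∀ i, 1 / d ≤ degree w₂ i ∧ degree w₂ i ≤ d
  spectrum : ∃ l : Multiset ℝ, (kronLaplacian w₁ w₂).charpoly.roots = 0 ::ₘ l ∧
    ∀ x ∈ l, 1 / z ≤ x ∧ x ≤ z

/-- `X₁, …, Xₙ` are i.i.d. `N(0, L†)`: a sample of the improper Gaussian Markov random field
with precision matrix `L`. -/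
def IsIGMRFSample {ι : Type*} [Fintype ι] [DecidableEq ι] {n : ℕ} {Ω : Type*}
    [MeasurableSpace Ω] (μ : Measure Ω) (L : Matrix ι ι ℝ)
    (X : Fin n → Ω → EuclideanSpace ℝ ι) : Prop :=
  iIndepFun X μ ∧
    ∃ C : Matrix ι ι ℝ, IsMoorePenroseInverse L C ∧
      ∀ k, HasLaw (X k) (multivariateGaussian 0 C) μ

/-- The event that the penalized MLE does not exist, or that some penalized MLE has
product-Laplacian Frobenius error larger than `r`. -/
def failureEvent {p₁ p₂ n : ℕ} {Ω : Type*} (α₁ α₂ : ℝ)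
    (X : Fin n → Ω → EuclideanSpace ℝ (Fin p₁ × Fin p₂))
    (w₁ : Edge p₁ → ℝ) (w₂ : Edge p₂ → ℝ) (r : ℝ) : Set Ω :=
  {ω | ¬ ((∃ v₁ v₂, IsPenalizedMLE α₁ α₂ (sampleCov fun k => X k ω) v₁ v₂) ∧
    ∀ v₁ v₂, IsPenalizedMLE α₁ α₂ (sampleCov fun k => X k ω) v₁ v₂ →
      frobNorm (kronLaplacian v₁ v₂ - kronLaplacian w₁ w₂) ≤ r)}

/-- Order of magnitude of the penalties, up to the constant `a`:
`0 < α₁ ≤ a √(p₂ log p / n)` and `0 < α₂ ≤ a √(p₁ log p / n)` with `p = p₁ p₂`. -/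
def ProperPenalty (a : ℝ) (p₁ p₂ n : ℕ) (α₁ α₂ : ℝ) : Prop :=
  (0 < α₁ ∧ α₁ ≤ a * Real.sqrt (p₂ * Real.log (p₁ * p₂) / n)) ∧
    (0 < α₂ ∧ α₂ ≤ a * Real.sqrt (p₁ * Real.log (p₁ * p₂) / n))

end

end KSGL

/-! Everything is measured by the log-determinant Bregman divergence D between the matrices L + J,
where J is the averaging matrix (`divergence`). Because J turns the kernel eigenvalue 0 into 1, the
pseudo-determinant becomes an ordinary determinant and L† = (L + J)⁻¹ - J.

Curvature. `trace_test_le` shows ⟨V, L̂ - L*⟩ ≤ D + z² tr V² for every symmetric V of size at most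
1/(2z) and every feasible L̂, so no prior closeness to the truth is needed. A Kronecker product of
diagonal matrices sees only the diagonal of L, one of adjacency matrices only the off-diagonal part,
and in both cases the pairing factorises over the two graphs. Each choice of V therefore tests the
rank-one array v₁ ⊗ v₂ - w₁ ⊗ w₂, for weights or for degrees.

Optimality. The Laplacian is unchanged under (w₁, w₂) ↦ (t w₁, t⁻¹ w₂). Comparing a minimiser with
the truth at the scale that balances the two penalties bounds D by a noise difference plus 2√(α₁α₂)
times a difference of square roots of products of total weights (`IsPenalizedMLE.divergence_le`).

Sparsity. Scale the estimate so that ⟨w₂, v₂⟩ = ⟨w₂, w₂⟩. Since v ≥ 0, the negative part of v - w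
lives on the true edges, so its ℓ¹ norm is at most √(s p) times its ℓ² norm, which the tests
control. The total weights are controlled too, hence the whole ℓ¹ deviations are of order
√(p₁/p₂)·√D and √(p₂/p₁)·√D (`l1_deviations_le`). Nonnegativity does the work usually asked of the
penalty, so the penalties need only be small.

Noise. With S the sample covariance, ⟨L(x, y), S - L†⟩ is bilinear. By Gaussian Chernoff bounds and
a union over edges it has size g√p₂, g√p₁ and g at (e, w₂), (w₁, f) and (e, f), where g = √(log p /
n). Expanding around the truth bounds the noise difference by g(√p₁ + √p₂)√D plus a small multiple
of D, so √D ≲ g√(p₁ + p₂). A crude bound D ≲ g p₁p₂ is needed beforehand to make the tests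
effective.

Conclusion. Tests from a fixed ℓ² ball give ‖L̂ - L*‖_F² ≲ D once D is below a small multiple of
min(p₁, p₂) (`sum_sq_rankOne_sub_le`); this is where n ≥ C(p₁/p₂ + p₂/p₁) log p enters. -/

namespace KSGL

/-! ### Weighted graphs: adjacency, degrees and edge sums. -/

section Graph

variable {p : ℕ}

lemma adj_symm (w : Edge p → ℝ) (i j : Fin p) : adj w i j = adj w j i := by
  rcases lt_trichotomy i j with h | h | h
  · simp [adj, h, h.not_gt]
  · simp [h]
  · simp [adj, h, h.not_gt]

lemma adj_self (w : Edge p → ℝ) (i : Fin p) : adj w i i = 0 := by simp [adj]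

lemma adj_edge (w : Edge p → ℝ) (e : Edge p) : adj w e.1.1 e.1.2 = w e := by
  simp [adj, e.2]

lemma adj_nonneg {w : Edge p → ℝ} (hw : ∀ e, 0 ≤ w e) (i j : Fin p) : 0 ≤ adj w i j := by
  unfold adj
  simp only [of_apply]
  split_ifs <;> first | exact hw _ | exact le_rfl

lemma adj_add (w w' : Edge p → ℝ) : adj (w + w') = adj w + adj w' := by
  ext i j
  simp only [adj, of_apply, Pi.add_apply, Matrix.add_apply]
  split_ifs <;> simp

lemma adj_smul (c : ℝ) (w : Edge p → ℝ) : adj (c • w) = c • adj w := by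
  ext i j
  simp only [adj, of_apply, Pi.smul_apply, Matrix.smul_apply]
  split_ifs <;> simp

lemma abs_adj (w : Edge p → ℝ) (i j : Fin p) : |adj w i j| = adj (fun e => |w e|) i j := by
  simp only [adj, of_apply]
  split_ifs <;> simp

lemma adj_mono {w w' : Edge p → ℝ} (h : ∀ e, w e ≤ w' e) (i j : Fin p) :
    adj w i j ≤ adj w' i j := by
  simp only [adj, of_apply]
  split_ifs <;> first | exact h _ | exact le_rfl

lemma degree_add (w w' : Edge p → ℝ) : degree (w + w') = degree w + degree w' := by
  ext i; simp [degree, adj_add, Finset.sum_add_distrib]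

lemma degree_smul (c : ℝ) (w : Edge p → ℝ) : degree (c • w) = c • degree w := by
  ext i; simp [degree, adj_smul, Finset.mul_sum]

lemma degree_nonneg {w : Edge p → ℝ} (hw : ∀ e, 0 ≤ w e) (i : Fin p) : 0 ≤ degree w i :=
  Finset.sum_nonneg fun j _ => adj_nonneg hw i j

lemma sum_edge_eq_sum_dite (f : Edge p → ℝ) :
    ∑ x : Fin p × Fin p, (if h : x.2 < x.1 then f ⟨x, h⟩ else 0) = ∑ e, f e := by
  classical
  rw [Finset.sum_dite, Finset.sum_const_zero, add_zero]
  refine Finset.sum_bij (fun x _ => ⟨x.1, (Finset.mem_filter.1 x.2).2⟩) (by simp) ?_ ?_ (by simp)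
  · rintro ⟨a, ha⟩ _ ⟨b, hb⟩ _ h
    simpa using h
  · rintro ⟨b, hb⟩ _
    exact ⟨⟨b, by simpa using hb⟩, by simp, rfl⟩

/-- Summing a symmetric function against an adjacency matrix counts every edge twice. -/
lemma sum_adj_mul (w : Edge p → ℝ) (g : Fin p → Fin p → ℝ) (hg : ∀ i j, g i j = g j i) :
    ∑ i, ∑ j, adj w i j * g i j = 2 * ∑ e, w e * g e.1.1 e.1.2 := by
  have h1 : ∑ i, ∑ j, adj w i j * g i j =
      ∑ x : Fin p × Fin p, ((if h : x.2 < x.1 then w ⟨x, h⟩ * g x.1 x.2 else 0) +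
        (if h : x.1 < x.2 then w ⟨(x.2, x.1), h⟩ * g x.1 x.2 else 0)) := by
    rw [← Fintype.sum_prod_type']
    refine Finset.sum_congr rfl fun x _ => ?_
    rcases lt_trichotomy x.1 x.2 with h | h | h
    · simp [adj, h, h.not_gt]
    · simp [adj, h]
    · simp [adj, h, h.not_gt]
  rw [h1, Finset.sum_add_distrib, two_mul]
  congr 1
  · exact sum_edge_eq_sum_dite fun e => w e * g e.1.1 e.1.2
  · rw [← sum_edge_eq_sum_dite fun e => w e * g e.1.1 e.1.2]
    refine Fintype.sum_equiv (Equiv.prodComm _ _) _ _ fun x => ?_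
    simp [hg x.1 x.2]
    rfl

lemma sum_adj_mul_adj (w x : Edge p → ℝ) :
    ∑ i, ∑ j, adj w i j * adj x i j = 2 * ∑ e, w e * x e := by
  rw [sum_adj_mul w _ (adj_symm x)]
  simp only [adj_edge]

lemma sum_degree (w : Edge p → ℝ) : ∑ i, degree w i = 2 * ∑ e, w e := by
  simpa [degree] using sum_adj_mul w (fun _ _ => 1) (by simp)

lemma trace_adj_mul_adj (w x : Edge p → ℝ) :
    (adj w * adj x).trace = 2 * ∑ e, w e * x e := by
  rw [← sum_adj_mul_adj]
  simp only [trace, diag, mul_apply]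
  exact Finset.sum_congr rfl fun i _ => Finset.sum_congr rfl fun j _ => by rw [adj_symm x j i]

lemma le_degree {w : Edge p → ℝ} (hw : ∀ e, 0 ≤ w e) (e : Edge p) : w e ≤ degree w e.1.1 := by
  rw [← adj_edge w e]
  exact Finset.single_le_sum (f := fun j => adj w e.1.1 j)
    (fun j _ => adj_nonneg hw _ j) (Finset.mem_univ _)

end Graph

/-! ### The Kronecker product Laplacian. -/

section Kron

variable {p₁ p₂ : ℕ}

lemma kronLaplacian_apply (w₁ : Edge p₁ → ℝ) (w₂ : Edge p₂ → ℝ) (x y : Fin p₁ × Fin p₂) :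
    kronLaplacian w₁ w₂ x y =
      (if x = y then degree w₁ x.1 * degree w₂ x.2 else 0) - adj w₁ x.1 y.1 * adj w₂ x.2 y.2 := by
  simp only [kronLaplacian, Matrix.sub_apply, kroneckerMap_apply, diagonal_apply, Prod.ext_iff]
  congr 1
  by_cases h1 : x.1 = y.1 <;> by_cases h2 : x.2 = y.2 <;> simp [h1, h2]

/-- The Kronecker product Laplacian as a bilinear map of the two weight vectors. -/
noncomputable def kronLaplacianBilin (p₁ p₂ : ℕ) :
    (Edge p₁ → ℝ) →ₗ[ℝ] (Edge p₂ → ℝ) →ₗ[ℝ] Matrix (Fin p₁ × Fin p₂) (Fin p₁ × Fin p₂) ℝ :=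
  LinearMap.mk₂ ℝ kronLaplacian
    (fun a b c => by
      ext x y; simp only [kronLaplacian_apply, Matrix.add_apply, adj_add, degree_add, Pi.add_apply]
      split_ifs <;> ring)
    (fun r a c => by
      ext x y
      simp only [kronLaplacian_apply, Matrix.smul_apply, adj_smul, degree_smul, Pi.smul_apply,
        smul_eq_mul]
      split_ifs <;> ring)
    (fun a b c => by
      ext x y; simp only [kronLaplacian_apply, Matrix.add_apply, adj_add, degree_add, Pi.add_apply]
      split_ifs <;> ring)
    (fun r a c => by
      ext x y
      simp only [kronLaplacian_apply, Matrix.smul_apply, adj_smul, degree_smul, Pi.smul_apply,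
        smul_eq_mul]
      split_ifs <;> ring)

lemma kronLaplacianBilin_apply (w₁ : Edge p₁ → ℝ) (w₂ : Edge p₂ → ℝ) :
    kronLaplacianBilin p₁ p₂ w₁ w₂ = kronLaplacian w₁ w₂ := rfl

/-- The factors are identified only up to this scaling. It is used to balance the penalties of the
truth and to normalise the estimate. -/
lemma kronLaplacian_smul_smul_inv {t : ℝ} (ht : t ≠ 0) (w₁ : Edge p₁ → ℝ) (w₂ : Edge p₂ → ℝ) :
    kronLaplacian (t • w₁) (t⁻¹ • w₂) = kronLaplacian w₁ w₂ := by
  simp [← kronLaplacianBilin_apply, smul_smul, ht]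

lemma kronLaplacian_transpose (w₁ : Edge p₁ → ℝ) (w₂ : Edge p₂ → ℝ) :
    (kronLaplacian w₁ w₂)ᵀ = kronLaplacian w₁ w₂ := by
  ext x y
  rw [transpose_apply, kronLaplacian_apply, kronLaplacian_apply, adj_symm w₁ y.1,
    adj_symm w₂ y.2]
  congr 1
  by_cases h : x = y
  · simp [h]
  · rw [if_neg h, if_neg (Ne.symm h)]

lemma sum_kronLaplacian_row (w₁ : Edge p₁ → ℝ) (w₂ : Edge p₂ → ℝ) (x : Fin p₁ × Fin p₂) :
    ∑ y, kronLaplacian w₁ w₂ x y = 0 := by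
  simp only [kronLaplacian_apply, Finset.sum_sub_distrib]
  rw [Fintype.sum_prod_type (f := fun y : Fin p₁ × Fin p₂ => adj w₁ x.1 y.1 * adj w₂ x.2 y.2)]
  simp [← Finset.mul_sum, ← Finset.sum_mul, degree]

lemma kronLaplacian_mul_avgMatrix (w₁ : Edge p₁ → ℝ) (w₂ : Edge p₂ → ℝ) :
    kronLaplacian w₁ w₂ * avgMatrix (Fin p₁ × Fin p₂) = 0 := by
  ext x y
  simp [mul_apply, avgMatrix, ← Finset.sum_mul, sum_kronLaplacian_row]

lemma avgMatrix_transpose (ι : Type*) [Fintype ι] : (avgMatrix ι)ᵀ = avgMatrix ι := by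
  ext x y; simp [avgMatrix]

lemma dotProduct_mulVec_eq_sum {ι : Type*} [Fintype ι] (A : Matrix ι ι ℝ) (ξ : ι → ℝ) :
    ξ ⬝ᵥ A *ᵥ ξ = ∑ x, ∑ y, A x y * ξ x * ξ y := by
  simp only [dotProduct, mulVec, Finset.mul_sum]
  exact Finset.sum_congr rfl fun x _ => Finset.sum_congr rfl fun y _ => by ring

lemma sum_adj_prod_left (w₁ : Edge p₁ → ℝ) (w₂ : Edge p₂ → ℝ) (f : Fin p₁ × Fin p₂ → ℝ) :
    ∑ x : Fin p₁ × Fin p₂, ∑ y : Fin p₁ × Fin p₂, adj w₁ x.1 y.1 * adj w₂ x.2 y.2 * f x =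
      ∑ x : Fin p₁ × Fin p₂, degree w₁ x.1 * degree w₂ x.2 * f x := by
  refine Finset.sum_congr rfl fun x _ => ?_
  rw [← Finset.sum_mul, Fintype.sum_prod_type]
  simp [← Finset.mul_sum, ← Finset.sum_mul, degree]

lemma sum_adj_prod_right (w₁ : Edge p₁ → ℝ) (w₂ : Edge p₂ → ℝ) (f : Fin p₁ × Fin p₂ → ℝ) :
    ∑ x : Fin p₁ × Fin p₂, ∑ y : Fin p₁ × Fin p₂, adj w₁ x.1 y.1 * adj w₂ x.2 y.2 * f y =
      ∑ x : Fin p₁ × Fin p₂, degree w₁ x.1 * degree w₂ x.2 * f x := by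
  rw [Finset.sum_comm, ← sum_adj_prod_left]
  exact Finset.sum_congr rfl fun x _ => Finset.sum_congr rfl fun y _ => by
    rw [adj_symm w₁ y.1, adj_symm w₂ y.2]

/-- The product graph has adjacency `W₁ ⊗ W₂` and product degrees, so this is its Dirichlet form. -/
lemma kronLaplacian_form (w₁ : Edge p₁ → ℝ) (w₂ : Edge p₂ → ℝ) (ξ : Fin p₁ × Fin p₂ → ℝ) :
    ξ ⬝ᵥ kronLaplacian w₁ w₂ *ᵥ ξ =
      2⁻¹ * ∑ x, ∑ y, adj w₁ x.1 y.1 * adj w₂ x.2 y.2 * (ξ x - ξ y) ^ 2 := by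
  have hL := sum_adj_prod_left w₁ w₂ fun x => ξ x ^ 2
  have hR := sum_adj_prod_right w₁ w₂ fun x => ξ x ^ 2
  have h1 : ∑ x : Fin p₁ × Fin p₂, ∑ y : Fin p₁ × Fin p₂,
        adj w₁ x.1 y.1 * adj w₂ x.2 y.2 * (ξ x - ξ y) ^ 2 =
      ∑ x : Fin p₁ × Fin p₂, ∑ y : Fin p₁ × Fin p₂, adj w₁ x.1 y.1 * adj w₂ x.2 y.2 * ξ x ^ 2 +
      ∑ x : Fin p₁ × Fin p₂, ∑ y : Fin p₁ × Fin p₂, adj w₁ x.1 y.1 * adj w₂ x.2 y.2 * ξ y ^ 2 -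
      2 * ∑ x : Fin p₁ × Fin p₂, ∑ y : Fin p₁ × Fin p₂,
        adj w₁ x.1 y.1 * adj w₂ x.2 y.2 * ξ x * ξ y := by
    simp only [Finset.mul_sum, ← Finset.sum_add_distrib, ← Finset.sum_sub_distrib]
    exact Finset.sum_congr rfl fun x _ => Finset.sum_congr rfl fun y _ => by ring
  rw [h1, hL, hR, dotProduct_mulVec_eq_sum]
  simp only [kronLaplacian_apply, sub_mul, Finset.sum_sub_distrib, ite_mul, zero_mul,
    Finset.sum_ite_eq, Finset.mem_univ, if_true]
  have h2 : ∑ x : Fin p₁ × Fin p₂, degree w₁ x.1 * degree w₂ x.2 * ξ x * ξ x =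
      ∑ x : Fin p₁ × Fin p₂, degree w₁ x.1 * degree w₂ x.2 * ξ x ^ 2 :=
    Finset.sum_congr rfl fun x _ => by ring
  rw [h2]; ring

lemma kronLaplacian_form_nonneg {w₁ : Edge p₁ → ℝ} {w₂ : Edge p₂ → ℝ} (h₁ : ∀ e, 0 ≤ w₁ e)
    (h₂ : ∀ e, 0 ≤ w₂ e) (ξ : Fin p₁ × Fin p₂ → ℝ) : 0 ≤ ξ ⬝ᵥ kronLaplacian w₁ w₂ *ᵥ ξ := by
  rw [kronLaplacian_form]
  refine mul_nonneg (by norm_num) (Finset.sum_nonneg fun x _ => Finset.sum_nonneg fun y _ => ?_)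
  exact mul_nonneg (mul_nonneg (adj_nonneg h₁ _ _) (adj_nonneg h₂ _ _)) (sq_nonneg _)

lemma kronLaplacian_posSemidef {w₁ : Edge p₁ → ℝ} {w₂ : Edge p₂ → ℝ} (h₁ : ∀ e, 0 ≤ w₁ e)
    (h₂ : ∀ e, 0 ≤ w₂ e) : (kronLaplacian w₁ w₂).PosSemidef := by
  refine PosSemidef.of_dotProduct_mulVec_nonneg ?_ fun ξ => ?_
  · rw [IsHermitian, conjTranspose_eq_transpose_of_trivial, kronLaplacian_transpose]
  · simpa using kronLaplacian_form_nonneg h₁ h₂ ξ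

lemma kronLaplacian_form_le {w₁ : Edge p₁ → ℝ} {w₂ : Edge p₂ → ℝ} (h₁ : ∀ e, 0 ≤ w₁ e)
    (h₂ : ∀ e, 0 ≤ w₂ e) {K : ℝ} (hK : ∀ i j, degree w₁ i * degree w₂ j ≤ K)
    (ξ : Fin p₁ × Fin p₂ → ℝ) : ξ ⬝ᵥ kronLaplacian w₁ w₂ *ᵥ ξ ≤ 2 * K * (ξ ⬝ᵥ ξ) := by
  have h : ∑ x : Fin p₁ × Fin p₂, ∑ y : Fin p₁ × Fin p₂,
        adj w₁ x.1 y.1 * adj w₂ x.2 y.2 * (ξ x - ξ y) ^ 2 ≤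
      ∑ x : Fin p₁ × Fin p₂, ∑ y : Fin p₁ × Fin p₂,
        (2 * (adj w₁ x.1 y.1 * adj w₂ x.2 y.2 * ξ x ^ 2) +
          2 * (adj w₁ x.1 y.1 * adj w₂ x.2 y.2 * ξ y ^ 2)) := by
    refine Finset.sum_le_sum fun x _ => Finset.sum_le_sum fun y _ => ?_
    have := mul_nonneg (adj_nonneg h₁ x.1 y.1) (adj_nonneg h₂ x.2 y.2)
    nlinarith [mul_nonneg this (sq_nonneg (ξ x + ξ y))]
  simp only [Finset.sum_add_distrib, ← Finset.mul_sum] at h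
  rw [sum_adj_prod_left w₁ w₂ fun x => ξ x ^ 2, sum_adj_prod_right w₁ w₂ fun x => ξ x ^ 2] at h
  have h2 : ∑ x : Fin p₁ × Fin p₂, degree w₁ x.1 * degree w₂ x.2 * ξ x ^ 2 ≤ K * (ξ ⬝ᵥ ξ) := by
    rw [dotProduct, Finset.mul_sum]
    refine Finset.sum_le_sum fun x _ => ?_
    nlinarith [hK x.1 x.2, sq_nonneg (ξ x)]
  rw [kronLaplacian_form]
  linarith

lemma trace_kronLaplacian (w₁ : Edge p₁ → ℝ) (w₂ : Edge p₂ → ℝ) :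
    (kronLaplacian w₁ w₂).trace = 4 * ((∑ e, w₁ e) * ∑ e, w₂ e) := by
  have h1 := sum_degree w₁
  have h2 := sum_degree w₂
  rw [kronLaplacian, trace_sub, trace_kronecker, trace_kronecker]
  simp only [trace_diagonal, h1, h2]
  simp only [trace, diag, adj_self, Finset.sum_const_zero]
  ring

/-- The term with `W₁ ⊗ W₂` drops out because adjacency matrices have zero diagonal; in the
companion for `adj x ⊗ₖ adj y` it is the degree term that drops out. -/
lemma trace_kron_diagonal_mul_kronLaplacian (x : Fin p₁ → ℝ) (y : Fin p₂ → ℝ)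
    (w₁ : Edge p₁ → ℝ) (w₂ : Edge p₂ → ℝ) :
    ((diagonal x ⊗ₖ diagonal y) * kronLaplacian w₁ w₂).trace =
      (∑ i, x i * degree w₁ i) * ∑ j, y j * degree w₂ j := by
  rw [kronLaplacian, mul_sub, ← mul_kronecker_mul, ← mul_kronecker_mul, trace_sub,
    trace_kronecker, trace_kronecker, diagonal_mul_diagonal, diagonal_mul_diagonal]
  simp [trace, diag, diagonal_mul, adj_self]

lemma trace_kron_adj_mul_kronLaplacian (x w₁ : Edge p₁ → ℝ) (y w₂ : Edge p₂ → ℝ) :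
    ((adj x ⊗ₖ adj y) * kronLaplacian w₁ w₂).trace =
      -(4 * ((∑ e, x e * w₁ e) * ∑ e, y e * w₂ e)) := by
  rw [kronLaplacian, mul_sub, ← mul_kronecker_mul, ← mul_kronecker_mul, trace_sub,
    trace_kronecker, trace_kronecker, trace_adj_mul_adj, trace_adj_mul_adj]
  simp [trace, diag, mul_diagonal, adj_self]
  ring

end Kron

/-! ### Operator bounds for entrywise absolute values. -/

section FormBound

variable {ι κ : Type*} [Fintype ι] [Fintype κ]

/-- The entrywise absolute value of `A` is bounded by `a` as a bilinear form on `ℓ²`. -/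
def AbsFormBound (A : Matrix ι ι ℝ) (a : ℝ) : Prop :=
  ∀ f g : ι → ℝ, (∀ i, 0 ≤ f i) → (∀ i, 0 ≤ g i) →
    ∑ i, ∑ j, |A i j| * f i * g j ≤ a * (√(∑ i, f i ^ 2) * √(∑ i, g i ^ 2))

/-- Schur's test: Cauchy–Schwarz with the weight `|A i j|` split evenly between the two functions.
-/
lemma absFormBound_of_rowSum {A : Matrix ι ι ℝ} {a : ℝ} (hA : ∀ i j, |A i j| = |A j i|)
    (h : ∀ i, ∑ j, |A i j| ≤ a) : AbsFormBound A a := by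
  intro f g hf hg
  rcases isEmpty_or_nonempty ι with he | ⟨⟨i₀⟩⟩
  · simp
  have ha : 0 ≤ a := le_trans (Finset.sum_nonneg fun j _ => abs_nonneg _) (h i₀)
  have h1 : ∑ i, ∑ j, |A i j| * f i * g j ≤
      √(∑ x : ι × ι, |A x.1 x.2| * f x.1 ^ 2) * √(∑ x : ι × ι, |A x.1 x.2| * g x.2 ^ 2) := by
    rw [← Fintype.sum_prod_type']
    have := Real.sum_mul_le_sqrt_mul_sqrt Finset.univ
      (fun x : ι × ι => √|A x.1 x.2| * f x.1) (fun x : ι × ι => √|A x.1 x.2| * g x.2)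
    simp only [mul_pow, Real.sq_sqrt (abs_nonneg _)] at this
    refine (le_of_eq (Finset.sum_congr rfl fun x _ => ?_)).trans this
    linear_combination (-(f x.1 * g x.2)) * Real.mul_self_sqrt (abs_nonneg (A x.1 x.2))
  have h2 : ∑ x : ι × ι, |A x.1 x.2| * f x.1 ^ 2 ≤ a * ∑ i, f i ^ 2 := by
    rw [Fintype.sum_prod_type, Finset.mul_sum]
    refine Finset.sum_le_sum fun i _ => ?_
    simp only [← Finset.sum_mul]
    exact mul_le_mul_of_nonneg_right (h i) (sq_nonneg _)
  have h3 : ∑ x : ι × ι, |A x.1 x.2| * g x.2 ^ 2 ≤ a * ∑ i, g i ^ 2 := by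
    rw [Fintype.sum_prod_type_right, Finset.mul_sum]
    refine Finset.sum_le_sum fun i _ => ?_
    simp only [← Finset.sum_mul, hA _ i]
    exact mul_le_mul_of_nonneg_right (h i) (sq_nonneg _)
  refine h1.trans ((mul_le_mul (Real.sqrt_le_sqrt h2) (Real.sqrt_le_sqrt h3)
    (Real.sqrt_nonneg _) (Real.sqrt_nonneg _)).trans (le_of_eq ?_))
  rw [Real.sqrt_mul ha, Real.sqrt_mul ha]
  linear_combination (√(∑ i, f i ^ 2) * √(∑ i, g i ^ 2)) * Real.mul_self_sqrt ha

lemma absFormBound_of_sum_sq (A : Matrix ι ι ℝ) :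
    AbsFormBound A √(∑ i, ∑ j, A i j ^ 2) := by
  intro f g hf hg
  have h := Real.sum_mul_le_sqrt_mul_sqrt Finset.univ (fun x : ι × ι => |A x.1 x.2|)
    (fun x : ι × ι => f x.1 * g x.2)
  simp only [Fintype.sum_prod_type, sq_abs, mul_pow, ← Finset.mul_sum, ← Finset.sum_mul] at h
  rw [Real.sqrt_mul (Finset.sum_nonneg fun _ _ => sq_nonneg _)] at h
  simpa only [mul_assoc] using h

/-- With absolute values inside, `B` can be applied fibre by fibre and `A` then to the ℓ² norms of
the fibres, so the bounds multiply. -/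
lemma AbsFormBound.kronecker {A : Matrix ι ι ℝ} {B : Matrix κ κ ℝ} {a b : ℝ}
    (hA : AbsFormBound A a) (hB : AbsFormBound B b) (hb : 0 ≤ b) :
    AbsFormBound (A ⊗ₖ B) (a * b) := by
  intro f g hf hg
  have h1 : ∑ x, ∑ y, |(A ⊗ₖ B) x y| * f x * g y =
      ∑ i, ∑ i', |A i i'| * ∑ j, ∑ j', |B j j'| * f (i, j) * g (i', j') := by
    simp only [Fintype.sum_prod_type, kroneckerMap_apply, abs_mul, Finset.mul_sum]
    refine Finset.sum_congr rfl fun i _ => ?_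
    rw [Finset.sum_comm]
    exact Finset.sum_congr rfl fun i' _ => Finset.sum_congr rfl fun j _ =>
      Finset.sum_congr rfl fun j' _ => by ring
  have h2 := hA (fun i => √(∑ j, f (i, j) ^ 2)) (fun i => √(∑ j, g (i, j) ^ 2))
    (fun _ => Real.sqrt_nonneg _) (fun _ => Real.sqrt_nonneg _)
  have hsq : ∀ (h : ι × κ → ℝ), ∑ i, √(∑ j, h (i, j) ^ 2) ^ 2 = ∑ x, h x ^ 2 := fun h => by
    rw [Fintype.sum_prod_type]
    exact Finset.sum_congr rfl fun i _ => Real.sq_sqrt (Finset.sum_nonneg fun _ _ => sq_nonneg _)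
  rw [hsq, hsq] at h2
  rw [h1]
  calc _ ≤ ∑ i, ∑ i', b * (|A i i'| * √(∑ j, f (i, j) ^ 2) * √(∑ j, g (i', j) ^ 2)) := by
        refine Finset.sum_le_sum fun i _ => Finset.sum_le_sum fun i' _ => ?_
        have := hB (fun j => f (i, j)) (fun j => g (i', j)) (fun _ => hf _) (fun _ => hg _)
        calc _ ≤ |A i i'| * _ := mul_le_mul_of_nonneg_left this (abs_nonneg _)
          _ = _ := by ring
    _ ≤ _ := by
        simp only [← Finset.mul_sum]
        calc _ ≤ b * _ := mul_le_mul_of_nonneg_left h2 hb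
          _ = _ := by ring

lemma AbsFormBound.abs_form_le {A : Matrix ι ι ℝ} {a : ℝ} (hA : AbsFormBound A a) (ξ : ι → ℝ) :
    |ξ ⬝ᵥ A *ᵥ ξ| ≤ a * (ξ ⬝ᵥ ξ) := by
  have h := hA (fun i => |ξ i|) (fun i => |ξ i|) (fun _ => abs_nonneg _) (fun _ => abs_nonneg _)
  rw [Real.mul_self_sqrt (Finset.sum_nonneg fun _ _ => sq_nonneg _)] at h
  rw [dotProduct_mulVec_eq_sum]
  calc _ ≤ ∑ i, ∑ j, |A i j| * |ξ i| * |ξ j| := by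
        refine (Finset.abs_sum_le_sum_abs _ _).trans (Finset.sum_le_sum fun i _ => ?_)
        refine (Finset.abs_sum_le_sum_abs _ _).trans (le_of_eq ?_)
        simp only [abs_mul]
    _ ≤ _ := h
    _ = _ := by simp [dotProduct, sq]

lemma adj_absFormBound_of_le {p : ℕ} {x w : Edge p → ℝ} {d : ℝ} (hxw : ∀ e, |x e| ≤ w e)
    (hd : ∀ i, degree w i ≤ d) : AbsFormBound (adj x) d := by
  refine absFormBound_of_rowSum (fun i j => by rw [adj_symm]) fun i => le_trans ?_ (hd i)
  refine Finset.sum_le_sum fun j _ => ?_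
  rw [abs_adj]
  exact adj_mono hxw i j

lemma adj_absFormBound_of_sum_sq {p : ℕ} (x : Edge p → ℝ) :
    AbsFormBound (adj x) √(2 * ∑ e, x e ^ 2) := by
  have h := absFormBound_of_sum_sq (adj x)
  have h2 := sum_adj_mul_adj x x
  simp only [← sq] at h2
  rwa [h2] at h

end FormBound

/-! ### Spectral inequalities and the log-determinant divergence. -/

section Spectral

variable {ι : Type*} [Fintype ι] [DecidableEq ι]

lemma form_eq_sum_eigenvalues {A : Matrix ι ι ℝ} (hA : A.IsHermitian) (ξ : ι → ℝ) :
    ∃ c : ι → ℝ, ξ ⬝ᵥ A *ᵥ ξ = ∑ i, hA.eigenvalues i * c i ^ 2 ∧ ξ ⬝ᵥ ξ = ∑ i, c i ^ 2 := by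
  set U : Matrix ι ι ℝ := (hA.eigenvectorUnitary : Matrix ι ι ℝ) with hU
  have hUU : U * star U = 1 := Unitary.coe_mul_star_self _
  have hspec : A = U * diagonal hA.eigenvalues * star U := by
    conv_lhs => rw [hA.spectral_theorem]
    rfl
  have hst : star U = Uᵀ := by rw [star_eq_conjTranspose, conjTranspose_eq_transpose_of_trivial]
  rw [hst] at hspec hUU
  refine ⟨Uᵀ *ᵥ ξ, ?_, ?_⟩
  · have h1 : ξ ⬝ᵥ A *ᵥ ξ = (Uᵀ *ᵥ ξ) ⬝ᵥ (diagonal hA.eigenvalues *ᵥ (Uᵀ *ᵥ ξ)) := by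
      conv_lhs => rw [hspec]
      rw [← mulVec_mulVec, ← mulVec_mulVec, dotProduct_mulVec ξ U, mulVec_transpose]
    rw [h1]
    simp only [dotProduct, mulVec_diagonal]
    exact Finset.sum_congr rfl fun i _ => by ring
  · have h1 : ξ ⬝ᵥ ξ = (Uᵀ *ᵥ ξ) ⬝ᵥ (Uᵀ *ᵥ ξ) := by
      rw [mulVec_transpose, ← dotProduct_mulVec, ← mulVec_transpose, mulVec_mulVec, hUU,
        one_mulVec]
    rw [h1]
    simp only [dotProduct, sq]

lemma form_le_of_eigenvalues_le {A : Matrix ι ι ℝ} (hA : A.IsHermitian) {b : ℝ}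
    (hb : ∀ i, hA.eigenvalues i ≤ b) (ξ : ι → ℝ) : ξ ⬝ᵥ A *ᵥ ξ ≤ b * (ξ ⬝ᵥ ξ) := by
  obtain ⟨c, h1, h2⟩ := form_eq_sum_eigenvalues hA ξ
  rw [h1, h2, Finset.mul_sum]
  exact Finset.sum_le_sum fun i _ => mul_le_mul_of_nonneg_right (hb i) (sq_nonneg _)

lemma le_form_of_le_eigenvalues {A : Matrix ι ι ℝ} (hA : A.IsHermitian) {b : ℝ}
    (hb : ∀ i, b ≤ hA.eigenvalues i) (ξ : ι → ℝ) : b * (ξ ⬝ᵥ ξ) ≤ ξ ⬝ᵥ A *ᵥ ξ := by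
  obtain ⟨c, h1, h2⟩ := form_eq_sum_eigenvalues hA ξ
  rw [h1, h2, Finset.mul_sum]
  exact Finset.sum_le_sum fun i _ => mul_le_mul_of_nonneg_right (hb i) (sq_nonneg _)

lemma exists_eigenvector_form {A : Matrix ι ι ℝ} (hA : A.IsHermitian) (i : ι) :
    ∃ ξ : ι → ℝ, ξ ⬝ᵥ ξ = 1 ∧ ξ ⬝ᵥ A *ᵥ ξ = hA.eigenvalues i := by
  refine ⟨⇑(hA.eigenvectorBasis i), ?_, ?_⟩
  · have h := hA.eigenvectorBasis.orthonormal.1 i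
    have h2 := EuclideanSpace.real_norm_sq_eq (hA.eigenvectorBasis i)
    rw [h] at h2
    simp only [dotProduct, ← sq]
    rw [← h2]; norm_num
  · have h := hA.eigenvalues_eq i
    simpa using h.symm

lemma trace_mul_self_eq_sum_eigenvalues {A : Matrix ι ι ℝ} (hA : A.IsHermitian) :
    (A * A).trace = ∑ i, hA.eigenvalues i ^ 2 := by
  set U : Matrix ι ι ℝ := (hA.eigenvectorUnitary : Matrix ι ι ℝ) with hU
  have hUU : star U * U = 1 := Unitary.coe_star_mul_self _
  have hspec : A = U * diagonal hA.eigenvalues * star U := by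
    conv_lhs => rw [hA.spectral_theorem]
    rfl
  have h : A * A = U * (diagonal hA.eigenvalues * diagonal hA.eigenvalues) * star U := by
    conv_lhs => rw [hspec]
    calc _ = U * diagonal hA.eigenvalues * (star U * U) * diagonal hA.eigenvalues * star U := by
          simp only [mul_assoc]
      _ = _ := by rw [hUU, mul_one]; simp only [mul_assoc]
  rw [h, trace_mul_comm, ← mul_assoc, hUU, one_mul, diagonal_mul_diagonal, trace_diagonal]
  exact Finset.sum_congr rfl fun i _ => by ring

lemma trace_eq_sum_eigenvalues_real {A : Matrix ι ι ℝ} (hA : A.IsHermitian) :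
    A.trace = ∑ i, hA.eigenvalues i := by simpa using hA.trace_eq_sum_eigenvalues

/-- `log x ≤ x - 1` summed over the eigenvalues. -/
lemma log_det_le_trace_sub_card {A : Matrix ι ι ℝ} (hA : A.PosDef) :
    Real.log A.det ≤ A.trace - Fintype.card ι := by
  rw [trace_eq_sum_eigenvalues_real hA.1, hA.1.det_eq_prod_eigenvalues]
  simp only [RCLike.ofReal_real_eq_id, id]
  rw [Real.log_prod fun i _ => (hA.eigenvalues_pos i).ne']
  calc _ ≤ ∑ i, (hA.1.eigenvalues i - 1) :=
        Finset.sum_le_sum fun i _ => Real.log_le_sub_one_of_pos (hA.eigenvalues_pos i)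
    _ = _ := by simp [Finset.sum_sub_distrib]

/-- The scalar inequality behind both the curvature of the log-determinant and the exponential
moment of a squared Gaussian. -/
lemma neg_sq_le_add_log_one_sub {x : ℝ} (hx : |x| ≤ 1 / 2) : -x ^ 2 ≤ x + Real.log (1 - x) := by
  have h := abs_le.1 hx
  have hpos : 0 < 1 - x := by linarith
  have h1 := Real.one_sub_inv_le_log_of_pos hpos
  have h2 : Real.exp (-x - x ^ 2) ≤ 1 - x := by
    rcases le_or_gt 0 x with h0 | h0
    · have : 1 + (x + x ^ 2) + (x + x ^ 2) ^ 2 / 2 ≤ Real.exp (x + x ^ 2) :=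
        Real.quadratic_le_exp_of_nonneg (by positivity)
      rw [show -x - x ^ 2 = -(x + x ^ 2) by ring, Real.exp_neg]
      rw [inv_le_comm₀ (Real.exp_pos _) hpos]
      refine le_trans ?_ this
      rw [inv_le_iff_one_le_mul₀ hpos]
      nlinarith [pow_nonneg h0 2, pow_nonneg h0 3, pow_nonneg h0 4, mul_nonneg h0 (sub_nonneg.2 h.2),
        mul_nonneg (pow_nonneg h0 2) (sub_nonneg.2 h.2), mul_nonneg (pow_nonneg h0 3) (sub_nonneg.2 h.2)]
    -- With `y = -x - x²`, the Taylor bound `exp y ≤ 1 + y + y²` suffices, since `y² ≤ x²` for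
    -- negative `x` in this range.
    · have hb : |(-x - x ^ 2)| ≤ 1 := by rw [abs_le]; constructor <;> nlinarith
      have h3 := Real.abs_exp_sub_one_sub_id_le hb
      have h4 := (abs_le.1 h3).2
      have h5 : 0 ≤ x ^ 2 * (-x * (2 + x)) :=
        mul_nonneg (sq_nonneg x) (mul_nonneg (by linarith) (by linarith))
      nlinarith
  have h3 := (Real.le_log_iff_exp_le hpos).2 h2
  linarith

lemma neg_trace_sq_le_trace_add_log_det {U : Matrix ι ι ℝ} (hU : U.IsHermitian)
    (h : ∀ ξ : ι → ℝ, |ξ ⬝ᵥ U *ᵥ ξ| ≤ 1 / 2 * (ξ ⬝ᵥ ξ)) :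
    -(U * U).trace ≤ U.trace + Real.log (1 - U).det := by
  have hev : ∀ i, |hU.eigenvalues i| ≤ 1 / 2 := fun i => by
    obtain ⟨ξ, h1, h2⟩ := exists_eigenvector_form hU i
    simpa [h1, h2] using h ξ
  have hdet : (1 - U).det = ∏ i, (1 - hU.eigenvalues i) := by
    have h1 := congrArg (Polynomial.eval 1) hU.charpoly_eq
    rw [Matrix.eval_charpoly, Polynomial.eval_prod] at h1
    simpa using h1
  rw [hdet, trace_mul_self_eq_sum_eigenvalues hU, trace_eq_sum_eigenvalues_real hU,
    Real.log_prod fun i _ => by have := abs_le.1 (hev i); linarith, ← Finset.sum_add_distrib,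
    ← Finset.sum_neg_distrib]
  exact Finset.sum_le_sum fun i _ => neg_sq_le_add_log_one_sub (hev i)

lemma trace_conj_le {M : Matrix ι ι ℝ} {z : ℝ} (h : ∀ ξ : ι → ℝ, ξ ⬝ᵥ M *ᵥ ξ ≤ z * (ξ ⬝ᵥ ξ))
    (B : Matrix ι ι ℝ) : (Bᵀ * M * B).trace ≤ z * (Bᵀ * B).trace := by
  have h1 : ∀ N : Matrix ι ι ℝ, (Bᵀ * N * B).trace = ∑ j, (fun i => B i j) ⬝ᵥ N *ᵥ (fun i => B i j) := by
    intro N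
    simp only [trace, diag, mul_apply, dotProduct, mulVec, transpose_apply, Finset.sum_mul,
      Finset.mul_sum]
    refine Finset.sum_congr rfl fun j _ => ?_
    rw [Finset.sum_comm]
    exact Finset.sum_congr rfl fun i _ => Finset.sum_congr rfl fun k _ => by ring
  have h2 := h1 1
  simp only [mul_one, one_mulVec] at h2
  rw [h1, h2, Finset.mul_sum]
  exact Finset.sum_le_sum fun j _ => h _

open scoped MatrixOrder Matrix.Norms.L2Operator in
lemma exists_transpose_mul_self {A : Matrix ι ι ℝ} (hA : A.PosSemidef) :
    ∃ Q : Matrix ι ι ℝ, A = Qᵀ * Q := by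
  obtain ⟨Q, hQ⟩ := CStarAlgebra.nonneg_iff_eq_star_mul_self.mp hA.nonneg
  exact ⟨Q, by rw [hQ, star_eq_conjTranspose, conjTranspose_eq_transpose_of_trivial]⟩

/-- Variational lower bound for the log-determinant Bregman divergence between `N` and `M`. -/
lemma trace_test_le {M N V : Matrix ι ι ℝ} {z : ℝ} (hz : 0 < z) (hM : M.PosDef) (hN : N.PosDef)
    (hMz : ∀ ξ : ι → ℝ, ξ ⬝ᵥ M *ᵥ ξ ≤ z * (ξ ⬝ᵥ ξ)) (hV : Vᵀ = V)
    (hVz : ∀ ξ : ι → ℝ, |ξ ⬝ᵥ V *ᵥ ξ| ≤ 1 / (2 * z) * (ξ ⬝ᵥ ξ)) :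
    (V * (N - M)).trace ≤
      (M⁻¹ * (N - M)).trace - Real.log N.det + Real.log M.det + z ^ 2 * (V * V).trace := by
  obtain ⟨Q, hQ, hMQ⟩ : ∃ Q : Matrix ι ι ℝ, IsUnit Q ∧ M = Qᵀ * Q := by
    obtain ⟨Q, hQ⟩ := exists_transpose_mul_self hM.posSemidef
    refine ⟨Q, ?_, hQ⟩
    rw [isUnit_iff_isUnit_det, isUnit_iff_ne_zero]
    intro h0
    have := hM.det_pos
    rw [hQ, det_mul, h0, mul_zero] at this
    exact lt_irrefl _ this
  have hQd : IsUnit Q.det := (isUnit_iff_isUnit_det Q).1 hQ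
  have hQtd : IsUnit Qᵀ.det := by rwa [det_transpose]
  set R := Q⁻¹ with hR
  have hQR : Q * R = 1 := mul_nonsing_inv _ hQd
  have hRQ : R * Q = 1 := nonsing_inv_mul _ hQd
  have hMinv : M⁻¹ = R * Rᵀ := by
    refine inv_eq_right_inv ?_
    rw [hMQ]
    calc Qᵀ * Q * (R * Rᵀ) = Qᵀ * (Q * R) * Rᵀ := by simp only [mul_assoc]
      _ = (R * Q)ᵀ := by rw [hQR, mul_one, transpose_mul]
      _ = 1 := by rw [hRQ, transpose_one]
  set U := Q * V * Qᵀ with hUdef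
  have hUsymm : Uᵀ = U := by
    rw [hUdef, transpose_mul, transpose_mul, transpose_transpose, hV, mul_assoc]
  have hUherm : U.IsHermitian := by
    rw [IsHermitian, conjTranspose_eq_transpose_of_trivial, hUsymm]
  have hUform : ∀ ξ : ι → ℝ, |ξ ⬝ᵥ U *ᵥ ξ| ≤ 1 / 2 * (ξ ⬝ᵥ ξ) := by
    intro ξ
    have h1 : ξ ⬝ᵥ U *ᵥ ξ = (Qᵀ *ᵥ ξ) ⬝ᵥ V *ᵥ (Qᵀ *ᵥ ξ) := by
      rw [hUdef, ← mulVec_mulVec, ← mulVec_mulVec, dotProduct_mulVec ξ Q, mulVec_transpose]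
    -- The upper bound on `QᵀQ = M` passes to `QQᵀ` by Cauchy–Schwarz.
    have h2 : (Qᵀ *ᵥ ξ) ⬝ᵥ (Qᵀ *ᵥ ξ) ≤ z * (ξ ⬝ᵥ ξ) := by
      set η := Qᵀ *ᵥ ξ with hη
      have h3 : η ⬝ᵥ η = ξ ⬝ᵥ (Q *ᵥ η) := by
        rw [dotProduct_mulVec ξ Q, hη, mulVec_transpose]
      have h4 : (Q *ᵥ η) ⬝ᵥ (Q *ᵥ η) ≤ z * (η ⬝ᵥ η) := by
        have := hMz η
        rwa [hMQ, ← mulVec_mulVec, dotProduct_mulVec, ← mulVec_transpose,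
          transpose_transpose] at this
      have h5 : (ξ ⬝ᵥ (Q *ᵥ η)) ^ 2 ≤ (ξ ⬝ᵥ ξ) * ((Q *ᵥ η) ⬝ᵥ (Q *ᵥ η)) := by
        simpa [dotProduct, sq] using
          Finset.sum_mul_sq_le_sq_mul_sq Finset.univ ξ (Q *ᵥ η)
      have h6 : 0 ≤ ξ ⬝ᵥ ξ := by simpa using dotProduct_star_self_nonneg ξ
      have h7 : 0 ≤ η ⬝ᵥ η := by simpa using dotProduct_star_self_nonneg η
      rw [← h3] at h5
      rcases h7.eq_or_lt with h8 | h8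
      · rw [← h8]; positivity
      · nlinarith [mul_le_mul_of_nonneg_left h4 h6]
    rw [h1]
    calc _ ≤ _ := hVz _
      _ ≤ 1 / (2 * z) * (z * (ξ ⬝ᵥ ξ)) := by gcongr
      _ = _ := by field_simp
  have hlog := neg_trace_sq_le_trace_add_log_det hUherm hUform
  have hUtr : U.trace = (V * M).trace := by
    rw [hUdef, hMQ, mul_assoc, trace_mul_comm, mul_assoc]
  -- `tr U² = tr (V M V M)`: each occurrence of `M` costs one factor `z`.
  have hUsq : (U * U).trace ≤ z ^ 2 * (V * V).trace := by
    have h1 := trace_conj_le hMz (V * Qᵀ)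
    have h2 := trace_conj_le hMz V
    have e1 : (U * U).trace = ((V * Qᵀ)ᵀ * M * (V * Qᵀ)).trace := by
      rw [hUdef, hMQ, transpose_mul, transpose_transpose, hV]
      simp only [mul_assoc]
    have e2 : ((V * Qᵀ)ᵀ * (V * Qᵀ)).trace = (Vᵀ * M * V).trace := by
      rw [transpose_mul, transpose_transpose, hV, hMQ, trace_mul_comm (Q * V)]
      simp only [mul_assoc]
    rw [hV] at h2 e2
    rw [e1]
    rw [e2] at h1
    nlinarith [mul_le_mul_of_nonneg_left h2 hz.le]
  have hPpos : (1 - U).PosDef := by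
    refine PosDef.of_dotProduct_mulVec_pos ?_ fun ξ hξ => ?_
    · rw [IsHermitian, conjTranspose_eq_transpose_of_trivial, transpose_sub, transpose_one, hUsymm]
    · have h1 := (abs_le.1 (hUform ξ)).2
      have h2 : 0 < ξ ⬝ᵥ ξ := by simpa using dotProduct_star_self_pos_iff.2 hξ
      simp only [star_trivial, sub_mulVec, one_mulVec, dotProduct_sub]
      linarith
  obtain ⟨P, hP⟩ := exists_transpose_mul_self hPpos.posSemidef
  have hPd : P.det ≠ 0 := by
    intro h0
    have := hPpos.det_pos
    rw [hP, det_mul, h0, mul_zero] at this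
    exact lt_irrefl _ this
  -- Here `TᵀT = M⁻¹ - V`. Applying `log det X ≤ tr X - card` to `X = T N Tᵀ` is Fenchel's
  -- inequality for `-log det` at the dual point `M⁻¹ - V`; only `log det (1 - U)` then remains to
  -- be bounded below.
  set T := P * Rᵀ with hT
  have hTd : IsUnit T := by
    rw [isUnit_iff_isUnit_det, isUnit_iff_ne_zero, hT, det_mul, det_transpose]
    refine mul_ne_zero hPd fun h0 => ?_
    have := congrArg det hQR
    rw [det_mul, h0, mul_zero, det_one] at this
    exact zero_ne_one this
  have hX : (T * N * Tᵀ).PosDef := by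
    have := (IsUnit.posDef_star_right_conjugate_iff (U := T) hTd).2 hN
    rwa [star_eq_conjTranspose, conjTranspose_eq_transpose_of_trivial] at this
  have hXlog := log_det_le_trace_sub_card hX
  have hTT : Tᵀ * T = M⁻¹ - V := by
    have : Tᵀ * T = R * (1 - U) * Rᵀ := by
      rw [hT, transpose_mul, transpose_transpose, hP]; simp only [mul_assoc]
    rw [this, mul_sub, sub_mul, mul_one, hMinv, hUdef]
    congr 1
    calc R * (Q * V * Qᵀ) * Rᵀ = (R * Q) * V * (R * Q)ᵀ := by
          rw [transpose_mul]; simp only [mul_assoc]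
      _ = V := by rw [hRQ, transpose_one, one_mul, mul_one]
  have hXtr : (T * N * Tᵀ).trace = (M⁻¹ * N).trace - (V * N).trace := by
    rw [trace_mul_comm, ← mul_assoc, hTT, sub_mul, trace_sub]
  have hMM : (M⁻¹ * M).trace = Fintype.card ι := by
    rw [nonsing_inv_mul _ (isUnit_iff_ne_zero.2 hM.det_pos.ne'), trace_one]
  have hXdet : (T * N * Tᵀ).det * M.det = N.det * (1 - U).det := by
    have h1 : (1 - U).det = P.det ^ 2 := by rw [hP, det_mul, det_transpose]; ring
    have h2 : M.det = Q.det ^ 2 := by rw [hMQ, det_mul, det_transpose]; ring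
    have h3 : Q.det * R.det = 1 := by rw [← det_mul, hQR, det_one]
    rw [h1, h2, hT]
    simp only [det_mul, det_transpose]
    linear_combination (N.det * P.det ^ 2 * (Q.det * R.det + 1)) * h3
  have hlogs := congrArg Real.log hXdet
  rw [Real.log_mul hX.det_pos.ne' hM.det_pos.ne', Real.log_mul hN.det_pos.ne' hPpos.det_pos.ne']
    at hlogs
  rw [mul_sub, mul_sub, trace_sub, trace_sub, hMM]
  linarith

end Spectral

/-! ### Adding the averaging matrix: pseudo-determinant and pseudo-inverse. -/

section AvgMatrix

variable {ι : Type*} [Fintype ι] [DecidableEq ι]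

lemma avgMatrix_mul_self {ι : Type*} [Fintype ι] [Nonempty ι] :
    avgMatrix ι * avgMatrix ι = avgMatrix ι := by
  ext x y
  simp [avgMatrix, mul_apply]

lemma charpoly_avgMatrix [Nonempty ι] :
    (avgMatrix ι).charpoly =
      Polynomial.X ^ (Fintype.card ι - 1) * (Polynomial.X - Polynomial.C 1) := by
  have h : avgMatrix ι = vecMulVec (fun _ => (Fintype.card ι : ℝ)⁻¹) (fun _ => 1) := by
    ext x y; simp [avgMatrix, vecMulVec]
  have hc : 0 < Fintype.card ι := Fintype.card_pos
  rw [h, charpoly_vecMulVec]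
  have h1 : (fun _ : ι => (Fintype.card ι : ℝ)⁻¹) ⬝ᵥ (fun _ => 1) = 1 := by
    simp [dotProduct]
  rw [h1, one_smul]
  obtain ⟨m, hm⟩ := Nat.exists_eq_succ_of_ne_zero hc.ne'
  rw [hm]
  simp only [Nat.succ_eq_add_one, Nat.add_sub_cancel, map_one]
  ring

/-- `A J = 0` gives `(X - A)(X - J) = X (X - (A + J))`; take determinants and cancel the powers of
`X` coming from the rank-one matrix `J`. -/
lemma charpoly_add_avgMatrix [Nonempty ι] {A : Matrix ι ι ℝ} (hA : A * avgMatrix ι = 0) :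
    A.charpoly * (Polynomial.X - Polynomial.C 1) = Polynomial.X * (A + avgMatrix ι).charpoly := by
  have h : charmatrix A * charmatrix (avgMatrix ι) =
      (Polynomial.X : Polynomial ℝ) • charmatrix (A + avgMatrix ι) := by
    simp only [charmatrix, map_add]
    have h0 : (Polynomial.C.mapMatrix A : Matrix ι ι (Polynomial ℝ)) *
        Polynomial.C.mapMatrix (avgMatrix ι) = 0 := by
      rw [← map_mul, hA, map_zero]
    have hs : ∀ B : Matrix ι ι (Polynomial ℝ),
        scalar ι (Polynomial.X : Polynomial ℝ) * B = (Polynomial.X : Polynomial ℝ) • B := fun B => by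
      rw [scalar_apply, ← smul_eq_diagonal_mul]
    have hs' : ∀ B : Matrix ι ι (Polynomial ℝ),
        B * scalar ι (Polynomial.X : Polynomial ℝ) = (Polynomial.X : Polynomial ℝ) • B := fun B => by
      rw [← hs, (scalar_commute _ (fun r => Commute.all _ r) _).eq]
    rw [sub_mul, mul_sub, mul_sub, h0, hs, hs, hs', smul_sub, smul_add]
    abel
  have h2 := congrArg det h
  rw [det_mul, det_smul] at h2
  change A.charpoly * (avgMatrix ι).charpoly = _ * (A + avgMatrix ι).charpoly at h2
  rw [charpoly_avgMatrix] at h2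
  obtain ⟨m, hm⟩ := Nat.exists_eq_succ_of_ne_zero (Fintype.card_pos (α := ι)).ne'
  rw [hm] at h2
  simp only [Nat.succ_eq_add_one, Nat.add_sub_cancel] at h2
  refine mul_left_cancel₀ (pow_ne_zero m (Polynomial.X_ne_zero (R := ℝ))) ?_
  rw [pow_succ] at h2
  linear_combination h2

lemma roots_charpoly_add_avgMatrix [Nonempty ι] {A : Matrix ι ι ℝ} (hA : A * avgMatrix ι = 0) :
    1 ::ₘ A.charpoly.roots = 0 ::ₘ (A + avgMatrix ι).charpoly.roots := by
  have h := congrArg Polynomial.roots (charpoly_add_avgMatrix hA)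
  rw [Polynomial.roots_mul (mul_ne_zero (charpoly_monic A).ne_zero (Polynomial.X_sub_C_ne_zero 1)),
    Polynomial.roots_mul (mul_ne_zero Polynomial.X_ne_zero (charpoly_monic _).ne_zero),
    Polynomial.roots_X_sub_C, Polynomial.roots_X, add_comm] at h
  simpa using h

/-- One zero eigenvalue is replaced by 1, which leaves the product unchanged; positive definiteness
says there was no other zero. -/
lemma pseudoDet_eq_det_add_avgMatrix [Nonempty ι] {A : Matrix ι ι ℝ} (hA : A * avgMatrix ι = 0)
    (hpd : (A + avgMatrix ι).PosDef) : pseudoDet A = (A + avgMatrix ι).det := by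
  have h := congrArg (Multiset.filter (fun x : ℝ => x ≠ 0)) (roots_charpoly_add_avgMatrix hA)
  have h0 : Multiset.filter (fun x : ℝ => x ≠ 0) (A + avgMatrix ι).charpoly.roots =
      (A + avgMatrix ι).charpoly.roots := by
    rw [Multiset.filter_eq_self, hpd.1.roots_charpoly_eq_eigenvalues]
    intro x hx
    obtain ⟨i, -, rfl⟩ := Multiset.mem_map.1 hx
    simpa using (hpd.eigenvalues_pos i).ne'
  rw [Multiset.filter_cons_of_pos (p := fun x : ℝ => x ≠ 0) _ one_ne_zero,
    Multiset.filter_cons_of_neg (p := fun x : ℝ => x ≠ 0) _ (by simp), h0] at h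
  have h2 := congrArg Multiset.prod h
  rw [Multiset.prod_cons, one_mul] at h2
  rw [pseudoDet, h2, hpd.1.det_eq_prod_eigenvalues, hpd.1.roots_charpoly_eq_eigenvalues]
  rfl

lemma IsMoorePenroseInverse.unique {ι : Type*} [Fintype ι] {A B C : Matrix ι ι ℝ} (hB : IsMoorePenroseInverse A B)
    (hC : IsMoorePenroseInverse A C) : B = C := by
  have h1 : A * B = A * C := by
    calc A * B = (A * C * A) * B := by rw [hC.mul_mul_left]
      _ = (A * C) * (A * B) := by simp only [mul_assoc]
      _ = ((A * B) * (A * C))ᵀ := by rw [transpose_mul, hC.symm_left, hB.symm_left]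
      _ = ((A * B * A) * C)ᵀ := by simp only [mul_assoc]
      _ = A * C := by rw [hB.mul_mul_left, hC.symm_left]
  have h2 : B * A = C * A := by
    calc B * A = B * (A * C * A) := by rw [hC.mul_mul_left]
      _ = (B * A) * (C * A) := by simp only [mul_assoc]
      _ = ((C * A) * (B * A))ᵀ := by rw [transpose_mul, hC.symm_right, hB.symm_right]
      _ = (C * (A * B * A))ᵀ := by simp only [mul_assoc]
      _ = C * A := by rw [hB.mul_mul_left, hC.symm_right]
  calc B = B * A * B := hB.mul_mul_right.symm
    _ = C * (A * B) := by rw [h2, mul_assoc]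
    _ = C := by rw [h1, ← mul_assoc, hC.mul_mul_right]

/-- Both products with `A` equal the projection `1 - J` off the constants. -/
lemma isMoorePenroseInverse_inv_sub_avgMatrix [Nonempty ι] {A : Matrix ι ι ℝ} (hsymm : Aᵀ = A)
    (hA : A * avgMatrix ι = 0) (hpd : (A + avgMatrix ι).PosDef) :
    IsMoorePenroseInverse A ((A + avgMatrix ι)⁻¹ - avgMatrix ι) := by
  set J := avgMatrix ι with hJ
  set M := A + J with hM
  have hJJ : J * J = J := avgMatrix_mul_self
  have hJA : J * A = 0 := by
    have := congrArg transpose hA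
    rwa [transpose_mul, hJ, avgMatrix_transpose, hsymm, transpose_zero] at this
  have hu : IsUnit M.det := isUnit_iff_ne_zero.2 hpd.det_pos.ne'
  have hMJ : M * J = J := by rw [hM, add_mul, hA, hJJ, zero_add]
  have hJM : J * M = J := by rw [hM, mul_add, hJA, hJJ, zero_add]
  have hiJ : M⁻¹ * J = J := by
    conv_lhs => rw [← hMJ]
    rw [← mul_assoc, nonsing_inv_mul _ hu, one_mul]
  have hJi : J * M⁻¹ = J := by
    conv_lhs => rw [← hJM]
    rw [mul_assoc, mul_nonsing_inv _ hu, mul_one]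
  have hAM : A = M - J := by rw [hM]; abel
  have e1 : A * (M⁻¹ - J) = 1 - J := by
    rw [hAM, sub_mul, mul_sub, mul_sub, mul_nonsing_inv _ hu, hMJ, hJi, hJJ]; abel
  have e2 : (M⁻¹ - J) * A = 1 - J := by
    rw [hAM, sub_mul, mul_sub, mul_sub, nonsing_inv_mul _ hu, hJM, hiJ, hJJ]; abel
  have hT : (1 - J)ᵀ = 1 - J := by rw [transpose_sub, transpose_one, hJ, avgMatrix_transpose]
  refine ⟨?_, ?_, ?_, ?_⟩
  · rw [e1, sub_mul, one_mul, hJA, sub_zero]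
  · rw [e2, sub_mul, one_mul, mul_sub, hJi, hJJ]; abel
  · rw [e1, hT]
  · rw [e2, hT]

/-- Cauchy–Schwarz for `ξ` and `η = M⁻¹ ξ`, with the lower bound on `M` applied to `η`. -/
lemma form_inv_le {M : Matrix ι ι ℝ} {z : ℝ} (hz : 0 < z) (hM : M.PosDef)
    (h : ∀ ξ : ι → ℝ, 1 / z * (ξ ⬝ᵥ ξ) ≤ ξ ⬝ᵥ M *ᵥ ξ) (ξ : ι → ℝ) :
    ξ ⬝ᵥ M⁻¹ *ᵥ ξ ≤ z * (ξ ⬝ᵥ ξ) := by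
  set η := M⁻¹ *ᵥ ξ with hη
  have hu : IsUnit M.det := isUnit_iff_ne_zero.2 hM.det_pos.ne'
  have h1 : M *ᵥ η = ξ := by rw [hη, mulVec_mulVec, mul_nonsing_inv _ hu, one_mulVec]
  have h2 := h η
  rw [h1, dotProduct_comm η ξ] at h2
  have h5 : (ξ ⬝ᵥ η) ^ 2 ≤ (ξ ⬝ᵥ ξ) * (η ⬝ᵥ η) := by
    simpa [dotProduct, sq] using Finset.sum_mul_sq_le_sq_mul_sq Finset.univ ξ η
  have h6 : 0 ≤ ξ ⬝ᵥ ξ := by simpa using dotProduct_star_self_nonneg ξ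
  have h7 : 0 ≤ η ⬝ᵥ η := by simpa using dotProduct_star_self_nonneg η
  have h8 : η ⬝ᵥ η ≤ z * (ξ ⬝ᵥ η) := by
    rw [one_div, inv_mul_le_iff₀ hz] at h2
    exact h2
  have h9 : (ξ ⬝ᵥ η) ^ 2 ≤ (ξ ⬝ᵥ ξ) * (z * (ξ ⬝ᵥ η)) :=
    h5.trans (mul_le_mul_of_nonneg_left h8 h6)
  rcases le_or_gt (ξ ⬝ᵥ η) 0 with h10 | h10
  · exact h10.trans (by positivity)
  · nlinarith

end AvgMatrix

/-! ### Consequences of the assumptions on the true graphs. -/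

section TrueGraphs

variable {s₁ s₂ d z : ℝ} {p₁ p₂ : ℕ} {w₁ : Edge p₁ → ℝ} {w₂ : Edge p₂ → ℝ}

lemma TrueGraphs.nonempty (h : TrueGraphs s₁ s₂ d z w₁ w₂) : Nonempty (Fin p₁ × Fin p₂) := by
  by_contra he
  rw [not_nonempty_iff] at he
  obtain ⟨l, hl, -⟩ := h.spectrum
  rw [charpoly, det_isEmpty, Polynomial.roots_one] at hl
  exact Multiset.cons_ne_zero hl.symm

lemma one_lt_of_degree_pos {p : ℕ} {w : Edge p → ℝ} (hp : 0 < p)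
    (h : ∀ i, 0 < degree w i) : 1 < p := by
  by_contra hlt
  obtain rfl : p = 1 := by omega
  have h0 := h 0
  have : degree w 0 = 0 := by
    rw [degree, Fin.sum_univ_one, adj_self]
  linarith

lemma TrueGraphs.one_lt (h : TrueGraphs s₁ s₂ d z w₁ w₂) (hd : 0 < d) : 1 < p₁ ∧ 1 < p₂ := by
  obtain ⟨⟨i, j⟩⟩ := h.nonempty
  have hd' : 0 < 1 / d := by positivity
  exact ⟨one_lt_of_degree_pos i.pos fun i => hd'.trans_le (h.degree₁ i).1,
    one_lt_of_degree_pos j.pos fun i => hd'.trans_le (h.degree₂ i).1⟩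

lemma isHermitian_kronLaplacian_add_avgMatrix (w₁ : Edge p₁ → ℝ) (w₂ : Edge p₂ → ℝ) :
    (kronLaplacian w₁ w₂ + avgMatrix (Fin p₁ × Fin p₂)).IsHermitian := by
  rw [IsHermitian, conjTranspose_eq_transpose_of_trivial, transpose_add, kronLaplacian_transpose,
    avgMatrix_transpose]

/-- The spectrum of `L + J` is that of `L` with one 0 replaced by 1, and 1 also lies in `[1/z, z]`.
-/
lemma TrueGraphs.form_bounds (h : TrueGraphs s₁ s₂ d z w₁ w₂) (hz : 1 < z)
    (ξ : Fin p₁ × Fin p₂ → ℝ) :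
    1 / z * (ξ ⬝ᵥ ξ) ≤ ξ ⬝ᵥ (kronLaplacian w₁ w₂ + avgMatrix (Fin p₁ × Fin p₂)) *ᵥ ξ ∧
      ξ ⬝ᵥ (kronLaplacian w₁ w₂ + avgMatrix (Fin p₁ × Fin p₂)) *ᵥ ξ ≤ z * (ξ ⬝ᵥ ξ) := by
  have := h.nonempty
  have hH := isHermitian_kronLaplacian_add_avgMatrix w₁ w₂
  obtain ⟨l, hl, hlz⟩ := h.spectrum
  have hr := roots_charpoly_add_avgMatrix (kronLaplacian_mul_avgMatrix w₁ w₂)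
  rw [hl, Multiset.cons_swap, Multiset.cons_inj_right, hH.roots_charpoly_eq_eigenvalues] at hr
  have hev : ∀ i, 1 / z ≤ hH.eigenvalues i ∧ hH.eigenvalues i ≤ z := by
    intro i
    have hi : hH.eigenvalues i ∈ 1 ::ₘ l := by
      rw [hr]
      exact Multiset.mem_map.2 ⟨i, Finset.mem_univ_val i, by simp⟩
    rcases Multiset.mem_cons.1 hi with h1 | h1
    · rw [h1]
      exact ⟨by rw [div_le_one (by linarith)]; exact hz.le, hz.le⟩
    · exact hlz _ h1
  exact ⟨le_form_of_le_eigenvalues hH (fun i => (hev i).1) ξ,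
    form_le_of_eigenvalues_le hH (fun i => (hev i).2) ξ⟩

lemma TrueGraphs.posDef (h : TrueGraphs s₁ s₂ d z w₁ w₂) (hz : 1 < z) :
    (kronLaplacian w₁ w₂ + avgMatrix (Fin p₁ × Fin p₂)).PosDef := by
  refine PosDef.of_dotProduct_mulVec_pos (isHermitian_kronLaplacian_add_avgMatrix _ _)
    fun ξ hξ => ?_
  have h2 : 0 < ξ ⬝ᵥ ξ := by simpa using dotProduct_star_self_pos_iff.2 hξ
  have hz0 : 0 < z := by linarith
  rw [star_trivial]
  exact lt_of_lt_of_le (by positivity) (h.form_bounds hz ξ).1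

lemma TrueGraphs.feasible (h : TrueGraphs s₁ s₂ d z w₁ w₂) (hz : 1 < z) : Feasible w₁ w₂ :=
  ⟨h.nonneg₁, h.nonneg₂, h.posDef hz⟩

lemma TrueGraphs.moorePenrose_eq (h : TrueGraphs s₁ s₂ d z w₁ w₂) (hz : 1 < z)
    {C : Matrix (Fin p₁ × Fin p₂) (Fin p₁ × Fin p₂) ℝ}
    (hC : IsMoorePenroseInverse (kronLaplacian w₁ w₂) C) :
    C = (kronLaplacian w₁ w₂ + avgMatrix _)⁻¹ - avgMatrix _ := by
  have := h.nonempty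
  exact hC.unique (isMoorePenroseInverse_inv_sub_avgMatrix (kronLaplacian_transpose _ _)
    (kronLaplacian_mul_avgMatrix _ _) (h.posDef hz))

lemma avgMatrix_form_nonneg {ι : Type*} [Fintype ι] (ξ : ι → ℝ) : 0 ≤ ξ ⬝ᵥ avgMatrix ι *ᵥ ξ := by
  rw [dotProduct_mulVec_eq_sum]
  have : ∑ x, ∑ y, avgMatrix ι x y * ξ x * ξ y = (Fintype.card ι : ℝ)⁻¹ * (∑ x, ξ x) ^ 2 := by
    rw [sq, Finset.sum_mul_sum, Finset.mul_sum]
    simp only [avgMatrix, of_apply, Finset.mul_sum]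
    exact Finset.sum_congr rfl fun x _ => Finset.sum_congr rfl fun y _ => by ring
  rw [this]
  positivity

lemma TrueGraphs.moorePenrose_form_le (h : TrueGraphs s₁ s₂ d z w₁ w₂) (hz : 1 < z)
    {C : Matrix (Fin p₁ × Fin p₂) (Fin p₁ × Fin p₂) ℝ}
    (hC : IsMoorePenroseInverse (kronLaplacian w₁ w₂) C) (ξ : Fin p₁ × Fin p₂ → ℝ) :
    ξ ⬝ᵥ C *ᵥ ξ ≤ z * (ξ ⬝ᵥ ξ) := by
  rw [h.moorePenrose_eq hz hC, sub_mulVec, dotProduct_sub]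
  have h1 := form_inv_le (by linarith) (h.posDef hz) (fun ξ => (h.form_bounds hz ξ).1) ξ
  have h2 := avgMatrix_form_nonneg ξ
  linarith

/-- `C` is symmetric and `C = C L C`, a congruence of the positive semidefinite `L`. -/
lemma TrueGraphs.moorePenrose_posSemidef (h : TrueGraphs s₁ s₂ d z w₁ w₂) (hz : 1 < z)
    {C : Matrix (Fin p₁ × Fin p₂) (Fin p₁ × Fin p₂) ℝ}
    (hC : IsMoorePenroseInverse (kronLaplacian w₁ w₂) C) : C.PosSemidef := by
  have hT : Cᵀ = C := by
    rw [h.moorePenrose_eq hz hC, transpose_sub, transpose_nonsing_inv, transpose_add,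
      kronLaplacian_transpose, avgMatrix_transpose]
  have h1 := (kronLaplacian_posSemidef h.nonneg₁ h.nonneg₂).mul_mul_conjTranspose_same C
  rwa [conjTranspose_eq_transpose_of_trivial, hT, hC.mul_mul_right] at h1

end TrueGraphs

/-! ### Existence of a minimiser. -/

section Existence

variable {p₁ p₂ : ℕ}

lemma continuous_adj_apply {p : ℕ} (i j : Fin p) : Continuous fun w : Edge p → ℝ => adj w i j := by
  simp only [adj, of_apply]
  split_ifs
  · exact continuous_apply _
  · exact continuous_apply _
  · exact continuous_const

lemma continuous_degree_apply {p : ℕ} (i : Fin p) : Continuous fun w : Edge p → ℝ => degree w i :=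
  continuous_finsetSum _ fun j _ => continuous_adj_apply i j

lemma continuous_kronLaplacian :
    Continuous fun w : (Edge p₁ → ℝ) × (Edge p₂ → ℝ) => kronLaplacian w.1 w.2 := by
  refine continuous_matrix fun x y => ?_
  simp only [kronLaplacian_apply]
  have h1 := (continuous_adj_apply (p := p₁) x.1 y.1).comp
    (continuous_fst (X := Edge p₁ → ℝ) (Y := Edge p₂ → ℝ))
  have h2 := (continuous_adj_apply (p := p₂) x.2 y.2).comp
    (continuous_snd (X := Edge p₁ → ℝ) (Y := Edge p₂ → ℝ))
  have h3 := (continuous_degree_apply (p := p₁) x.1).comp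
    (continuous_fst (X := Edge p₁ → ℝ) (Y := Edge p₂ → ℝ))
  have h4 := (continuous_degree_apply (p := p₂) x.2).comp
    (continuous_snd (X := Edge p₁ → ℝ) (Y := Edge p₂ → ℝ))
  split_ifs
  · exact (h3.mul h4).sub (h1.mul h2)
  · exact continuous_const.sub (h1.mul h2)

lemma trace_avgMatrix {ι : Type*} [Fintype ι] [Nonempty ι] : (avgMatrix ι).trace = 1 := by
  simp [trace, diag, avgMatrix]

/-- Apply `log_det_le_trace_sub_card` to `A` divided by its trace. -/
lemma log_det_le_card_mul_log_trace {ι : Type*} [Fintype ι] [DecidableEq ι] [Nonempty ι]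
    {A : Matrix ι ι ℝ} (hA : A.PosDef) (h1 : 1 ≤ A.trace) :
    Real.log A.det ≤ Fintype.card ι * Real.log A.trace := by
  have hpos : 0 < A.trace := by linarith
  have h := log_det_le_trace_sub_card (hA.smul (inv_pos.2 hpos))
  rw [det_smul, trace_smul, smul_eq_mul, inv_mul_cancel₀ hpos.ne',
    Real.log_mul (by positivity) hA.det_pos.ne', Real.log_pow, Real.log_inv] at h
  have : (1 : ℝ) ≤ Fintype.card ι := by exact_mod_cast Fintype.card_pos
  linarith

/-- Coercivity: the log-determinant grows at most logarithmically in the product of the total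
weights, and by AM–GM that product is at most quadratic in the penalty. -/
lemma penalty_le_of_log_det_ge {q : ℕ} {α β a b F ld : ℝ} (hq : 0 < q) (hα : 0 < α) (hβ : 0 < β)
    (ha : 0 ≤ a) (hb : 0 ≤ b) (hld : ld ≤ q * Real.log (4 * (a * b) + 1))
    (hF : α * a + β * b - ld ≤ F) :
    α * a + β * b ≤ 2 * (F + 2 * q * (√(α * β) / (4 * q) - 1 - Real.log (√(α * β) / (4 * q)))) := by
  set t := √(α * β) with ht
  have htpos : 0 < t := Real.sqrt_pos.2 (mul_pos hα hβ)
  have htsq : t ^ 2 = α * β := Real.sq_sqrt (mul_pos hα hβ).le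
  set P := α * a + β * b with hP
  have hP0 : 0 ≤ P := by positivity
  have hq' : (0 : ℝ) < q := by exact_mod_cast hq
  have h1 : 4 * (a * b) + 1 ≤ (1 + P / t) ^ 2 := by
    have h2 : 4 * (a * b) ≤ (P / t) ^ 2 := by
      rw [div_pow, le_div_iff₀ (by positivity), htsq]
      nlinarith [sq_nonneg (α * a - β * b)]
    have h3 : 0 ≤ P / t := by positivity
    nlinarith
  have h4 : Real.log (4 * (a * b) + 1) ≤ 2 * Real.log (1 + P / t) := by
    have := Real.log_le_log (by positivity) h1
    rwa [Real.log_pow, Nat.cast_ofNat] at this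
  -- Slope of the tangent bound for the logarithm, chosen so that the logarithmic term takes exactly
  -- half of the penalty.
  set ε := t / (4 * q) with hε
  have hεpos : 0 < ε := by positivity
  have h5 : Real.log (1 + P / t) ≤ ε * (1 + P / t) - 1 - Real.log ε := by
    have := Real.log_le_sub_one_of_pos (show 0 < ε * (1 + P / t) by positivity)
    rw [Real.log_mul hεpos.ne' (by positivity)] at this
    linarith
  have h6 : ld ≤ q * (2 * (ε * (1 + P / t) - 1 - Real.log ε)) :=
    hld.trans (mul_le_mul_of_nonneg_left (h4.trans (by linarith)) hq'.le)
  have h7 : q * (2 * (ε * (P / t))) = P / 2 := by rw [hε]; field_simp; norm_num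
  linarith

/-- A global minimizer of the penalized likelihood exists as soon as the feasible set is nonempty:
the penalty makes the objective coercive and the log-determinant is a barrier. -/
lemma exists_isPenalizedMLE [Nonempty (Fin p₁ × Fin p₂)] {α₁ α₂ : ℝ} (hα₁ : 0 < α₁) (hα₂ : 0 < α₂)
    {S : Matrix (Fin p₁ × Fin p₂) (Fin p₁ × Fin p₂) ℝ} (hS : S.PosSemidef)
    {u₁ : Edge p₁ → ℝ} {u₂ : Edge p₂ → ℝ} (hu : Feasible u₁ u₂) :
    ∃ v₁ v₂, IsPenalizedMLE α₁ α₂ S v₁ v₂ := by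
  set J := avgMatrix (Fin p₁ × Fin p₂) with hJ
  let E := (Edge p₁ → ℝ) × (Edge p₂ → ℝ)
  let F : E → ℝ := fun w => (kronLaplacian w.1 w.2 * S).trace
    - Real.log (kronLaplacian w.1 w.2 + J).det + α₁ * ∑ e, w.1 e + α₂ * ∑ e, w.2 e
  have hFeq : ∀ w : E, Feasible w.1 w.2 → penNegLogLik α₁ α₂ S w.1 w.2 = F w := fun w hw => by
    simp only [penNegLogLik, F]
    rw [pseudoDet_eq_det_add_avgMatrix (kronLaplacian_mul_avgMatrix _ _) hw.2.2]
  have htr : ∀ w : E, (∀ e, 0 ≤ w.1 e) → (∀ e, 0 ≤ w.2 e) →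
      0 ≤ (kronLaplacian w.1 w.2 * S).trace := fun w h1 h2 => by
    obtain ⟨Q, hQ⟩ := exists_transpose_mul_self hS
    have := ((kronLaplacian_posSemidef h1 h2).mul_mul_conjTranspose_same Q).trace_nonneg
    rw [conjTranspose_eq_transpose_of_trivial, mul_assoc, trace_mul_comm, mul_assoc, ← hQ] at this
    exact this
  set F₀ := F (u₁, u₂) with hF₀
  set q := Fintype.card (Fin p₁ × Fin p₂) with hq
  have hq0 : 0 < q := Fintype.card_pos
  set R := 2 * (F₀ + 2 * q * (√(α₁ * α₂) / (4 * q) - 1 - Real.log (√(α₁ * α₂) / (4 * q)))) with hR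
  -- The sublevel set of the reference point lies in this compact set. Trace and penalties are
  -- nonnegative there, so the value `F₀` forces `det ≥ exp (-F₀)`: a closed condition that stays
  -- away from the boundary of the feasible set.
  let K : Set E := Set.Icc (0, 0) (fun _ => R / α₁, fun _ => R / α₂) ∩
    {w | Real.exp (-F₀) ≤ (kronLaplacian w.1 w.2 + J).det}
  have hdetc : Continuous fun w : E => (kronLaplacian w.1 w.2 + J).det :=
    (continuous_kronLaplacian.add continuous_const).matrix_det
  have hKc : IsCompact K := isCompact_Icc.inter_right (isClosed_le continuous_const hdetc)
  have hmem : ∀ w : E, Feasible w.1 w.2 → F w ≤ F₀ → w ∈ K := by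
    intro w hw hwF
    have ha : 0 ≤ ∑ e, w.1 e := Finset.sum_nonneg fun e _ => hw.1 e
    have hb : 0 ≤ ∑ e, w.2 e := Finset.sum_nonneg fun e _ => hw.2.1 e
    have ht := htr w hw.1 hw.2.1
    have hP : 0 ≤ α₁ * ∑ e, w.1 e + α₂ * ∑ e, w.2 e := by positivity
    have hld : Real.log (kronLaplacian w.1 w.2 + J).det ≤
        q * Real.log (4 * ((∑ e, w.1 e) * ∑ e, w.2 e) + 1) := by
      have htrM : (kronLaplacian w.1 w.2 + J).trace = 4 * ((∑ e, w.1 e) * ∑ e, w.2 e) + 1 := by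
        rw [trace_add, trace_kronLaplacian, hJ, trace_avgMatrix]
      have := log_det_le_card_mul_log_trace hw.2.2 (by rw [← hJ, htrM]; nlinarith [mul_nonneg ha hb])
      rwa [← hJ, htrM] at this
    simp only [F] at hwF
    have hpen := penalty_le_of_log_det_ge hq0 hα₁ hα₂ ha hb hld (F := F₀) (by linarith)
    rw [← hR] at hpen
    refine ⟨⟨⟨fun e => hw.1 e, fun e => hw.2.1 e⟩, ⟨fun e => ?_, fun e => ?_⟩⟩, ?_⟩
    · have := Finset.single_le_sum (f := w.1) (fun e _ => hw.1 e) (Finset.mem_univ e)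
      simp only
      rw [le_div_iff₀ hα₁]
      nlinarith [mul_nonneg hα₂.le hb]
    · have := Finset.single_le_sum (f := w.2) (fun e _ => hw.2.1 e) (Finset.mem_univ e)
      simp only
      rw [le_div_iff₀ hα₂]
      nlinarith [mul_nonneg hα₁.le ha]
    · change Real.exp (-F₀) ≤ _
      rw [← Real.le_log_iff_exp_le hw.2.2.det_pos]
      linarith
  have hfeas : ∀ w ∈ K, Feasible w.1 w.2 := by
    intro w hw
    have h1 : ∀ e, 0 ≤ w.1 e := fun e => hw.1.1.1 e
    have h2 : ∀ e, 0 ≤ w.2 e := fun e => hw.1.1.2 e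
    refine ⟨h1, h2, ?_⟩
    have hps : (kronLaplacian w.1 w.2 + J).PosSemidef := by
      refine (kronLaplacian_posSemidef h1 h2).add (PosSemidef.of_dotProduct_mulVec_nonneg ?_ ?_)
      · rw [IsHermitian, conjTranspose_eq_transpose_of_trivial, hJ, avgMatrix_transpose]
      · intro ξ; simpa using avgMatrix_form_nonneg ξ
    -- A positive semidefinite matrix with nonzero determinant is positive definite, so every point
    -- of `K` is feasible.
    rw [hps.posDef_iff_isUnit, isUnit_iff_isUnit_det, isUnit_iff_ne_zero]
    exact ((Real.exp_pos _).trans_le hw.2).ne'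
  have hFc : ContinuousOn F K := by
    have hc1 : Continuous fun w : E => (kronLaplacian w.1 w.2 * S).trace :=
      (continuous_kronLaplacian.matrix_mul continuous_const).matrix_trace
    have hc2 : Continuous fun w : (Edge p₁ → ℝ) × (Edge p₂ → ℝ) => α₁ * ∑ e, w.1 e := by
      fun_prop
    have hc3 : Continuous fun w : (Edge p₁ → ℝ) × (Edge p₂ → ℝ) => α₂ * ∑ e, w.2 e := by
      fun_prop
    refine ((hc1.continuousOn.sub (hdetc.continuousOn.log fun w hw => ?_)).add
      hc2.continuousOn).add hc3.continuousOn
    exact ((Real.exp_pos _).trans_le hw.2).ne'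
  have hu' : (u₁, u₂) ∈ K := hmem _ hu le_rfl
  obtain ⟨v, hvK, hv⟩ := hKc.exists_isMinOn ⟨_, hu'⟩ hFc
  refine ⟨v.1, v.2, hfeas v hvK, fun x₁ x₂ hx => ?_⟩
  rw [hFeq v (hfeas v hvK), hFeq (x₁, x₂) hx]
  rcases le_or_gt (F (x₁, x₂)) F₀ with h | h
  · exact hv (hmem _ hx h)
  · exact (hv hu').trans h.le

end Existence

/-! ### Concentration of Gaussian quadratic forms. -/

section Gaussian

/-- The integral equals `exp (-u) (1 - 2u)^(-1/2)`, and `neg_sq_le_add_log_one_sub` at `2u` bounds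
it. -/
lemma gaussianReal_exp_sq {u : ℝ} (hu : |u| ≤ 1 / 4) :
    Integrable (fun x : ℝ => Real.exp (u * (x ^ 2 - 1))) (gaussianReal 0 1) ∧
      ∫ x, Real.exp (u * (x ^ 2 - 1)) ∂(gaussianReal 0 1) ≤ Real.exp (2 * u ^ 2) := by
  have hu' := abs_le.1 hu
  have hb : 0 < 1 / 2 - u := by linarith
  have hpi : 0 < 2 * Real.pi := by positivity
  have hval : ∫ x, Real.exp (u * (x ^ 2 - 1)) ∂(gaussianReal 0 1) =
      Real.exp (-u) * ((√(2 * Real.pi))⁻¹ * √(Real.pi / (1 / 2 - u))) := by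
    rw [integral_gaussianReal_eq_integral_smul one_ne_zero, ← integral_gaussian,
      ← integral_const_mul, ← integral_const_mul]
    refine integral_congr_ae (Filter.Eventually.of_forall fun x => ?_)
    simp only [gaussianPDFReal, NNReal.coe_one, mul_one, sub_zero, smul_eq_mul]
    rw [mul_assoc, ← Real.exp_add, mul_left_comm, ← Real.exp_add]
    congr 2
    ring
  have hsqrt : (√(2 * Real.pi))⁻¹ * √(Real.pi / (1 / 2 - u)) = (√(1 - 2 * u))⁻¹ := by
    rw [← Real.sqrt_inv, ← Real.sqrt_mul (by positivity), ← Real.sqrt_inv]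
    congr 1
    have : (1 - 2 * u) = 2 * (1 / 2 - u) := by ring
    rw [this]
    field_simp
  have hpos : 0 < 1 - 2 * u := by linarith
  rw [hsqrt] at hval
  constructor
  -- The integral of a non-integrable function is 0 by convention, so a nonzero value proves
  -- integrability.
  · refine Integrable.of_integral_ne_zero ?_
    rw [hval]
    have := Real.sqrt_pos.2 hpos
    positivity
  · rw [hval, ← Real.exp_log (Real.sqrt_pos.2 hpos), ← Real.exp_neg, ← Real.exp_add,
      Real.exp_le_exp, Real.log_sqrt hpos.le]
    have := neg_sq_le_add_log_one_sub (x := 2 * u) (by rw [abs_mul, abs_two]; linarith)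
    linarith

variable {ι : Type*} [Fintype ι] [DecidableEq ι]

lemma trace_mul_le_mul_trace {A C : Matrix ι ι ℝ} {z : ℝ} (hA : A.PosSemidef)
    (hCz : ∀ ξ : ι → ℝ, ξ ⬝ᵥ C *ᵥ ξ ≤ z * (ξ ⬝ᵥ ξ)) : (A * C).trace ≤ z * A.trace := by
  obtain ⟨Q, hQ⟩ := exists_transpose_mul_self hA
  have h := trace_conj_le hCz Qᵀ
  rw [transpose_transpose, mul_assoc, trace_mul_comm, mul_assoc, trace_mul_comm C,
    trace_mul_comm Q, ← hQ] at h
  exact h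

lemma form_sum_smul_eigenvectorBasis {B : Matrix ι ι ℝ} (hB : B.IsHermitian) (x : ι → ℝ) :
    (⇑(∑ i, x i • hB.eigenvectorBasis i) : ι → ℝ) ⬝ᵥ
      B *ᵥ ⇑(∑ i, x i • hB.eigenvectorBasis i) = ∑ i, hB.eigenvalues i * x i ^ 2 := by
  set b := hB.eigenvectorBasis with hb
  set y : EuclideanSpace ℝ ι := ∑ i, x i • b i with hy
  have h1 : (⇑y : ι → ℝ) = ∑ i, x i • (⇑(b i) : ι → ℝ) := by
    ext k; simp [hy]
  have h2 : B *ᵥ (⇑y : ι → ℝ) = ∑ i, (x i * hB.eigenvalues i) • (⇑(b i) : ι → ℝ) := by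
    rw [h1, mulVec_sum]
    refine Finset.sum_congr rfl fun i _ => ?_
    rw [mulVec_smul, hB.mulVec_eigenvectorBasis i, smul_smul]
  have h3 : ∀ i, (⇑y : ι → ℝ) ⬝ᵥ (⇑(b i) : ι → ℝ) = x i := fun i => by
    have h4 : inner ℝ (b i) y = x i := by
      rw [hy]; exact b.orthonormal.inner_right_fintype x i
    rw [← h4, EuclideanSpace.inner_eq_star_dotProduct]
    simp
  rw [h2, dotProduct_sum]
  refine Finset.sum_congr rfl fun i _ => ?_
  rw [dotProduct_smul, h3, smul_eq_mul]
  ring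

open scoped MatrixOrder in
/-- Exponential moments of a centred quadratic form of a Gaussian vector. -/
lemma multivariateGaussian_exp_form {A C : Matrix ι ι ℝ} {z K t : ℝ} (hz : 0 ≤ z) (hK : 0 ≤ K)
    (hA : A.PosSemidef) (hC : C.PosSemidef)
    (hAK : ∀ ξ : ι → ℝ, ξ ⬝ᵥ A *ᵥ ξ ≤ K * (ξ ⬝ᵥ ξ))
    (hCz : ∀ ξ : ι → ℝ, ξ ⬝ᵥ C *ᵥ ξ ≤ z * (ξ ⬝ᵥ ξ)) (ht : |t| * (K * z) ≤ 1 / 4) :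
    Integrable (fun x : EuclideanSpace ℝ ι =>
        Real.exp (t * ((⇑x : ι → ℝ) ⬝ᵥ A *ᵥ ⇑x - (A * C).trace))) (multivariateGaussian 0 C) ∧
      ∫ x : EuclideanSpace ℝ ι, Real.exp (t * ((⇑x : ι → ℝ) ⬝ᵥ A *ᵥ ⇑x - (A * C).trace))
        ∂(multivariateGaussian 0 C) ≤ Real.exp (2 * t ^ 2 * (K * z * (z * A.trace))) := by
  set R := CFC.sqrt C with hR
  have hRR : R * R = C := CFC.sqrt_mul_sqrt_self _ hC.nonneg
  have hRps : R.PosSemidef := (CFC.sqrt_nonneg C).posSemidef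
  have hRT : Rᵀ = R := by
    have := hRps.1
    rwa [IsHermitian, conjTranspose_eq_transpose_of_trivial] at this
  set B := R * A * R with hB
  have hBps : B.PosSemidef := by
    have := hA.mul_mul_conjTranspose_same R
    rwa [conjTranspose_eq_transpose_of_trivial, hRT] at this
  have hBH := hBps.1
  have hBform : ∀ ξ : ι → ℝ, ξ ⬝ᵥ B *ᵥ ξ = (R *ᵥ ξ) ⬝ᵥ A *ᵥ (R *ᵥ ξ) := fun ξ => by
    rw [hB, ← mulVec_mulVec, ← mulVec_mulVec, dotProduct_mulVec ξ R, ← mulVec_transpose, hRT]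
  have hev0 : ∀ i, 0 ≤ hBH.eigenvalues i := hBps.eigenvalues_nonneg
  have hevK : ∀ i, hBH.eigenvalues i ≤ K * z := fun i => by
    obtain ⟨ξ, h1, h2⟩ := exists_eigenvector_form hBH i
    rw [← h2, hBform]
    have h3 : (R *ᵥ ξ) ⬝ᵥ (R *ᵥ ξ) = ξ ⬝ᵥ C *ᵥ ξ := by
      rw [← hRR, ← mulVec_mulVec, dotProduct_mulVec ξ R, ← mulVec_transpose, hRT]
    have h4 := hCz ξ
    rw [h1, mul_one] at h4
    calc _ ≤ K * _ := hAK _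
      _ ≤ K * z := by rw [h3]; gcongr
  have hsum : ∑ i, hBH.eigenvalues i = (A * C).trace := by
    rw [← trace_eq_sum_eigenvalues_real hBH, hB, mul_assoc, trace_mul_comm, mul_assoc, hRR]
  -- The variance proxy: largest eigenvalue times trace.
  have hsumsq : ∑ i, hBH.eigenvalues i ^ 2 ≤ K * z * (z * A.trace) := by
    calc _ ≤ ∑ i, K * z * hBH.eigenvalues i := by
          refine Finset.sum_le_sum fun i _ => ?_
          rw [sq]
          exact mul_le_mul_of_nonneg_right (hevK i) (hev0 i)
      _ = K * z * (A * C).trace := by rw [← Finset.mul_sum, hsum]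
      _ ≤ _ := by
          have := trace_mul_le_mul_trace hA hCz
          gcongr
  -- A standard Gaussian vector is expanded in the eigenbasis of `B = R A R`, so the quadratic form
  -- becomes a weighted sum of independent squares.
  let h : (ι → ℝ) → EuclideanSpace ℝ ι := fun x =>
    0 + toEuclideanCLM (𝕜 := ℝ) R (∑ i, x i • hBH.eigenvectorBasis i)
  have hhm : Measurable h := by fun_prop
  have hmap : multivariateGaussian 0 C = (Measure.pi fun _ : ι => gaussianReal 0 1).map h := by
    rw [multivariateGaussian, stdGaussian_eq_map_pi_orthonormalBasis hBH.eigenvectorBasis,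
      Measure.map_map (by fun_prop) (by fun_prop)]
    rfl
  have hq : ∀ x, Real.exp (t * ((⇑(h x) : ι → ℝ) ⬝ᵥ A *ᵥ ⇑(h x) - (A * C).trace)) =
      ∏ i, Real.exp (t * hBH.eigenvalues i * (x i ^ 2 - 1)) := fun x => by
    have h1 : (⇑(h x) : ι → ℝ) = R *ᵥ ⇑(∑ i, x i • hBH.eigenvectorBasis i) := by
      simp only [h, zero_add]
      rfl
    rw [h1, ← hBform, form_sum_smul_eigenvectorBasis, ← hsum, ← Finset.sum_sub_distrib,
      Finset.mul_sum, Real.exp_sum]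
    exact Finset.prod_congr rfl fun i _ => by congr 1; ring
  have hev : ∀ i, |t * hBH.eigenvalues i| ≤ 1 / 4 := fun i => by
    rw [abs_mul, abs_of_nonneg (hev0 i)]
    exact (mul_le_mul_of_nonneg_left (hevK i) (abs_nonneg t)).trans ht
  have hmeas : Measurable fun x : EuclideanSpace ℝ ι =>
      Real.exp (t * ((⇑x : ι → ℝ) ⬝ᵥ A *ᵥ ⇑x - (A * C).trace)) := by
    simp only [dotProduct_mulVec_eq_sum]
    fun_prop
  rw [hmap, integrable_map_measure hmeas.aestronglyMeasurable hhm.aemeasurable,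
    integral_map hhm.aemeasurable hmeas.aestronglyMeasurable]
  simp only [Function.comp_def, hq]
  constructor
  · exact Integrable.fintype_prod (f := fun i (y : ℝ) =>
      Real.exp (t * hBH.eigenvalues i * (y ^ 2 - 1))) fun i => (gaussianReal_exp_sq (hev i)).1
  · rw [integral_fintype_prod_eq_prod (fun i (y : ℝ) =>
      Real.exp (t * hBH.eigenvalues i * (y ^ 2 - 1)))]
    calc _ ≤ ∏ i, Real.exp (2 * (t * hBH.eigenvalues i) ^ 2) :=
          Finset.prod_le_prod (fun i _ => integral_nonneg fun _ => (Real.exp_pos _).le)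
            fun i _ => (gaussianReal_exp_sq (hev i)).2
      _ = Real.exp (2 * t ^ 2 * ∑ i, hBH.eigenvalues i ^ 2) := by
          rw [← Real.exp_sum, Finset.mul_sum]
          congr 1
          exact Finset.sum_congr rfl fun i _ => by ring
      _ ≤ _ := by
          rw [Real.exp_le_exp]
          gcongr

lemma trace_mul_sampleCov {ι : Type*} [Fintype ι] {n : ℕ} (A : Matrix ι ι ℝ) (x : Fin n → EuclideanSpace ℝ ι) :
    (A * sampleCov x).trace = (n : ℝ)⁻¹ * ∑ k, (⇑(x k) : ι → ℝ) ⬝ᵥ A *ᵥ ⇑(x k) := by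
  simp only [dotProduct_mulVec_eq_sum, trace, diag, mul_apply, sampleCov, of_apply,
    Finset.mul_sum]
  conv_rhs => rw [Finset.sum_comm]
  refine Finset.sum_congr rfl fun i _ => ?_
  conv_rhs => rw [Finset.sum_comm]
  exact Finset.sum_congr rfl fun i _ => Finset.sum_congr rfl fun k _ => by ring

lemma sampleCov_posSemidef {ι : Type*} [Finite ι] {n : ℕ} (x : Fin n → EuclideanSpace ℝ ι) :
    (sampleCov x).PosSemidef := by
  have h : sampleCov x = (n : ℝ)⁻¹ • ∑ k, vecMulVec (⇑(x k) : ι → ℝ) (star (⇑(x k) : ι → ℝ)) := by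
    ext i j
    simp [sampleCov, vecMulVec_apply, Matrix.sum_apply]
  rw [h]
  exact (posSemidef_sum _ fun k _ => posSemidef_vecMulVec_self_star _).smul (by positivity)

/-- Two-sided Chernoff bound for `⟨A, S - C⟩`, `S` the sample covariance of `n` independent
`N(0, C)` vectors. -/
lemma measure_abs_trace_sampleCov_sub_ge {n : ℕ} (hn : 0 < n) {Ω : Type*} [MeasurableSpace Ω]
    (μ : Measure Ω) [IsProbabilityMeasure μ] {X : Fin n → Ω → EuclideanSpace ℝ ι}
    {A C : Matrix ι ι ℝ} {z K t r : ℝ} (hX : iIndepFun X μ)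
    (hlaw : ∀ k, HasLaw (X k) (multivariateGaussian 0 C) μ) (hz : 0 ≤ z) (hK : 0 ≤ K)
    (hA : A.PosSemidef) (hC : C.PosSemidef)
    (hAK : ∀ ξ : ι → ℝ, ξ ⬝ᵥ A *ᵥ ξ ≤ K * (ξ ⬝ᵥ ξ))
    (hCz : ∀ ξ : ι → ℝ, ξ ⬝ᵥ C *ᵥ ξ ≤ z * (ξ ⬝ᵥ ξ)) (ht0 : 0 ≤ t) (ht : t * (K * z) ≤ 1 / 4) :
    μ.real {ω | r ≤ |(A * (sampleCov (fun k => X k ω) - C)).trace|} ≤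
      2 * Real.exp (n * (-(t * r) + 2 * t ^ 2 * (K * z * (z * A.trace)))) := by
  have hn' : (0 : ℝ) < n := by exact_mod_cast hn
  let q : EuclideanSpace ℝ ι → ℝ := fun x => (⇑x : ι → ℝ) ⬝ᵥ A *ᵥ ⇑x - (A * C).trace
  have hqm : Measurable q := by
    simp only [q, dotProduct_mulVec_eq_sum]
    fun_prop
  let Y : Fin n → Ω → ℝ := fun k => q ∘ X k
  have hYm : ∀ k, AEMeasurable (Y k) μ := fun k => hqm.comp_aemeasurable (hlaw k).aemeasurable
  have hYind : iIndepFun Y μ := hX.comp (fun _ => q) fun _ => hqm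
  have hsum : ∀ ω, (A * (sampleCov (fun k => X k ω) - C)).trace = (n : ℝ)⁻¹ * (∑ k, Y k) ω := by
    intro ω
    rw [mul_sub, trace_sub, trace_mul_sampleCov]
    simp only [Finset.sum_apply, Y, q, Function.comp_apply, Finset.sum_sub_distrib,
      Finset.sum_const, Finset.card_univ, Fintype.card_fin, nsmul_eq_mul, mul_sub]
    rw [inv_mul_cancel_left₀ hn'.ne']
  have hmgf : ∀ s : ℝ, |s| = t → Integrable (fun ω => Real.exp (s * (∑ k, Y k) ω)) μ ∧
      mgf (∑ k, Y k) μ s ≤ Real.exp (n * (2 * t ^ 2 * (K * z * (z * A.trace)))) := by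
    intro s hs
    have hg := multivariateGaussian_exp_form (t := s) hz hK hA hC hAK hCz (by rw [hs]; exact ht)
    have hqe : Measurable fun x => Real.exp (s * q x) := by fun_prop
    have hYint : ∀ k, Integrable (fun ω => Real.exp (s * Y k ω)) μ := fun k => by
      have h1 := hg.1
      rw [← (hlaw k).map_eq] at h1
      exact h1.comp_aemeasurable (hlaw k).aemeasurable
    have hle : ∀ k, mgf (Y k) μ s ≤ Real.exp (2 * t ^ 2 * (K * z * (z * A.trace))) := fun k => by
      have h1 := hg.2
      rw [← (hlaw k).map_eq, integral_map (hlaw k).aemeasurable hqe.aestronglyMeasurable] at h1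
      rw [← hs, sq_abs]
      exact h1
    have hprod := hYind.mgf_sum₀ hYm Finset.univ (t := s)
    constructor
    · refine Integrable.of_integral_ne_zero ?_
      change mgf (∑ k, Y k) μ s ≠ 0
      rw [hprod]
      exact (Finset.prod_pos fun k _ => mgf_pos (hYint k)).ne'
    · rw [hprod]
      refine (Finset.prod_le_prod (fun k _ => mgf_nonneg) fun k _ => hle k).trans ?_
      rw [Finset.prod_const, Finset.card_univ, Fintype.card_fin, ← Real.exp_nat_mul]
  have hsub : {ω | r ≤ |(A * (sampleCov (fun k => X k ω) - C)).trace|} ⊆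
      {ω | n * r ≤ (∑ k, Y k) ω} ∪ {ω | (∑ k, Y k) ω ≤ -(n * r)} := by
    intro ω hω
    simp only [Set.mem_ofPred_eq, hsum] at hω
    rcases le_abs.1 hω with h | h
    · left
      rw [inv_mul_eq_div, le_div_iff₀ hn'] at h
      simp only [Set.mem_ofPred_eq]
      linarith
    · right
      rw [inv_mul_eq_div, ← neg_div, le_div_iff₀ hn'] at h
      simp only [Set.mem_ofPred_eq]
      linarith
  have h1 := hmgf t (abs_of_nonneg ht0)
  have h2 := hmgf (-t) (by rw [abs_neg, abs_of_nonneg ht0])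
  have hE : ∀ m ≤ Real.exp (n * (2 * t ^ 2 * (K * z * (z * A.trace)))),
      Real.exp (-t * (n * r)) * m ≤
        Real.exp (n * (-(t * r) + 2 * t ^ 2 * (K * z * (z * A.trace)))) := fun m hm => by
    refine (mul_le_mul_of_nonneg_left hm (Real.exp_pos _).le).trans (le_of_eq ?_)
    rw [← Real.exp_add]
    congr 1
    ring
  calc _ ≤ _ := measureReal_mono hsub
    _ ≤ _ := measureReal_union_le _ _
    _ ≤ Real.exp (-t * (n * r)) * mgf (∑ k, Y k) μ t +
        Real.exp (-(-t) * (-(n * r))) * mgf (∑ k, Y k) μ (-t) :=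
        add_le_add (measure_ge_le_exp_mul_mgf _ ht0 h1.1)
          (measure_le_le_exp_mul_mgf _ (neg_nonpos.2 ht0) h2.1)
    _ ≤ _ := by
        rw [neg_mul_neg, two_mul]
        exact add_le_add (hE _ h1.2) (hE _ h2.2)

end Gaussian

/-! ### Real inequalities turning test bounds into error bounds. -/

section RealAnalysis

/-- The optimal `κ = A / (2B)` gives the bound. If it were out of range, `κ = ± κ₀` would contradict
the smallness of `D`. -/
lemma sq_le_of_forall_quadratic {A B D κ₀ : ℝ} (hB : 0 < B) (hκ₀ : 0 < κ₀)
    (h : ∀ κ, |κ| ≤ κ₀ → κ * A ≤ D + B * κ ^ 2) (hD : D ≤ B * κ₀ ^ 2) : A ^ 2 ≤ 4 * B * D := by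
  rcases le_or_gt |A| (2 * B * κ₀) with hA | hA
  · have h1 := h (A / (2 * B)) (by
      rw [abs_div, abs_of_pos (show 0 < 2 * B by positivity), div_le_iff₀ (by positivity)]
      linarith)
    have h2 : A / (2 * B) * A - B * (A / (2 * B)) ^ 2 = A ^ 2 / (4 * B) := by field_simp; ring
    have h3 : A ^ 2 / (4 * B) ≤ D := by linarith
    rw [div_le_iff₀ (by positivity)] at h3
    linarith
  · exfalso
    rcases le_total 0 A with h0 | h0
    · rw [abs_of_nonneg h0] at hA
      have h1 := h κ₀ (abs_of_pos hκ₀).le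
      nlinarith
    · rw [abs_of_nonpos h0] at hA
      have h1 := h (-κ₀) (by rw [abs_neg, abs_of_pos hκ₀])
      nlinarith

/-- A crude bound on the divergence and the total weight of the estimate. -/
lemma total_weight_lt {D Q Q' p d z e : ℝ} (hd : 1 < d) (hz : 1 < z) (hQ : 0 < Q)
    (hp : p ≤ 4 * d ^ 2 * Q) (hD : D ≤ e * (Q' + Q)) (he0 : 0 ≤ e) (he : 3 * e * (d ^ 2 * z ^ 2) < 1)
    (htest : ∀ κ, |κ| ≤ 1 / (2 * z) → κ * (4 * (Q' - Q)) ≤ D + z ^ 2 * p * κ ^ 2) :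
    D ≤ 3 * e * Q := by
  have hdz : 0 < d ^ 2 * z ^ 2 := by positivity
  -- Chosen so that the quadratic cost is at most `2κQ`. Then `Q' > 2Q` would force `2κ < 3e`,
  -- against `he`.
  set κ := 1 / (2 * (d ^ 2 * z ^ 2)) with hκ
  have hκpos : 0 < κ := by positivity
  have hκe : κ * (2 * (d ^ 2 * z ^ 2)) = 1 := by rw [hκ]; field_simp
  have h1 := htest κ (by
    rw [abs_of_pos hκpos, hκ]
    refine one_div_le_one_div_of_le (by positivity) ?_
    have : z ≤ d ^ 2 * z ^ 2 := by nlinarith [mul_pos (sub_pos.2 hd) (sub_pos.2 hz), sq_nonneg (d * z)]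
    linarith)
  have h2 : z ^ 2 * p * κ ^ 2 ≤ 2 * κ * Q := by
    calc z ^ 2 * p * κ ^ 2 ≤ z ^ 2 * (4 * d ^ 2 * Q) * κ ^ 2 := by gcongr
      _ = 2 * κ * Q * (κ * (2 * (d ^ 2 * z ^ 2))) := by ring
      _ = _ := by rw [hκe, mul_one]
  have h3 : 3 * e < 2 * κ := by
    by_contra hcon
    push Not at hcon
    nlinarith
  have h4 : Q' ≤ 2 * Q := by
    by_contra hcon
    push Not at hcon
    nlinarith
  nlinarith

variable {ι₁ ι₂ : Type*} [Fintype ι₁] [Fintype ι₂]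

/-- Splits an ℓ¹ deviation into a difference of total weights and twice a negative part; the latter
is supported on the true edges. -/
lemma sum_abs_sub_eq {ι : Type*} [Fintype ι] (v w : ι → ℝ) :
    ∑ e, |v e - w e| = ∑ e, v e - ∑ e, w e + 2 * ∑ e, max (w e - v e) 0 := by
  rw [Finset.mul_sum, ← Finset.sum_sub_distrib, ← Finset.sum_add_distrib]
  refine Finset.sum_congr rfl fun e _ => ?_
  rcases le_total (w e) (v e) with h | h
  · rw [max_eq_right (by linarith), abs_of_nonneg (by linarith)]; ring
  · rw [max_eq_left (by linarith), abs_of_nonpos (by linarith)]; ring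

lemma sum_negPart_mul {ι : Type*} [Fintype ι] (v w : ι → ℝ) :
    ∑ e, max (w e - v e) 0 * v e = ∑ e, max (w e - v e) 0 * w e - ∑ e, max (w e - v e) 0 ^ 2 := by
  rw [← Finset.sum_sub_distrib]
  refine Finset.sum_congr rfl fun e _ => ?_
  rcases le_total (w e) (v e) with h | h
  · rw [max_eq_right (by linarith)]; ring
  · rw [max_eq_left (by linarith)]; ring

/-- Nonnegativity of the estimate makes the negative part an admissible test and gives it the
sparsity of the truth. -/
lemma abs_negPart_le {ι : Type*} {v w : ι → ℝ} (hv : ∀ e, 0 ≤ v e) (hw : ∀ e, 0 ≤ w e) (e : ι) :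
    |max (w e - v e) 0| ≤ w e := by
  rw [abs_of_nonneg (le_max_right _ _)]
  exact max_le (by linarith [hv e]) (hw e)

/-- Control of the negative parts of the deviations of both factors. -/
lemma negPart_sq_le {w₁ v₁ : ι₁ → ℝ} {w₂ v₂ : ι₂ → ℝ} {d z D k W₁ W₂ m : ℝ} (hd : 1 < d)
    (hz : 1 < z) (hD : 0 ≤ D) (hk : k = 1 / (4 * z ^ 2 * d ^ 2))
    (hw₁ : ∀ e, 0 ≤ w₁ e) (hw₂ : ∀ e, 0 ≤ w₂ e) (hv₁ : ∀ e, 0 ≤ v₁ e) (hv₂ : ∀ e, 0 ≤ v₂ e)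
    (hW₁ : ∑ e, w₁ e * w₁ e = W₁) (hW₂ : ∑ e, w₂ e * w₂ e = W₂) (hW₁0 : 0 < W₁) (hW₂0 : 0 < W₂)
    (hm : ∑ e, w₁ e * v₁ e = m) (hm2 : W₁ / 2 ≤ m) (hnorm : ∑ e, w₂ e * v₂ e = W₂)
    (hR : ((m - W₁) * W₂) ^ 2 ≤ 4 * (z ^ 2 * (W₁ * W₂)) * D)
    (htest : ∀ (κ : ℝ) (x : ι₁ → ℝ) (y : ι₂ → ℝ), (∀ e, |x e| ≤ w₁ e) → (∀ e, |y e| ≤ w₂ e) →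
      |κ| ≤ 1 / (2 * z * d ^ 2) →
      κ * ((∑ e, x e * v₁ e) * (∑ e, y e * v₂ e) - (∑ e, x e * w₁ e) * ∑ e, y e * w₂ e) ≤
        D + z ^ 2 * ((∑ e, x e ^ 2) * ∑ e, y e ^ 2) * κ ^ 2) :
    (∑ e, max (w₁ e - v₁ e) 0 ^ 2) * W₂ ≤ 24 / k * D ∧
      (∑ e, max (w₂ e - v₂ e) 0 ^ 2) * W₁ ≤ 24 / k * D := by
  have hkpos : 0 < k := by rw [hk]; positivity
  have hke : k * (4 * z ^ 2 * d ^ 2) = 1 := by rw [hk]; field_simp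
  have hkz : z ^ 2 * k ≤ 1 / 4 := by
    nlinarith [mul_pos (mul_pos hkpos (pow_pos (by linarith : 0 < z) 2)) (sub_pos.2 hd),
      mul_pos hkpos (pow_pos (by linarith : 0 < z) 2)]
  have hkadm : |(-k)| ≤ 1 / (2 * z * d ^ 2) := by
    rw [abs_neg, abs_of_pos hkpos, hk]
    refine one_div_le_one_div_of_le (by positivity) ?_
    have : 0 < d ^ 2 := by positivity
    nlinarith [mul_pos this (sub_pos.2 hz)]
  have hself₁ : ∑ e, w₁ e ^ 2 = W₁ := by simp only [sq, hW₁]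
  have hself₂ : ∑ e, w₂ e ^ 2 = W₂ := by simp only [sq, hW₂]
  constructor
  · set x : ι₁ → ℝ := fun e => max (w₁ e - v₁ e) 0 with hx
    -- The negative part tests itself: by `sum_negPart_mul` its pairing with the deviation is minus
    -- its squared norm, hence the sign of `-k`.
    have h := htest (-k) x w₂ (abs_negPart_le hv₁ hw₁) (fun e => (abs_of_nonneg (hw₂ e)).le) hkadm
    have hneg := sum_negPart_mul v₁ w₁
    rw [hW₂, hnorm, hself₂] at h
    change ∑ e, x e * v₁ e = ∑ e, x e * w₁ e - ∑ e, x e ^ 2 at hneg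
    rw [hneg] at h
    set X := ∑ e, x e ^ 2 with hX
    have hX0 : 0 ≤ X := Finset.sum_nonneg fun _ _ => sq_nonneg _
    have h1 : z ^ 2 * (X * W₂) * (-k) ^ 2 ≤ 1 / 4 * (k * (X * W₂)) := by
      calc _ = (z ^ 2 * k) * (k * (X * W₂)) := by ring
        _ ≤ _ := by gcongr
    rw [div_mul_eq_mul_div, le_div_iff₀ hkpos]
    nlinarith [mul_nonneg hX0 hW₂0.le]
  · set y : ι₂ → ℝ := fun e => max (w₂ e - v₂ e) 0 with hy
    have h := htest (-k) w₁ y (fun e => (abs_of_nonneg (hw₁ e)).le) (abs_negPart_le hv₂ hw₂) hkadm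
    have hneg := sum_negPart_mul v₂ w₂
    rw [hW₁, hm, hself₁] at h
    change ∑ e, y e * v₂ e = ∑ e, y e * w₂ e - ∑ e, y e ^ 2 at hneg
    rw [hneg] at h
    -- Only the second factor is normalised, so a cross term `(m - W₁) c` survives. It is bounded
    -- through `hR` and absorbed by AM–GM into `W₁ Y / 8`; the remaining `k W₁ Y / 8 ≤ 3 D` is the
    -- origin of 24.
    have hcs : (∑ e, y e * w₂ e) ^ 2 ≤ (∑ e, y e ^ 2) * W₂ := by
      rw [← hself₂]; exact Finset.sum_mul_sq_le_sq_mul_sq _ _ _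
    set Y := ∑ e, y e ^ 2 with hY
    set c := ∑ e, y e * w₂ e with hc
    have hY0 : 0 ≤ Y := Finset.sum_nonneg fun _ _ => sq_nonneg _
    have h1 : z ^ 2 * (W₁ * Y) * (-k) ^ 2 ≤ 1 / 4 * (k * (W₁ * Y)) := by
      calc _ = (z ^ 2 * k) * (k * (W₁ * Y)) := by ring
        _ ≤ _ := by gcongr
    have h2 : ((m - W₁) * c) ^ 2 ≤ 4 * z ^ 2 * (W₁ * Y) * D := by
      have h3 : (m - W₁) ^ 2 * W₂ ≤ 4 * z ^ 2 * W₁ * D := by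
        refine le_of_mul_le_mul_right ?_ hW₂0
        nlinarith
      calc ((m - W₁) * c) ^ 2 = (m - W₁) ^ 2 * c ^ 2 := by ring
        _ ≤ (m - W₁) ^ 2 * (Y * W₂) := by gcongr
        _ = ((m - W₁) ^ 2 * W₂) * Y := by ring
        _ ≤ (4 * z ^ 2 * W₁ * D) * Y := by gcongr
        _ = _ := by ring
    have h4 : (m - W₁) * c ≤ W₁ * Y / 8 + 8 * z ^ 2 * D := by
      refine le_of_sq_le_sq ?_ (by positivity)
      nlinarith [sq_nonneg (W₁ * Y / 8 - 8 * z ^ 2 * D)]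
    have h5 : m * Y ≥ W₁ / 2 * Y := mul_le_mul_of_nonneg_right hm2 hY0
    have h6 : k * (m * Y - (m - W₁) * c) ≤ D + 1 / 4 * (k * (W₁ * Y)) := by
      have e : k * (m * Y - (m - W₁) * c) = -k * (m * (c - Y) - W₁ * c) := by ring
      rw [e]
      linarith
    have h7 : k * (W₁ / 2 * Y - (W₁ * Y / 8 + 8 * z ^ 2 * D)) ≤ k * (m * Y - (m - W₁) * c) :=
      mul_le_mul_of_nonneg_left (by linarith) hkpos.le
    have h8 : 8 * D * (z ^ 2 * k) ≤ 8 * D * (1 / 4) :=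
      mul_le_mul_of_nonneg_left hkz (by positivity)
    have e : k * (W₁ / 2 * Y - (W₁ * Y / 8 + 8 * z ^ 2 * D)) =
        3 / 8 * (k * (W₁ * Y)) - 8 * D * (z ^ 2 * k) := by ring
    rw [div_mul_eq_mul_div, le_div_iff₀ hkpos, show Y * W₁ * k = k * (W₁ * Y) by ring]
    linarith

lemma sum_negPart_le {ι : Type*} [Fintype ι] {x : ι → ℝ} {A B W T k β s c : ℝ} (hA : 0 < A)
    (hB : 0 < B) (hT : 0 ≤ T) (hk : 0 < k) (hβ : 0 < β) (hs : 0 < s) (hc : 0 ≤ c)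
    (hc2 : c ^ 2 = 24 * s / (k * β)) (hsupp : (∑ e, x e) ^ 2 ≤ s * A ^ 2 * ∑ e, x e ^ 2)
    (hW : β * B ^ 2 ≤ W) (hx : (∑ e, x e ^ 2) * W ≤ 24 / k * T ^ 2) :
    ∑ e, x e ≤ c * (A / B) * T := by
  refine le_of_sq_le_sq (hsupp.trans ?_) (by positivity)
  set X := ∑ e, x e ^ 2
  have hX0 : 0 ≤ X := Finset.sum_nonneg fun _ _ => sq_nonneg _
  have h1 : X ≤ 24 / k * T ^ 2 / (β * B ^ 2) := by
    rw [le_div_iff₀ (by positivity)]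
    exact (mul_le_mul_of_nonneg_left hW hX0).trans hx
  calc s * A ^ 2 * X ≤ s * A ^ 2 * (24 / k * T ^ 2 / (β * B ^ 2)) := by gcongr
    _ = (24 * s / (k * β)) * (A / B) ^ 2 * T ^ 2 := by field_simp
    _ = _ := by rw [← hc2]; ring

/-- From `(n₁ - q₁) n₂ = (n₁ n₂ - q₁ q₂) + q₁ (q₂ - n₂)`: the product of the totals is known to be
accurate, and the other factor's total falls short by at most its negative part. -/
lemma l1_deviation_le {A B T z d β c n₁ n₂ q₁ q₂ a₁ a₂ : ℝ} (hA : 0 < A) (hB : 0 < B)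
    (hT : 0 ≤ T) (hz : 0 < z) (hd : 0 < d) (hβ : 0 < β) (hc : 0 ≤ c)
    (hQ : |n₁ * n₂ - q₁ * q₂| ≤ z / 2 * (A * B) * T) (hn₂ : β * B ^ 2 / (2 * d) ≤ n₂)
    (hq₁ : q₁ ≤ d * A ^ 2 / 2) (hq₁0 : 0 ≤ q₁) (hqn : q₂ - n₂ ≤ a₂) (ha₁ : a₁ ≤ c * (A / B) * T)
    (ha₂ : a₂ ≤ c * (B / A) * T) :
    n₁ - q₁ + 2 * a₁ ≤ (z * d / β + d ^ 2 * c / β + 2 * c) * (A / B) * T := by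
  have hn₂pos : 0 < n₂ := lt_of_lt_of_le (by positivity) hn₂
  have h1 : n₁ - q₁ ≤ (z * d / β + d ^ 2 * c / β) * (A / B) * T := by
    refine le_of_mul_le_mul_right ?_ hn₂pos
    calc (n₁ - q₁) * n₂ = (n₁ * n₂ - q₁ * q₂) + q₁ * (q₂ - n₂) := by ring
      _ ≤ z / 2 * (A * B) * T + (d * A ^ 2 / 2) * (c * (B / A) * T) := by
          refine add_le_add ((le_abs_self _).trans hQ) ?_
          calc q₁ * (q₂ - n₂) ≤ q₁ * (c * (B / A) * T) :=
                mul_le_mul_of_nonneg_left (hqn.trans ha₂) hq₁0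
            _ ≤ _ := mul_le_mul_of_nonneg_right hq₁ (by positivity)
      _ = (z * d / β + d ^ 2 * c / β) * (A / B) * T * (β * B ^ 2 / (2 * d)) := by
          field_simp
      _ ≤ _ := by gcongr
  calc _ ≤ (z * d / β + d ^ 2 * c / β) * (A / B) * T + 2 * (c * (A / B) * T) := by linarith
    _ = _ := by ring

lemma sqrt_sub_sqrt_le {Q Q' : ℝ} (hQ : 0 < Q) (hQ' : 0 ≤ Q') :
    √Q - √Q' ≤ |Q' - Q| / √Q := by
  have h := Real.sqrt_pos.2 hQ
  rw [le_div_iff₀ h]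
  have h1 := Real.mul_self_sqrt hQ.le
  have h2 := Real.mul_self_sqrt hQ'
  rcases le_total Q Q' with hle | hle
  · have := mul_nonneg (sub_nonneg.2 (Real.sqrt_le_sqrt hle)) h.le
    linarith [abs_nonneg (Q' - Q)]
  · have h3 := mul_le_mul_of_nonneg_left (Real.sqrt_le_sqrt hle) (Real.sqrt_nonneg Q')
    have h4 := neg_abs_le (Q' - Q)
    linarith

lemma sum_mul_le_mul_sum {ι : Type*} [Fintype ι] {w v : ι → ℝ} {d : ℝ} (hw : ∀ e, w e ≤ d)
    (hv : ∀ e, 0 ≤ v e) : ∑ e, w e * v e ≤ d * ∑ e, v e := by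
  rw [Finset.mul_sum]
  exact Finset.sum_le_sum fun e _ => mul_le_mul_of_nonneg_right (hw e) (hv e)

lemma sum_sub_sum_le_negPart {ι : Type*} [Fintype ι] (w v : ι → ℝ) :
    ∑ e, w e - ∑ e, v e ≤ ∑ e, max (w e - v e) 0 := by
  rw [← Finset.sum_sub_distrib]
  exact Finset.sum_le_sum fun e _ => le_max_left _ _

/-- Bilinear expansion around the truth. The imbalances `A / B` and `B / A` of the ℓ¹ deviations
cancel against the noise levels, also in the second-order term. -/
lemma noise_sub_le {w₁ v₁ : ι₁ → ℝ} {w₂ v₂ : ι₂ → ℝ}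
    (N : (ι₁ → ℝ) →ₗ[ℝ] (ι₂ → ℝ) →ₗ[ℝ] ℝ) {A B T c γ : ℝ} (hA : 0 < A) (hB : 0 < B)
    (hT : 0 ≤ T) (hc : 0 ≤ c) (hγ : 0 ≤ γ)
    (hN₁ : ∀ x, |N x w₂| ≤ γ * B * ∑ e, |x e|) (hN₂ : ∀ y, |N w₁ y| ≤ γ * A * ∑ e, |y e|)
    (hN : ∀ x y, |N x y| ≤ γ * ((∑ e, |x e|) * ∑ e, |y e|))
    (hμ : ∑ e, |v₁ e - w₁ e| ≤ c * (A / B) * T) (hν : ∑ e, |v₂ e - w₂ e| ≤ c * (B / A) * T) :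
    N w₁ w₂ - N v₁ v₂ ≤ γ * c * (A + B) * T + γ * c ^ 2 * T ^ 2 := by
  have hsplit : N w₁ w₂ - N v₁ v₂ =
      -(N (v₁ - w₁) w₂) - N w₁ (v₂ - w₂) - N (v₁ - w₁) (v₂ - w₂) := by
    simp only [map_sub, LinearMap.sub_apply]; ring
  have e1 := (abs_le.1 (hN₁ (v₁ - w₁))).1
  have e2 := (abs_le.1 (hN₂ (v₂ - w₂))).1
  have e3 := (abs_le.1 (hN (v₁ - w₁) (v₂ - w₂))).1
  simp only [Pi.sub_apply] at e1 e2 e3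
  have hM0 : 0 ≤ ∑ e, |v₂ e - w₂ e| := Finset.sum_nonneg fun _ _ => abs_nonneg _
  have f1 : γ * B * ∑ e, |v₁ e - w₁ e| ≤ γ * B * (c * (A / B) * T) :=
    mul_le_mul_of_nonneg_left hμ (by positivity)
  have f2 : γ * A * ∑ e, |v₂ e - w₂ e| ≤ γ * A * (c * (B / A) * T) :=
    mul_le_mul_of_nonneg_left hν (by positivity)
  have f3 : γ * ((∑ e, |v₁ e - w₁ e|) * ∑ e, |v₂ e - w₂ e|) ≤
      γ * ((c * (A / B) * T) * (c * (B / A) * T)) :=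
    mul_le_mul_of_nonneg_left (mul_le_mul hμ hν hM0 (by positivity)) hγ
  have g1 : γ * B * (c * (A / B) * T) = γ * c * A * T := by field_simp
  have g2 : γ * A * (c * (B / A) * T) = γ * c * B * T := by field_simp
  have g3 : γ * ((c * (A / B) * T) * (c * (B / A) * T)) = γ * c ^ 2 * T ^ 2 := by
    field_simp
  rw [hsplit]
  linarith

/-- Control of the `ℓ¹` deviations of both factors of a normalised pair. -/
lemma l1_deviations_le {w₁ v₁ : ι₁ → ℝ} {w₂ v₂ : ι₂ → ℝ} {A B T d z β s k c c' : ℝ}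
    (hA : 0 < A) (hB : 0 < B) (hT : 0 ≤ T) (hd : 1 < d) (hz : 1 < z) (hβ : 0 < β) (hs : 0 < s)
    (hk : k = 1 / (4 * z ^ 2 * d ^ 2)) (hc : c = √(24 * s / (k * β)))
    (hc' : c' = z * d / β + d ^ 2 * c / β + 2 * c)
    (hw₁ : ∀ e, 0 ≤ w₁ e) (hw₂ : ∀ e, 0 ≤ w₂ e) (hv₁ : ∀ e, 0 ≤ v₁ e) (hv₂ : ∀ e, 0 ≤ v₂ e)
    (hw₁d : ∀ e, w₁ e ≤ d) (hw₂d : ∀ e, w₂ e ≤ d)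
    (hq₁ : ∑ e, w₁ e ≤ d * A ^ 2 / 2) (hq₂ : ∑ e, w₂ e ≤ d * B ^ 2 / 2)
    (hW₁ : β * A ^ 2 ≤ ∑ e, w₁ e * w₁ e) (hW₂ : β * B ^ 2 ≤ ∑ e, w₂ e * w₂ e)
    (hsupp₁ : ∀ x : ι₁ → ℝ, (∀ e, |x e| ≤ w₁ e) → (∑ e, x e) ^ 2 ≤ s * A ^ 2 * ∑ e, x e ^ 2)
    (hsupp₂ : ∀ x : ι₂ → ℝ, (∀ e, |x e| ≤ w₂ e) → (∑ e, x e) ^ 2 ≤ s * B ^ 2 * ∑ e, x e ^ 2)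
    (hm : (∑ e, w₁ e * w₁ e) / 2 ≤ ∑ e, w₁ e * v₁ e)
    (hnorm : ∑ e, w₂ e * v₂ e = ∑ e, w₂ e * w₂ e)
    (hR : ((∑ e, w₁ e * v₁ e - ∑ e, w₁ e * w₁ e) * ∑ e, w₂ e * w₂ e) ^ 2 ≤
      4 * (z ^ 2 * ((∑ e, w₁ e * w₁ e) * ∑ e, w₂ e * w₂ e)) * T ^ 2)
    (hQ : |(∑ e, v₁ e) * (∑ e, v₂ e) - (∑ e, w₁ e) * ∑ e, w₂ e| ≤ z / 2 * (A * B) * T)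
    (htest : ∀ (κ : ℝ) (x : ι₁ → ℝ) (y : ι₂ → ℝ), (∀ e, |x e| ≤ w₁ e) → (∀ e, |y e| ≤ w₂ e) →
      |κ| ≤ 1 / (2 * z * d ^ 2) →
      κ * ((∑ e, x e * v₁ e) * (∑ e, y e * v₂ e) - (∑ e, x e * w₁ e) * ∑ e, y e * w₂ e) ≤
        T ^ 2 + z ^ 2 * ((∑ e, x e ^ 2) * ∑ e, y e ^ 2) * κ ^ 2) :
    ∑ e, |v₁ e - w₁ e| ≤ c' * (A / B) * T ∧ ∑ e, |v₂ e - w₂ e| ≤ c' * (B / A) * T := by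
  have hkpos : 0 < k := by rw [hk]; positivity
  have hc0 : 0 ≤ c := by rw [hc]; positivity
  have hc2 : c ^ 2 = 24 * s / (k * β) := by rw [hc, Real.sq_sqrt (by positivity)]
  have hd0 : 0 < d := by linarith
  have hz0 : 0 < z := by linarith
  have hW₁pos : 0 < ∑ e, w₁ e * w₁ e := lt_of_lt_of_le (by positivity) hW₁
  have hW₂pos : 0 < ∑ e, w₂ e * w₂ e := lt_of_lt_of_le (by positivity) hW₂
  obtain ⟨hx, hy⟩ := negPart_sq_le hd hz (sq_nonneg T) hk hw₁ hw₂ hv₁ hv₂ rfl rfl hW₁pos hW₂pos rfl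
    hm hnorm hR htest
  have ha₁ := sum_negPart_le hA hB hT hkpos hβ hs hc0 hc2
    (hsupp₁ _ (abs_negPart_le hv₁ hw₁)) hW₂ hx
  have ha₂ := sum_negPart_le hB hA hT hkpos hβ hs hc0 hc2
    (hsupp₂ _ (abs_negPart_le hv₂ hw₂)) hW₁ hy
  have hn₁ : β * A ^ 2 / (2 * d) ≤ ∑ e, v₁ e := by
    have := sum_mul_le_mul_sum hw₁d hv₁
    rw [div_le_iff₀ (by positivity)]
    linarith
  have hn₂ : β * B ^ 2 / (2 * d) ≤ ∑ e, v₂ e := by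
    have := sum_mul_le_mul_sum hw₂d hv₂
    rw [hnorm] at this
    rw [div_le_iff₀ (by positivity)]
    linarith
  have hq₁0 : 0 ≤ ∑ e, w₁ e := Finset.sum_nonneg fun e _ => hw₁ e
  have hq₂0 : 0 ≤ ∑ e, w₂ e := Finset.sum_nonneg fun e _ => hw₂ e
  constructor
  · rw [sum_abs_sub_eq, hc']
    exact l1_deviation_le hA hB hT hz0 hd0 hβ hc0 hQ hn₂ hq₁ hq₁0 (sum_sub_sum_le_negPart w₂ v₂)
      ha₁ ha₂
  · rw [sum_abs_sub_eq, hc']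
    refine l1_deviation_le hB hA hT hz0 hd0 hβ hc0 ?_ hn₁ hq₂ hq₂0 (sum_sub_sum_le_negPart w₁ v₁)
      ha₂ ha₁
    rw [mul_comm (∑ e, v₂ e), mul_comm (∑ e, w₂ e), mul_comm B]
    exact hQ

/-- Final bootstrap: a divergence dominated by noise and penalty is at most of the order of the
squared rate. -/
lemma sqrt_divergence_le {A B T d z c γ a r ρ g b q₁ q₂ n₁ n₂ E : ℝ}
    (hA : 0 < A) (hB : 0 < B) (hT : 0 ≤ T) (hd : 0 < d) (hz : 0 < z) (hc : 0 ≤ c) (hb : 0 ≤ b)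
    (hg : 0 ≤ g) (hγ : γ = b * g) (hsmall : γ * c ^ 2 ≤ 1 / 2) (hr : r = g * √(A ^ 2 + B ^ 2))
    (hρ0 : 0 ≤ ρ) (hρ : ρ ≤ a * r) (hq₁ : A ^ 2 / (2 * d) ≤ q₁) (hq₂ : B ^ 2 / (2 * d) ≤ q₂)
    (hn : 0 ≤ n₁ * n₂) (hQ : |n₁ * n₂ - q₁ * q₂| ≤ z / 2 * (A * B) * T)
    (hE : E ≤ γ * c * (A + B) * T + γ * c ^ 2 * T ^ 2)
    (hbasic : T ^ 2 ≤ E + 2 * ρ * (√(q₁ * q₂) - √(n₁ * n₂))) :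
    T ≤ 4 * (b * c + z * d * a) * r := by
  have hr0 : 0 ≤ r := by rw [hr]; positivity
  have hQpos : (A * B / (2 * d)) ^ 2 ≤ q₁ * q₂ := by
    calc (A * B / (2 * d)) ^ 2 = A ^ 2 / (2 * d) * (B ^ 2 / (2 * d)) := by ring
      _ ≤ q₁ * q₂ := mul_le_mul hq₁ hq₂ (by positivity) (le_trans (by positivity) hq₁)
  have hQ0 : 0 < q₁ * q₂ := lt_of_lt_of_le (by positivity) hQpos
  have hpen : √(q₁ * q₂) - √(n₁ * n₂) ≤ z * d * T := by
    refine (sqrt_sub_sqrt_le hQ0 hn).trans ?_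
    have h2 : A * B / (2 * d) ≤ √(q₁ * q₂) := Real.le_sqrt_of_sq_le hQpos
    rw [div_le_iff₀ (Real.sqrt_pos.2 hQ0)]
    calc _ ≤ z / 2 * (A * B) * T := hQ
      _ = z * d * T * (A * B / (2 * d)) := by field_simp
      _ ≤ _ := mul_le_mul_of_nonneg_left h2 (by positivity)
  have hpen2 : 2 * ρ * (√(q₁ * q₂) - √(n₁ * n₂)) ≤ 2 * (a * r) * (z * d * T) :=
    (mul_le_mul_of_nonneg_left hpen (by positivity)).trans
      (mul_le_mul_of_nonneg_right (by linarith) (by positivity))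
  have hAB : g * (A + B) ≤ 2 * r := by
    have h1 : A ≤ √(A ^ 2 + B ^ 2) := Real.le_sqrt_of_sq_le (by linarith [sq_nonneg B])
    have h2 : B ≤ √(A ^ 2 + B ^ 2) := Real.le_sqrt_of_sq_le (by linarith [sq_nonneg A])
    have h3 := mul_le_mul_of_nonneg_left (add_le_add h1 h2) hg
    rw [hr]
    linarith
  have h1 : γ * c ^ 2 * T ^ 2 ≤ 1 / 2 * T ^ 2 := mul_le_mul_of_nonneg_right hsmall (sq_nonneg T)
  have h2 : γ * c * (A + B) * T ≤ b * c * (2 * r) * T := by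
    calc _ = b * c * (g * (A + B)) * T := by rw [hγ]; ring
      _ ≤ _ := mul_le_mul_of_nonneg_right
          (mul_le_mul_of_nonneg_left hAB (mul_nonneg hb hc)) hT
  have hfin : T * T ≤ (4 * (b * c + z * d * a) * r) * T := by
    -- By `hsmall`, half of `T²` absorbs the second-order noise; what remains is linear in `T`.
    have : 1 / 2 * (T * T) ≤ b * c * (2 * r) * T + 2 * (a * r) * (z * d * T) := by
      rw [sq] at *
      linarith
    calc T * T ≤ 2 * (b * c * (2 * r) * T + 2 * (a * r) * (z * d * T)) := by linarith
      _ = _ := by ring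
  rcases hT.eq_or_lt with h0 | h0
  · rw [← h0]
    have h3 : 0 ≤ z * d * (a * r) := mul_nonneg (mul_nonneg hz.le hd.le) (hρ0.trans hρ)
    have h4 : 0 ≤ b * c * r := mul_nonneg (mul_nonneg hb hc) hr0
    calc 0 ≤ 4 * (b * c * r + z * d * (a * r)) := by linarith
      _ = _ := by ring
  · exact le_of_mul_le_mul_right hfin h0

lemma sum_sum_mul_sq (x : ι₁ → ℝ) (y : ι₂ → ℝ) :
    ∑ i, ∑ j, (x i * y j) ^ 2 = (∑ i, x i ^ 2) * ∑ j, y j ^ 2 := by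
  simp only [mul_pow, Finset.sum_mul_sum]

/-- A test scaled to the boundary of the admissible ball rules out `X > 1`; after that `c = k` is
itself admissible and gives the estimate. -/
lemma norm_sq_le_of_test {X W D k m : ℝ} (hX : 0 ≤ X) (hW : 0 < W) (hk : 0 < k)
    (hm : W / 2 ≤ m) (hD : D < k / 4 * W) {Z : ℝ} (hZk : Z * k ≤ 1 / 4)
    (htest : ∀ c, 0 ≤ c → c ^ 2 * X ≤ k ^ 2 → c * (m * X) ≤ D + Z * (c ^ 2 * X) * W) :
    X * W ≤ 4 / k * D := by
  have hmX : W / 2 * X ≤ m * X := mul_le_mul_of_nonneg_right hm hX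
  have hX1 : X ≤ 1 := by
    by_contra hcon
    push Not at hcon
    set y := √X with hy
    have hy2 : y ^ 2 = X := Real.sq_sqrt hX
    have hy1 : 1 < y := by
      rw [hy]; exact Real.lt_sqrt_of_sq_lt (by linarith)
    have h1 := htest (k / y) (by positivity) (by rw [← hy2]; field_simp; exact le_rfl)
    have h2 : (k / y) ^ 2 * X = k ^ 2 := by rw [← hy2]; field_simp
    have h3 : k / y * (m * X) = k * m * y := by rw [← hy2]; field_simp
    rw [h2, h3] at h1
    have h4 : k * (W / 2) * 1 ≤ k * m * y := by
      refine mul_le_mul (mul_le_mul_of_nonneg_left hm hk.le) hy1.le zero_le_one ?_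
      have : 0 < m := by linarith
      positivity
    have h5 : Z * k ^ 2 * W ≤ 1 / 4 * (k * W) := by
      calc _ = (Z * k) * (k * W) := by ring
        _ ≤ _ := by gcongr
    linarith
  have h1 := htest k hk.le (by nlinarith [sq_nonneg k])
  have h5 : Z * (k ^ 2 * X) * W ≤ 1 / 4 * (k * (X * W)) := by
    calc _ = (Z * k) * (k * (X * W)) := by ring
      _ ≤ _ := by gcongr
  have h6 : k * (W / 2 * X) ≤ k * (m * X) := mul_le_mul_of_nonneg_left hmX hk.le
  rw [div_mul_eq_mul_div, le_div_iff₀ hk]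
  linarith

/-- A rank-one array whose pairings with rank-one tests are controlled by `D` is close to the
reference array in `ℓ²`. -/
lemma sum_sq_rankOne_sub_le {u u₀ : ι₁ → ℝ} {v v₀ : ι₂ → ℝ} {D Z k h : ℝ}
    (hk : 0 < k) (hZk : Z * k ≤ 1 / 4) (hu : 1 ≤ h * ∑ i, u₀ i ^ 2)
    (hv0 : 0 < ∑ j, v₀ j ^ 2) (hu0 : 0 < ∑ i, u₀ i ^ 2)
    (hvv : 0 < ∑ j, v₀ j * v j)
    (hR : (∑ i, u₀ i ^ 2) * (∑ j, v₀ j ^ 2) / 2 ≤ (∑ i, u₀ i * u i) * ∑ j, v₀ j * v j)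
    (hDu : D < k / 4 * ∑ i, u₀ i ^ 2) (hDv : D < k / 4 * ∑ j, v₀ j ^ 2)
    (htest₁ : ∀ x : ι₁ → ℝ, ∑ i, x i ^ 2 ≤ k ^ 2 →
      (∑ i, x i * u i) * (∑ j, v₀ j * v j) - (∑ i, x i * u₀ i) * ∑ j, v₀ j * v₀ j ≤
        D + Z * ((∑ i, x i ^ 2) * ∑ j, v₀ j ^ 2))
    (htest₂ : ∀ y : ι₂ → ℝ, ∑ j, y j ^ 2 ≤ k ^ 2 →
      (∑ i, u₀ i * u i) * (∑ j, y j * v j) - (∑ i, u₀ i * u₀ i) * ∑ j, y j * v₀ j ≤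
        D + Z * ((∑ i, u₀ i ^ 2) * ∑ j, y j ^ 2)) :
    ∑ i, ∑ j, (u i * v j - u₀ i * v₀ j) ^ 2 ≤ (24 + 16 * h) / k * D := by
  set U := ∑ i, u₀ i ^ 2 with hU
  set V := ∑ j, v₀ j ^ 2 with hV
  have hUU : ∑ i, u₀ i * u₀ i = U := by simp only [hU, sq]
  have hVV : ∑ j, v₀ j * v₀ j = V := by simp only [hV, sq]
  rw [hVV] at htest₁
  rw [hUU] at htest₂
  -- This rescaling leaves the array `u ⊗ v` unchanged and makes the deviation `ν` of the second
  -- factor orthogonal to `v₀`, which removes the cross terms from both tests.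
  set t := (∑ j, v₀ j * v j) / V with ht
  have htpos : 0 < t := div_pos hvv hv0
  have htV : ∑ j, v₀ j * v j = t * V := by rw [ht]; field_simp
  set μ : ι₁ → ℝ := fun i => t * u i - u₀ i with hμ
  set ν : ι₂ → ℝ := fun j => t⁻¹ * v j - v₀ j with hν
  set a := ∑ i, μ i ^ 2 with ha
  set c := ∑ j, ν j ^ 2 with hc
  have ha0 : 0 ≤ a := Finset.sum_nonneg fun _ _ => sq_nonneg _
  have hc0 : 0 ≤ c := Finset.sum_nonneg fun _ _ => sq_nonneg _
  set m := t * ∑ i, u₀ i * u i with hm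
  have hm2 : U / 2 ≤ m := by
    rw [htV] at hR
    refine le_of_mul_le_mul_right ?_ hv0
    calc U / 2 * V = U * V / 2 := by ring
      _ ≤ _ := hR
      _ = _ := by rw [hm]; ring
  have hνv₀ : ∑ j, ν j * v₀ j = 0 := by
    have : ∑ j, ν j * v₀ j = t⁻¹ * (∑ j, v₀ j * v j) - ∑ j, v₀ j * v₀ j := by
      rw [Finset.mul_sum, ← Finset.sum_sub_distrib]
      exact Finset.sum_congr rfl fun j _ => by simp only [hν]; ring
    rw [this, htV, hVV]; field_simp; ring
  have haV : a * V ≤ 4 / k * D := by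
    refine norm_sq_le_of_test (m := V) ha0 hv0 hk (by linarith) hDv hZk fun b hb hbk => ?_
    have h1 := htest₁ (fun i => b * μ i) (by
      simp only [mul_pow, ← Finset.mul_sum]; exact hbk)
    have e1 : (∑ i, b * μ i * u i) * (∑ j, v₀ j * v j) - (∑ i, b * μ i * u₀ i) * V =
        b * (V * a) := by
      rw [htV]
      have : b * (V * a) = (∑ i, b * μ i * (t * u i - u₀ i)) * V := by
        rw [ha, Finset.mul_sum, Finset.mul_sum, Finset.sum_mul]
        exact Finset.sum_congr rfl fun i _ => by simp only [hμ]; ring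
      rw [this]
      have e2 : ∑ i, b * μ i * (t * u i - u₀ i) =
          t * (∑ i, b * μ i * u i) - ∑ i, b * μ i * u₀ i := by
        rw [Finset.mul_sum, ← Finset.sum_sub_distrib]
        exact Finset.sum_congr rfl fun i _ => by ring
      rw [e2]; ring
    rw [e1] at h1
    simp only [mul_pow, ← Finset.mul_sum] at h1
    linarith
  have hcU : c * U ≤ 4 / k * D := by
    refine norm_sq_le_of_test (m := m) hc0 hu0 hk hm2 hDu hZk fun b hb hbk => ?_
    have h1 := htest₂ (fun j => b * ν j) (by
      simp only [mul_pow, ← Finset.mul_sum]; exact hbk)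
    have e0 : ∑ j, b * ν j * v₀ j = 0 := by
      simp only [mul_assoc, ← Finset.mul_sum, hνv₀, mul_zero]
    have e1 : ∑ j, b * ν j * v j = t * (b * c) := by
      have : ∑ j, b * ν j * v j = t * (∑ j, b * ν j ^ 2 + ∑ j, b * ν j * v₀ j) := by
        rw [← Finset.sum_add_distrib, Finset.mul_sum]
        refine Finset.sum_congr rfl fun j _ => ?_
        simp only [hν]
        field_simp
        ring
      rw [this, e0, add_zero, ← Finset.mul_sum]
    rw [e0, e1] at h1
    simp only [mul_pow, ← Finset.mul_sum] at h1
    have e2 : (∑ i, u₀ i * u i) * (t * (b * c)) = b * (m * c) := by rw [hm]; ring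
    rw [e2] at h1
    linarith
  -- Needed for the second-order piece `μ ⊗ ν`: with `1 ≤ h U`, its squared norm is at most `h`
  -- times that of `u₀ ⊗ ν`.
  have ha1 : a ≤ 1 := by
    have h1 : 4 / k * D ≤ 1 * V := by
      rw [div_mul_eq_mul_div, div_le_iff₀ hk]; linarith
    exact le_of_mul_le_mul_right (haV.trans h1) hv0
  have hh : 0 ≤ h := by
    by_contra hcon
    push Not at hcon
    nlinarith
  have hsplit : ∀ i j, (u i * v j - u₀ i * v₀ j) ^ 2 ≤
      2 * (μ i * v₀ j) ^ 2 + 4 * (u₀ i * ν j) ^ 2 + 4 * (μ i * ν j) ^ 2 := fun i j => by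
    have e : u i * v j - u₀ i * v₀ j = μ i * v₀ j + (u₀ i * ν j + μ i * ν j) := by
      simp only [hμ, hν]; field_simp; ring
    rw [e]
    nlinarith [sq_nonneg (μ i * v₀ j - (u₀ i * ν j + μ i * ν j)), sq_nonneg (u₀ i * ν j - μ i * ν j)]
  calc _ ≤ ∑ i, ∑ j, (2 * (μ i * v₀ j) ^ 2 + 4 * (u₀ i * ν j) ^ 2 + 4 * (μ i * ν j) ^ 2) :=
        Finset.sum_le_sum fun i _ => Finset.sum_le_sum fun j _ => hsplit i j
    _ = 2 * (a * V) + 4 * (c * U) + 4 * (a * c) := by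
        simp only [Finset.sum_add_distrib, ← Finset.mul_sum, sum_sum_mul_sq]
        rw [mul_comm U]
    _ ≤ 2 * (4 / k * D) + 4 * (4 / k * D) + 4 * (h * (4 / k * D)) := by
        have h1 : a * c ≤ h * (c * U) := by
          calc a * c ≤ 1 * c := by gcongr
            _ ≤ (h * U) * c := by gcongr
            _ = _ := by ring
        have h2 : h * (c * U) ≤ h * (4 / k * D) := by gcongr
        linarith
    _ = _ := by ring

end RealAnalysis

/-! ### The divergence, its tests, and the basic inequality. -/

section Deterministic

variable {p₁ p₂ : ℕ}

/-- The log-determinant Bregman divergence between two Kronecker product Laplacians. -/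
noncomputable def divergence (w₁ v₁ : Edge p₁ → ℝ) (w₂ v₂ : Edge p₂ → ℝ) : ℝ :=
  ((kronLaplacian w₁ w₂ + avgMatrix (Fin p₁ × Fin p₂))⁻¹ *
      (kronLaplacian v₁ v₂ - kronLaplacian w₁ w₂)).trace
    - Real.log (kronLaplacian v₁ v₂ + avgMatrix (Fin p₁ × Fin p₂)).det
    + Real.log (kronLaplacian w₁ w₂ + avgMatrix (Fin p₁ × Fin p₂)).det

variable {s₁ s₂ d z : ℝ} {w₁ v₁ : Edge p₁ → ℝ} {w₂ v₂ : Edge p₂ → ℝ}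

lemma TrueGraphs.trace_test_le (h : TrueGraphs s₁ s₂ d z w₁ w₂) (hz : 1 < z)
    (hv : Feasible v₁ v₂) {V : Matrix (Fin p₁ × Fin p₂) (Fin p₁ × Fin p₂) ℝ} (hV : Vᵀ = V)
    {c : ℝ} (hVc : AbsFormBound V c) (hc : c ≤ 1 / (2 * z)) :
    (V * kronLaplacian v₁ v₂).trace - (V * kronLaplacian w₁ w₂).trace ≤
      divergence w₁ v₁ w₂ v₂ + z ^ 2 * (V * V).trace := by
  have h1 := KSGL.trace_test_le (V := V) (by linarith) (h.posDef hz) hv.2.2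
    (fun ξ => (h.form_bounds hz ξ).2) hV (fun ξ => (hVc.abs_form_le ξ).trans (by
      have : 0 ≤ ξ ⬝ᵥ ξ := by simpa using dotProduct_star_self_nonneg ξ
      gcongr))
  rwa [add_sub_add_right_eq_sub, mul_sub, trace_sub] at h1

lemma TrueGraphs.divergence_nonneg (h : TrueGraphs s₁ s₂ d z w₁ w₂) (hz : 1 < z)
    (hv : Feasible v₁ v₂) : 0 ≤ divergence w₁ v₁ w₂ v₂ := by
  have h1 := h.trace_test_le hz hv (V := 0) (c := 0) (by simp) (by intro f g _ _; simp)
    (by positivity)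
  simpa using h1

lemma TrueGraphs.degree_test_le (h : TrueGraphs s₁ s₂ d z w₁ w₂) (hz : 1 < z)
    (hv : Feasible v₁ v₂) (x : Fin p₁ → ℝ) (y : Fin p₂ → ℝ)
    (hxy : ∀ i j, |x i * y j| ≤ 1 / (2 * z)) :
    (∑ i, x i * degree v₁ i) * (∑ j, y j * degree v₂ j) -
        (∑ i, x i * degree w₁ i) * ∑ j, y j * degree w₂ j ≤
      divergence w₁ v₁ w₂ v₂ + z ^ 2 * ((∑ i, x i ^ 2) * ∑ j, y j ^ 2) := by
  have hsymm : (diagonal x ⊗ₖ diagonal y)ᵀ = diagonal x ⊗ₖ diagonal y := by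
    rw [← kroneckerMap_transpose, diagonal_transpose, diagonal_transpose]
  have happ : ∀ a b : Fin p₁ × Fin p₂, (diagonal x ⊗ₖ diagonal y) a b =
      if a = b then x a.1 * y a.2 else 0 := fun a b => by
    simp only [kroneckerMap_apply, diagonal_apply, Prod.ext_iff]
    by_cases h1 : a.1 = b.1 <;> by_cases h2 : a.2 = b.2 <;> simp [h1, h2]
  have hb : AbsFormBound (diagonal x ⊗ₖ diagonal y) (1 / (2 * z)) := by
    refine absFormBound_of_rowSum (fun a b => ?_) fun a => ?_
    · rw [← transpose_apply (diagonal x ⊗ₖ diagonal y), hsymm]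
    · rw [Finset.sum_eq_single a (fun b _ hb => by rw [happ, if_neg hb.symm, abs_zero]) (by simp),
        happ, if_pos rfl]
      exact hxy _ _
  have h1 := h.trace_test_le hz hv hsymm hb le_rfl
  rw [trace_kron_diagonal_mul_kronLaplacian, trace_kron_diagonal_mul_kronLaplacian,
    ← mul_kronecker_mul, trace_kronecker, diagonal_mul_diagonal, diagonal_mul_diagonal,
    trace_diagonal, trace_diagonal] at h1
  simpa only [sq] using h1

/-- The test `adj (-x) ⊗ adj y` compensates the minus sign of `W₁ ⊗ W₂`. Both sides carry a factor 4
from double counting edges; dividing it out leaves `D / 4`, relaxed to `D`. -/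
lemma TrueGraphs.weight_test_le (h : TrueGraphs s₁ s₂ d z w₁ w₂) (hz : 1 < z)
    (hv : Feasible v₁ v₂) (x : Edge p₁ → ℝ) (y : Edge p₂ → ℝ) {a b : ℝ}
    (hx : AbsFormBound (adj x) a) (hy : AbsFormBound (adj y) b) (hb : 0 ≤ b)
    (hab : a * b ≤ 1 / (2 * z)) :
    (∑ e, x e * v₁ e) * (∑ e, y e * v₂ e) - (∑ e, x e * w₁ e) * ∑ e, y e * w₂ e ≤
      divergence w₁ v₁ w₂ v₂ + z ^ 2 * ((∑ e, x e ^ 2) * ∑ e, y e ^ 2) := by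
  have hx' : AbsFormBound (adj (-x)) a := by
    intro f g hf hg
    have := hx f g hf hg
    have e : ∀ i j, |adj (-x) i j| = |adj x i j| := fun i j => by
      rw [abs_adj, abs_adj]; simp
    simpa only [e] using this
  have hadj : ∀ {p : ℕ} (w : Edge p → ℝ), (adj w)ᵀ = adj w := fun w => by
    ext i j; rw [transpose_apply, adj_symm]
  have hsymm : (adj (-x) ⊗ₖ adj y)ᵀ = adj (-x) ⊗ₖ adj y := by
    rw [← kroneckerMap_transpose, hadj, hadj]
  have h1 := h.trace_test_le hz hv hsymm (hx'.kronecker hy hb) hab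
  rw [trace_kron_adj_mul_kronLaplacian, trace_kron_adj_mul_kronLaplacian, ← mul_kronecker_mul,
    trace_kronecker, trace_adj_mul_adj, trace_adj_mul_adj] at h1
  simp only [Pi.neg_apply, neg_mul, mul_neg, neg_neg, Finset.sum_neg_distrib, ← sq, neg_sq] at h1
  have h0 := h.divergence_nonneg hz hv
  linarith

/-- Cauchy–Schwarz on the support; the only place where sparsity acts. -/
lemma sum_sq_weights_le {p : ℕ} {w x : Edge p → ℝ} {s : ℝ}
    (hs : ((Finset.univ.filter fun e => w e ≠ 0).card : ℝ) ≤ s * p) (hx : ∀ e, |x e| ≤ w e) :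
    (∑ e, x e) ^ 2 ≤ s * p * ∑ e, x e ^ 2 := by
  classical
  set F := Finset.univ.filter fun e => w e ≠ 0 with hF
  have h0 : ∀ e, e ∉ F → x e = 0 := fun e he => by
    have hw : w e = 0 := by simpa [hF] using he
    have := hx e
    rw [hw] at this
    exact abs_nonpos_iff.1 this
  have h1 : ∑ e, x e = ∑ e ∈ F, x e :=
    (Finset.sum_subset (Finset.subset_univ F) fun e _ he => h0 e he).symm
  have h2 : ∑ e, x e ^ 2 = ∑ e ∈ F, x e ^ 2 :=
    (Finset.sum_subset (Finset.subset_univ F) fun e _ he => by rw [h0 e he]; simp).symm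
  rw [h1, h2]
  refine sq_sum_le_card_mul_sum_sq.trans ?_
  exact mul_le_mul_of_nonneg_right hs (Finset.sum_nonneg fun _ _ => sq_nonneg _)

/-- Elementary consequences of the degree and sparsity assumptions on a factor graph. -/
lemma factor_bounds {p : ℕ} {w : Edge p → ℝ} {s d : ℝ} (hp : 0 < p) (hd : 1 < d) (hs : 0 < s)
    (hw : ∀ e, 0 ≤ w e) (hsp : ((Finset.univ.filter fun e => w e ≠ 0).card : ℝ) ≤ s * p)
    (hdeg : ∀ i, 1 / d ≤ degree w i ∧ degree w i ≤ d) :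
    (∀ e, w e ≤ d) ∧ (p / (2 * d) ≤ ∑ e, w e ∧ ∑ e, w e ≤ d * p / 2) ∧
      1 / (4 * d ^ 2 * s) * p ≤ ∑ e, w e * w e ∧ p / d ^ 2 ≤ ∑ i, degree w i ^ 2 := by
  have hp' : (0 : ℝ) < p := by exact_mod_cast hp
  have hd0 : 0 < d := by linarith
  have hsum := sum_degree w
  have h1 : (p : ℝ) * (1 / d) ≤ ∑ i, degree w i := by
    have := Finset.sum_le_sum fun i (_ : i ∈ Finset.univ) => (hdeg i).1
    simpa using this
  have h2 : ∑ i, degree w i ≤ p * d := by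
    have := Finset.sum_le_sum fun i (_ : i ∈ Finset.univ) => (hdeg i).2
    simpa using this
  have h3 : p / (2 * d) ≤ ∑ e, w e := by
    have : p / (2 * d) = (p : ℝ) * (1 / d) / 2 := by field_simp
    rw [this]; linarith
  refine ⟨fun e => (le_degree hw e).trans (hdeg _).2, ⟨h3, by linarith⟩, ?_, ?_⟩
  -- Total weight of order `p` on at most `s p` edges forces a squared norm of order `p`.
  · have h4 := sum_sq_weights_le hsp (fun e => (abs_of_nonneg (hw e)).le)
    simp only [← sq]
    have h5 : (p / (2 * d)) ^ 2 ≤ (∑ e, w e) ^ 2 := by gcongr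
    have h6 := h5.trans h4
    refine le_of_mul_le_mul_left ?_ (mul_pos hs hp')
    refine le_trans (le_of_eq ?_) h6
    field_simp
    norm_num
  · have h4 : ∀ i, 1 / d ^ 2 ≤ degree w i ^ 2 := fun i => by
      have := (hdeg i).1
      have h5 : (1 / d) ^ 2 ≤ degree w i ^ 2 := by gcongr
      rwa [div_pow, one_pow] at h5
    have := Finset.sum_le_sum fun i (_ : i ∈ Finset.univ) => h4 i
    simpa [div_eq_mul_inv] using this

/-- Comparing a minimiser with the optimally rescaled truth. -/
lemma IsPenalizedMLE.divergence_le {α₁ α₂ : ℝ}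
    {S C : Matrix (Fin p₁ × Fin p₂) (Fin p₁ × Fin p₂) ℝ} (hα₁ : 0 < α₁) (hα₂ : 0 < α₂)
    (h : TrueGraphs s₁ s₂ d z w₁ w₂) (hz : 1 < z)
    (hC : IsMoorePenroseInverse (kronLaplacian w₁ w₂) C) (hv : IsPenalizedMLE α₁ α₂ S v₁ v₂)
    (hq₁ : 0 < ∑ e, w₁ e) (hq₂ : 0 < ∑ e, w₂ e) :
    divergence w₁ v₁ w₂ v₂ ≤ (kronLaplacian w₁ w₂ * (S - C)).trace -
      (kronLaplacian v₁ v₂ * (S - C)).trace +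
      2 * √(α₁ * α₂) * (√((∑ e, w₁ e) * ∑ e, w₂ e) - √((∑ e, v₁ e) * ∑ e, v₂ e)) := by
  have := h.nonempty
  set q₁ := ∑ e, w₁ e
  set q₂ := ∑ e, w₂ e
  set t := √(α₂ * q₂ / (α₁ * q₁)) with ht
  -- This `t` makes the two penalty terms of the rescaled truth equal, so AM–GM is an equality for
  -- it, while for the estimate AM–GM bounds the penalty from below.
  have ht0 : 0 < t := by positivity
  have ht2 : t * t = α₂ * q₂ / (α₁ * q₁) := Real.mul_self_sqrt (by positivity)
  have hL := kronLaplacian_smul_smul_inv ht0.ne' w₁ w₂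
  have hfeas : Feasible (t • w₁) (t⁻¹ • w₂) := by
    refine ⟨fun e => ?_, fun e => ?_, by rw [hL]; exact h.posDef hz⟩
    · exact mul_nonneg ht0.le (h.nonneg₁ e)
    · exact mul_nonneg (by positivity) (h.nonneg₂ e)
  have hmin := hv.2 _ _ hfeas
  simp only [penNegLogLik, hL] at hmin
  rw [pseudoDet_eq_det_add_avgMatrix (kronLaplacian_mul_avgMatrix _ _) hv.1.2.2,
    pseudoDet_eq_det_add_avgMatrix (kronLaplacian_mul_avgMatrix _ _) (h.posDef hz)] at hmin
  simp only [Pi.smul_apply, smul_eq_mul, ← Finset.mul_sum] at hmin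
  have hpen : α₁ * (t * q₁) + α₂ * (t⁻¹ * q₂) = 2 * √(α₁ * α₂) * √(q₁ * q₂) := by
    have h1 : α₂ * (t⁻¹ * q₂) = α₁ * (t * q₁) := by
      have : α₂ * q₂ = t * t * (α₁ * q₁) := by rw [ht2]; field_simp
      field_simp
      linarith
    have h2 : α₁ * (t * q₁) = √(α₁ * α₂) * √(q₁ * q₂) := by
      rw [← Real.sqrt_mul (by positivity)]
      symm
      rw [Real.sqrt_eq_iff_mul_self_eq (by positivity) (by positivity)]
      have e : α₁ * (t * q₁) * (α₁ * (t * q₁)) = (t * t) * (α₁ * q₁) ^ 2 := by ring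
      have e' : α₂ * q₂ / (α₁ * q₁) * (α₁ * q₁) ^ 2 = α₁ * α₂ * (q₁ * q₂) := by
        field_simp
      rw [e, ht2, e']
    rw [h1, h2]; ring
  have hpenv : 2 * √(α₁ * α₂) * √((∑ e, v₁ e) * ∑ e, v₂ e) ≤
      α₁ * ∑ e, v₁ e + α₂ * ∑ e, v₂ e := by
    have ha : 0 ≤ ∑ e, v₁ e := Finset.sum_nonneg fun e _ => hv.1.1 e
    have hb : 0 ≤ ∑ e, v₂ e := Finset.sum_nonneg fun e _ => hv.1.2.1 e
    rw [mul_assoc, ← Real.sqrt_mul (by positivity)]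
    have : √(α₁ * α₂ * ((∑ e, v₁ e) * ∑ e, v₂ e)) ≤ (α₁ * ∑ e, v₁ e + α₂ * ∑ e, v₂ e) / 2 := by
      refine Real.sqrt_le_iff.2 ⟨by positivity, ?_⟩
      nlinarith [sq_nonneg (α₁ * ∑ e, v₁ e - α₂ * ∑ e, v₂ e)]
    linarith
  -- `L†` and `(L + J)⁻¹` differ by `J`, which every product Laplacian annihilates.
  have hCtr : ∀ (x₁ : Edge p₁ → ℝ) (x₂ : Edge p₂ → ℝ), (kronLaplacian x₁ x₂ * C).trace =
      ((kronLaplacian w₁ w₂ + avgMatrix (Fin p₁ × Fin p₂))⁻¹ * kronLaplacian x₁ x₂).trace := by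
    intro x₁ x₂
    rw [h.moorePenrose_eq hz hC, mul_sub, kronLaplacian_mul_avgMatrix, sub_zero, trace_mul_comm]
  simp only [divergence, mul_sub, trace_sub, hCtr]
  linarith

lemma frobNorm_sq_sub_le (w₁ v₁ : Edge p₁ → ℝ) (w₂ v₂ : Edge p₂ → ℝ) :
    frobNorm (kronLaplacian v₁ v₂ - kronLaplacian w₁ w₂) ^ 2 ≤
      2 * ∑ i, ∑ j, (degree v₁ i * degree v₂ j - degree w₁ i * degree w₂ j) ^ 2 +
      8 * ∑ e, ∑ f, (v₁ e * v₂ f - w₁ e * w₂ f) ^ 2 := by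
  have hoff : ∑ x : Fin p₁ × Fin p₂, ∑ y : Fin p₁ × Fin p₂,
      (adj v₁ x.1 y.1 * adj v₂ x.2 y.2 - adj w₁ x.1 y.1 * adj w₂ x.2 y.2) ^ 2 =
      4 * ∑ e, ∑ f, (v₁ e * v₂ f - w₁ e * w₂ f) ^ 2 := by
    have hprod : ∀ (a b : Edge p₁ → ℝ) (a' b' : Edge p₂ → ℝ),
        ∑ x : Fin p₁ × Fin p₂, ∑ y : Fin p₁ × Fin p₂,
          (adj a x.1 y.1 * adj b x.1 y.1) * (adj a' x.2 y.2 * adj b' x.2 y.2) =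
        4 * ((∑ e, a e * b e) * ∑ f, a' f * b' f) := by
      intro a b a' b'
      have e1 := sum_adj_mul_adj a b
      have e2 := sum_adj_mul_adj a' b'
      calc _ = (∑ i, ∑ i', adj a i i' * adj b i i') * ∑ j, ∑ j', adj a' j j' * adj b' j j' := by
            simp only [Fintype.sum_prod_type, Finset.sum_mul_sum]
        _ = _ := by rw [e1, e2]; ring
    have hexp : ∀ x y : Fin p₁ × Fin p₂,
        (adj v₁ x.1 y.1 * adj v₂ x.2 y.2 - adj w₁ x.1 y.1 * adj w₂ x.2 y.2) ^ 2 =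
        (adj v₁ x.1 y.1 * adj v₁ x.1 y.1) * (adj v₂ x.2 y.2 * adj v₂ x.2 y.2) -
        2 * ((adj v₁ x.1 y.1 * adj w₁ x.1 y.1) * (adj v₂ x.2 y.2 * adj w₂ x.2 y.2)) +
        (adj w₁ x.1 y.1 * adj w₁ x.1 y.1) * (adj w₂ x.2 y.2 * adj w₂ x.2 y.2) := fun x y => by
      ring
    have hexp' : ∀ e f, (v₁ e * v₂ f - w₁ e * w₂ f) ^ 2 =
        (v₁ e * v₁ e) * (v₂ f * v₂ f) - 2 * ((v₁ e * w₁ e) * (v₂ f * w₂ f)) +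
        (w₁ e * w₁ e) * (w₂ f * w₂ f) := fun e f => by ring
    simp only [hexp, hexp', Finset.sum_add_distrib, Finset.sum_sub_distrib, ← Finset.mul_sum, hprod]
    simp only [← Finset.sum_mul]
    ring
  have hdiag : ∑ x : Fin p₁ × Fin p₂, ∑ y : Fin p₁ × Fin p₂,
      (if x = y then degree v₁ x.1 * degree v₂ x.2 - degree w₁ x.1 * degree w₂ x.2 else 0) ^ 2 =
      ∑ i, ∑ j, (degree v₁ i * degree v₂ j - degree w₁ i * degree w₂ j) ^ 2 := by
    simp only [ite_pow, ne_eq, OfNat.ofNat_ne_zero, not_false_eq_true, zero_pow,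
      Finset.sum_ite_eq, Finset.mem_univ, if_true, Fintype.sum_prod_type]
  have hfrob : ∀ M : Matrix (Fin p₁ × Fin p₂) (Fin p₁ × Fin p₂) ℝ,
      frobNorm M ^ 2 = ∑ i, ∑ j, M i j ^ 2 := fun M =>
    Real.sq_sqrt (Finset.sum_nonneg fun _ _ => Finset.sum_nonneg fun _ _ => sq_nonneg _)
  rw [hfrob, ← hdiag]
  have : 8 * ∑ e, ∑ f, (v₁ e * v₂ f - w₁ e * w₂ f) ^ 2 = 2 * (4 * ∑ e, ∑ f,
    (v₁ e * v₂ f - w₁ e * w₂ f) ^ 2) := by ring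
  rw [this, ← hoff]
  simp only [Finset.mul_sum, ← Finset.sum_add_distrib]
  refine Finset.sum_le_sum fun x _ => Finset.sum_le_sum fun y _ => ?_
  rw [Matrix.sub_apply, kronLaplacian_apply, kronLaplacian_apply]
  split_ifs
  · nlinarith [sq_nonneg (degree v₁ x.1 * degree v₂ x.2 - degree w₁ x.1 * degree w₂ x.2 +
      (adj v₁ x.1 y.1 * adj v₂ x.2 y.2 - adj w₁ x.1 y.1 * adj w₂ x.2 y.2))]
  · nlinarith [sq_nonneg (adj v₁ x.1 y.1 * adj v₂ x.2 y.2 - adj w₁ x.1 y.1 * adj w₂ x.2 y.2)]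

end Deterministic

/-! ### From small noise to small Frobenius error. -/

section Deterministic

variable {p₁ p₂ : ℕ} {s d z : ℝ} {w₁ v₁ : Edge p₁ → ℝ} {w₂ v₂ : Edge p₂ → ℝ}

lemma TrueGraphs.mono {s₁ s₂ s₁' s₂' : ℝ} (h : TrueGraphs s₁ s₂ d z w₁ w₂) (h₁ : s₁ ≤ s₁')
    (h₂ : s₂ ≤ s₂') : TrueGraphs s₁' s₂' d z w₁ w₂ :=
  { h with
    sparse₁ := h.sparse₁.trans (by gcongr)
    sparse₂ := h.sparse₂.trans (by gcongr) }

/-- Reduces noise bounds over all weight vectors to finitely many edge indicators. -/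
lemma abs_apply_le_mul_sum_abs {ι : Type*} [Fintype ι] [DecidableEq ι] (f : (ι → ℝ) →ₗ[ℝ] ℝ)
    {K : ℝ} (hf : ∀ e, |f (Pi.single e 1)| ≤ K) (x : ι → ℝ) : |f x| ≤ K * ∑ e, |x e| := by
  rw [LinearMap.pi_apply_eq_sum_univ f x, Finset.mul_sum]
  refine (Finset.abs_sum_le_sum_abs _ _).trans (Finset.sum_le_sum fun e _ => ?_)
  rw [smul_eq_mul, abs_mul, mul_comm]
  have : (fun j => if e = j then (1 : ℝ) else 0) = Pi.single e 1 := by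
    ext j; simp [Pi.single_apply, eq_comm]
  rw [this]
  exact mul_le_mul_of_nonneg_right (hf e) (abs_nonneg _)

/-- The pairing `(x, y) ↦ ⟨L(x, y), Z⟩` as a bilinear map. -/
noncomputable def tracePairing (Z : Matrix (Fin p₁ × Fin p₂) (Fin p₁ × Fin p₂) ℝ) :
    (Edge p₁ → ℝ) →ₗ[ℝ] (Edge p₂ → ℝ) →ₗ[ℝ] ℝ :=
  (kronLaplacianBilin p₁ p₂).compr₂
    ((Matrix.traceLinearMap (Fin p₁ × Fin p₂) ℝ ℝ).comp (LinearMap.mulRight ℝ Z))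

lemma tracePairing_apply (Z : Matrix (Fin p₁ × Fin p₂) (Fin p₁ × Fin p₂) ℝ)
    (x : Edge p₁ → ℝ) (y : Edge p₂ → ℝ) : tracePairing Z x y = (kronLaplacian x y * Z).trace := rfl

/-- A constant diagonal test; degree sums are twice total weights, whence the 4. -/
lemma TrueGraphs.total_weight_test (h : TrueGraphs s s d z w₁ w₂) (hz : 1 < z)
    (hv : Feasible v₁ v₂) (κ : ℝ) (hκ : |κ| ≤ 1 / (2 * z)) :
    κ * (4 * ((∑ e, v₁ e) * (∑ e, v₂ e) - (∑ e, w₁ e) * ∑ e, w₂ e)) ≤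
      divergence w₁ v₁ w₂ v₂ + z ^ 2 * (p₁ * p₂) * κ ^ 2 := by
  have h1 := h.degree_test_le hz hv (fun _ => κ) (fun _ => 1)
    (fun _ _ => by simpa using hκ)
  simp only [← Finset.mul_sum, one_mul, sum_degree, Finset.sum_const, Finset.card_univ,
    Fintype.card_fin, nsmul_eq_mul, one_pow, mul_one] at h1
  linarith

lemma TrueGraphs.weight_test (h : TrueGraphs s s d z w₁ w₂) (hd : 1 < d) (hz : 1 < z)
    (hv : Feasible v₁ v₂) (κ : ℝ) (x : Edge p₁ → ℝ) (y : Edge p₂ → ℝ) (hx : ∀ e, |x e| ≤ w₁ e)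
    (hy : ∀ e, |y e| ≤ w₂ e) (hκ : |κ| ≤ 1 / (2 * z * d ^ 2)) :
    κ * ((∑ e, x e * v₁ e) * (∑ e, y e * v₂ e) - (∑ e, x e * w₁ e) * ∑ e, y e * w₂ e) ≤
      divergence w₁ v₁ w₂ v₂ + z ^ 2 * ((∑ e, x e ^ 2) * ∑ e, y e ^ 2) * κ ^ 2 := by
  have h1 := h.weight_test_le hz hv (fun e => κ * x e) y (a := |κ| * d) (b := d)
    (adj_absFormBound_of_le (w := |κ| • w₁) (fun e => by
      rw [abs_mul, Pi.smul_apply, smul_eq_mul]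
      exact mul_le_mul_of_nonneg_left (hx e) (abs_nonneg κ)) fun i => by
        rw [degree_smul, Pi.smul_apply, smul_eq_mul]
        exact mul_le_mul_of_nonneg_left (h.degree₁ i).2 (abs_nonneg κ))
    (adj_absFormBound_of_le hy fun i => (h.degree₂ i).2) (by linarith) (by
      calc |κ| * d * d = |κ| * d ^ 2 := by ring
        _ ≤ 1 / (2 * z * d ^ 2) * d ^ 2 := by gcongr
        _ = _ := by field_simp)
  simp only [mul_assoc κ, mul_pow, ← Finset.mul_sum] at h1
  linarith

lemma TrueGraphs.degree_test (h : TrueGraphs s s d z w₁ w₂) (hd : 1 < d) (hz : 1 < z)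
    (hv : Feasible v₁ v₂) (κ : ℝ) (hκ : |κ| ≤ 1 / (2 * z * d ^ 2)) :
    κ * ((∑ i, degree w₁ i * degree v₁ i) * (∑ j, degree w₂ j * degree v₂ j) -
        (∑ i, degree w₁ i ^ 2) * ∑ j, degree w₂ j ^ 2) ≤
      divergence w₁ v₁ w₂ v₂ + z ^ 2 * ((∑ i, degree w₁ i ^ 2) * ∑ j, degree w₂ j ^ 2) * κ ^ 2 := by
  have h1 := h.degree_test_le hz hv (fun i => κ * degree w₁ i) (degree w₂) (fun i j => by
    have e1 := degree_nonneg h.nonneg₁ i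
    have e2 := degree_nonneg h.nonneg₂ j
    have f1 := (h.degree₁ i).2
    have f2 := (h.degree₂ j).2
    rw [abs_mul, abs_mul, abs_of_nonneg e1, abs_of_nonneg e2]
    calc |κ| * degree w₁ i * degree w₂ j ≤ 1 / (2 * z * d ^ 2) * d * d := by gcongr
      _ = _ := by field_simp)
  simp only [mul_assoc κ, mul_pow, ← Finset.mul_sum, ← sq] at h1
  linarith

/-- Optimises the test along the truth itself; smallness of `D` makes the resulting fluctuation at
most `R / 2`. -/
lemma inner_close_of_test {R R' D z d : ℝ} (hR : 0 < R) (hd : 1 < d) (hz : 1 < z)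
    (htest : ∀ κ, |κ| ≤ 1 / (2 * z * d ^ 2) → κ * (R' - R) ≤ D + z ^ 2 * R * κ ^ 2)
    (hD : D ≤ R / (16 * z ^ 2 * d ^ 4)) :
    (R' - R) ^ 2 ≤ 4 * (z ^ 2 * R) * D ∧ R / 2 ≤ R' := by
  have h1 := sq_le_of_forall_quadratic (by positivity) (by positivity) htest (hD.trans (by
    have : z ^ 2 * R * (1 / (2 * z * d ^ 2)) ^ 2 = R / (4 * d ^ 4) := by field_simp; norm_num
    rw [this]
    refine div_le_div_of_nonneg_left hR.le (by positivity) ?_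
    have : 1 ≤ z ^ 2 := one_le_pow₀ hz.le
    have : 0 < d ^ 4 := by positivity
    nlinarith))
  refine ⟨h1, ?_⟩
  have h2 : (R - R') ^ 2 ≤ (R / 2) ^ 2 := by
    calc (R - R') ^ 2 = (R' - R) ^ 2 := by ring
      _ ≤ _ := h1
      _ ≤ 4 * (z ^ 2 * R) * (R / (16 * z ^ 2 * d ^ 4)) := by gcongr
      _ = R ^ 2 / 4 * (1 / d ^ 4) := by field_simp; norm_num
      _ ≤ R ^ 2 / 4 * 1 := by
          gcongr
          rw [div_le_one (by positivity)]
          exact one_le_pow₀ hd.le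
      _ = _ := by ring
  have := le_of_sq_le_sq h2 (by positivity)
  linarith

/-- Crude version of the penalty term: `p₁ + p₂ ≤ 2 p₁ p₂` makes `√(p₁ + p₂)` at most `3d√Q`. -/
lemma penalty_sub_le {a d g ρ Q Q' p₁ p₂ : ℝ} (ha : 0 ≤ a) (hg : 0 ≤ g) (hd : 0 < d)
    (hp₁ : 1 ≤ p₁) (hp₂ : 1 ≤ p₂) (hQ : 0 < Q) (hpQ : p₁ * p₂ ≤ 4 * d ^ 2 * Q) (hρ0 : 0 ≤ ρ)
    (hρ : ρ ≤ a * (g * √(p₁ + p₂))) : 2 * ρ * (√Q - √Q') ≤ 6 * a * d * g * Q := by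
  have hsq : √(p₁ + p₂) ≤ 3 * d * √Q := by
    refine Real.sqrt_le_iff.2 ⟨by positivity, ?_⟩
    rw [mul_pow, Real.sq_sqrt hQ.le]
    nlinarith [mul_nonneg (sub_nonneg.2 hp₁) (sub_nonneg.2 hp₂), mul_pos (pow_pos hd 2) hQ]
  calc 2 * ρ * (√Q - √Q') ≤ 2 * ρ * √Q :=
        mul_le_mul_of_nonneg_left (by linarith [Real.sqrt_nonneg Q']) (by positivity)
    _ ≤ 2 * (a * (g * (3 * d * √Q))) * √Q := by
        have : ρ ≤ a * (g * (3 * d * √Q)) := hρ.trans (by gcongr)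
        gcongr
    _ = 6 * a * d * g * (√Q * √Q) := by ring
    _ = _ := by rw [Real.mul_self_sqrt hQ.le]

/-- A priori bound. Noise and penalty give `D ≤ e (Q' + Q)` with `Q'` the unknown total weight of
the estimate, and `total_weight_lt` removes `Q'`. -/
lemma TrueGraphs.divergence_le_mul_card (h : TrueGraphs s s d z w₁ w₂) (hd : 1 < d) (hz : 1 < z)
    (hs : 1 ≤ s) (hv : Feasible v₁ v₂) {Z : Matrix (Fin p₁ × Fin p₂) (Fin p₁ × Fin p₂) ℝ}
    {a b g ρ : ℝ} (ha : 0 ≤ a) (hb : 0 ≤ b) (hg : 0 ≤ g)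
    (hN : ∀ x y, |tracePairing Z x y| ≤ b * g * ((∑ e, |x e|) * ∑ e, |y e|)) (hρ0 : 0 ≤ ρ)
    (hρ : ρ ≤ a * (g * √(p₁ + p₂)))
    (hbasic : divergence w₁ v₁ w₂ v₂ ≤ tracePairing Z w₁ w₂ - tracePairing Z v₁ v₂ +
      2 * ρ * (√((∑ e, w₁ e) * ∑ e, w₂ e) - √((∑ e, v₁ e) * ∑ e, v₂ e)))
    (hsmall : 3 * ((b + 6 * a * d) * g) * (d ^ 2 * z ^ 2) < 1) :
    divergence w₁ v₁ w₂ v₂ ≤ 3 * ((b + 6 * a * d) * g) * (d ^ 2 / 4 * (p₁ * p₂)) := by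
  obtain ⟨hp₁, hp₂⟩ := h.one_lt (by linarith)
  have hp₁' : (1 : ℝ) ≤ p₁ := by exact_mod_cast hp₁.le
  have hp₂' : (1 : ℝ) ≤ p₂ := by exact_mod_cast hp₂.le
  obtain ⟨-, hq₁, -⟩ := factor_bounds (by omega) hd (by linarith) h.nonneg₁ h.sparse₁ h.degree₁
  obtain ⟨-, hq₂, -⟩ := factor_bounds (by omega) hd (by linarith) h.nonneg₂ h.sparse₂ h.degree₂
  have hw₁ : ∑ e, |w₁ e| = ∑ e, w₁ e :=
    Finset.sum_congr rfl fun e _ => abs_of_nonneg (h.nonneg₁ e)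
  have hw₂ : ∑ e, |w₂ e| = ∑ e, w₂ e :=
    Finset.sum_congr rfl fun e _ => abs_of_nonneg (h.nonneg₂ e)
  have hv₁ : ∑ e, |v₁ e| = ∑ e, v₁ e :=
    Finset.sum_congr rfl fun e _ => abs_of_nonneg (hv.1 e)
  have hv₂ : ∑ e, |v₂ e| = ∑ e, v₂ e :=
    Finset.sum_congr rfl fun e _ => abs_of_nonneg (hv.2.1 e)
  have e1 := (abs_le.1 (hN w₁ w₂)).2
  have e2 := (abs_le.1 (hN v₁ v₂)).1
  rw [hw₁, hw₂] at e1
  rw [hv₁, hv₂] at e2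
  have htest := h.total_weight_test hz hv
  have hd0 : 0 < d := by linarith
  have hq₁0 : 0 < ∑ e, w₁ e := lt_of_lt_of_le (by positivity) hq₁.1
  have hq₂0 : 0 < ∑ e, w₂ e := lt_of_lt_of_le (by positivity) hq₂.1
  have hQ'0 : 0 ≤ (∑ e, v₁ e) * ∑ e, v₂ e :=
    mul_nonneg (Finset.sum_nonneg fun e _ => hv.1 e) (Finset.sum_nonneg fun e _ => hv.2.1 e)
  have hQlow : p₁ * p₂ ≤ 4 * d ^ 2 * ((∑ e, w₁ e) * ∑ e, w₂ e) := by
    have := mul_le_mul hq₁.1 hq₂.1 (by positivity) hq₁0.le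
    calc (p₁ : ℝ) * p₂ = 4 * d ^ 2 * (p₁ / (2 * d) * (p₂ / (2 * d))) := by field_simp; norm_num
      _ ≤ _ := by gcongr
  have hQup : (∑ e, w₁ e) * ∑ e, w₂ e ≤ d ^ 2 / 4 * (p₁ * p₂) := by
    have := mul_le_mul hq₁.2 hq₂.2 hq₂0.le (by positivity)
    calc _ ≤ _ := this
      _ = _ := by ring
  have hQ0 : 0 < (∑ e, w₁ e) * ∑ e, w₂ e := mul_pos hq₁0 hq₂0
  have hpen := penalty_sub_le ha hg hd0 hp₁' hp₂' hQ0 hQlow hρ0 hρ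
    (Q' := (∑ e, v₁ e) * ∑ e, v₂ e)
  have hD : divergence w₁ v₁ w₂ v₂ ≤ (b + 6 * a * d) * g *
      ((∑ e, v₁ e) * (∑ e, v₂ e) + (∑ e, w₁ e) * ∑ e, w₂ e) := by
    have : 0 ≤ 6 * a * d * g * ((∑ e, v₁ e) * ∑ e, v₂ e) :=
      mul_nonneg (by positivity) hQ'0
    linarith
  have he0 : 0 ≤ (b + 6 * a * d) * g := by positivity
  exact (total_weight_lt hd hz hQ0 hQlow hD he0 hsmall htest).trans
    (mul_le_mul_of_nonneg_left hQup (by linarith))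

lemma small_divergence_le {β d z P : ℝ} (hβ : 0 ≤ β) (hβ1 : β ≤ 1) (hd : 1 < d) (hz : 1 < z)
    (hP : 0 ≤ P) : β ^ 2 * P / (16 * z ^ 2 * d ^ 4) ≤ z ^ 2 * P * (1 / (2 * z)) ^ 2 := by
  have e1 : z ^ 2 * P * (1 / (2 * z)) ^ 2 = 1 * P / 4 := by field_simp; norm_num
  have e3 : 4 ≤ 16 * z ^ 2 * d ^ 4 := by
    have f1 : 1 ≤ z ^ 2 := one_le_pow₀ hz.le
    have f2 : 1 ≤ d ^ 4 := one_le_pow₀ hd.le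
    nlinarith
  rw [e1]
  exact div_le_div₀ (by positivity)
    (mul_le_mul_of_nonneg_right (pow_le_one₀ hβ hβ1) hP) (by norm_num) e3

/-- The divergence of a normalised minimiser is at most of the order of the squared rate. -/
lemma TrueGraphs.sqrt_divergence_le_of_normalized (h : TrueGraphs s s d z w₁ w₂) (hd : 1 < d)
    (hz : 1 < z) (hs : 1 ≤ s) (hv : Feasible v₁ v₂)
    {Z : Matrix (Fin p₁ × Fin p₂) (Fin p₁ × Fin p₂) ℝ}
    {a b g ρ β k c c' : ℝ} (hb : 0 ≤ b) (hg : 0 ≤ g) (hβ : β = 1 / (4 * d ^ 2 * s))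
    (hk : k = 1 / (4 * z ^ 2 * d ^ 2)) (hc : c = √(24 * s / (k * β)))
    (hc' : c' = z * d / β + d ^ 2 * c / β + 2 * c) (hsmall : b * g * c' ^ 2 ≤ 1 / 2)
    (hN₁ : ∀ x, |tracePairing Z x w₂| ≤ b * g * √p₂ * ∑ e, |x e|)
    (hN₂ : ∀ y, |tracePairing Z w₁ y| ≤ b * g * √p₁ * ∑ e, |y e|)
    (hN : ∀ x y, |tracePairing Z x y| ≤ b * g * ((∑ e, |x e|) * ∑ e, |y e|)) (hρ0 : 0 ≤ ρ)
    (hρ : ρ ≤ a * (g * √(p₁ + p₂)))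
    (hbasic : divergence w₁ v₁ w₂ v₂ ≤ tracePairing Z w₁ w₂ - tracePairing Z v₁ v₂ +
      2 * ρ * (√((∑ e, w₁ e) * ∑ e, w₂ e) - √((∑ e, v₁ e) * ∑ e, v₂ e)))
    (hD : divergence w₁ v₁ w₂ v₂ ≤ β ^ 2 * (p₁ * p₂) / (16 * z ^ 2 * d ^ 4))
    (hnorm : ∑ e, w₂ e * v₂ e = ∑ e, w₂ e * w₂ e) :
    √(divergence w₁ v₁ w₂ v₂) ≤ 4 * (b * c' + z * d * a) * (g * √(p₁ + p₂)) := by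
  obtain ⟨hp₁, hp₂⟩ := h.one_lt (by linarith)
  have hp₁' : (0 : ℝ) < p₁ := by exact_mod_cast (by omega : 0 < p₁)
  have hp₂' : (0 : ℝ) < p₂ := by exact_mod_cast (by omega : 0 < p₂)
  obtain ⟨hw₁d, hq₁, hW₁, -⟩ :=
    factor_bounds (by omega) hd (by linarith) h.nonneg₁ h.sparse₁ h.degree₁
  obtain ⟨hw₂d, hq₂, hW₂, -⟩ :=
    factor_bounds (by omega) hd (by linarith) h.nonneg₂ h.sparse₂ h.degree₂
  rw [← hβ] at hW₁ hW₂
  have hd0 : 0 < d := by linarith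
  have hz0 : 0 < z := by linarith
  have hs0 : 0 < s := by linarith
  have hβ0 : 0 < β := by rw [hβ]; positivity
  have hβ1 : β ≤ 1 := by
    rw [hβ, div_le_one (by positivity)]
    have : 1 ≤ d ^ 2 := one_le_pow₀ hd.le
    nlinarith
  have hA2 : (√(p₁ : ℝ)) ^ 2 = p₁ := Real.sq_sqrt hp₁'.le
  have hB2 : (√(p₂ : ℝ)) ^ 2 = p₂ := Real.sq_sqrt hp₂'.le
  have hA : 0 < √(p₁ : ℝ) := Real.sqrt_pos.2 hp₁'
  have hB : 0 < √(p₂ : ℝ) := Real.sqrt_pos.2 hp₂'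
  have hD0 := h.divergence_nonneg hz hv
  have hT2 : √(divergence w₁ v₁ w₂ v₂) ^ 2 = divergence w₁ v₁ w₂ v₂ := Real.sq_sqrt hD0
  have hRpos : β ^ 2 * (p₁ * p₂) ≤ (∑ e, w₁ e * w₁ e) * ∑ e, w₂ e * w₂ e := by
    calc β ^ 2 * (p₁ * p₂) = (β * p₁) * (β * p₂) := by ring
      _ ≤ _ := mul_le_mul hW₁ hW₂ (by positivity) (le_trans (by positivity) hW₁)
  have hR0 : 0 < (∑ e, w₁ e * w₁ e) * ∑ e, w₂ e * w₂ e := lt_of_lt_of_le (by positivity) hRpos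
  have habs₁ : ∀ e, |w₁ e| ≤ w₁ e := fun e => (abs_of_nonneg (h.nonneg₁ e)).le
  have habs₂ : ∀ e, |w₂ e| ≤ w₂ e := fun e => (abs_of_nonneg (h.nonneg₂ e)).le
  obtain ⟨hRsq, hRhalf⟩ := inner_close_of_test (D := divergence w₁ v₁ w₂ v₂)
    (R' := (∑ e, w₁ e * v₁ e) * ∑ e, w₂ e * v₂ e) hR0 hd hz
    (fun κ hκ => by
      have := h.weight_test hd hz hv κ w₁ w₂ habs₁ habs₂ hκ
      simpa only [sq] using this)
    (hD.trans (by gcongr))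
  rw [hnorm] at hRsq hRhalf
  have hW₂pos : 0 < ∑ e, w₂ e * w₂ e := lt_of_lt_of_le (by positivity) hW₂
  have hm : (∑ e, w₁ e * w₁ e) / 2 ≤ ∑ e, w₁ e * v₁ e := by
    refine le_of_mul_le_mul_right ?_ hW₂pos
    linarith
  have hQsq := sq_le_of_forall_quadratic (by positivity) (by positivity)
    (h.total_weight_test hz hv) (hD.trans (small_divergence_le hβ0.le hβ1 hd hz (by positivity)))
  have hQ : |(∑ e, v₁ e) * (∑ e, v₂ e) - (∑ e, w₁ e) * ∑ e, w₂ e| ≤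
      z / 2 * (√p₁ * √p₂) * √(divergence w₁ v₁ w₂ v₂) := by
    refine abs_le_of_sq_le_sq ?_ (by positivity)
    rw [mul_pow, mul_pow, mul_pow, hA2, hB2, hT2]
    linarith
  obtain ⟨hμ, hν⟩ := l1_deviations_le (T := √(divergence w₁ v₁ w₂ v₂)) (A := √p₁) (B := √p₂)
    hA hB (Real.sqrt_nonneg _) hd hz hβ0 hs0 hk hc hc'
    h.nonneg₁ h.nonneg₂ hv.1 hv.2.1 hw₁d hw₂d (by rw [hA2]; exact hq₁.2) (by rw [hB2]; exact hq₂.2)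
    (by rw [hA2]; exact hW₁) (by rw [hB2]; exact hW₂)
    (fun x hx => by rw [hA2]; exact sum_sq_weights_le h.sparse₁ hx)
    (fun x hx => by rw [hB2]; exact sum_sq_weights_le h.sparse₂ hx) hm hnorm
    (by rw [hT2, sub_mul]; exact hRsq) hQ
    (fun κ x y hx hy hκ => by rw [hT2]; exact h.weight_test hd hz hv κ x y hx hy hκ)
  have hc0 : 0 ≤ c' := by rw [hc', hc]; positivity
  have hnoise := noise_sub_le (tracePairing Z) hA hB (Real.sqrt_nonneg (divergence w₁ v₁ w₂ v₂)) hc0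
    (mul_nonneg hb hg) hN₁ hN₂ hN hμ hν
  refine sqrt_divergence_le (ρ := ρ) (a := a) hA hB (Real.sqrt_nonneg _) hd0 hz0 hc0 hb hg rfl
    hsmall (by rw [hA2, hB2]) hρ0 hρ (by rw [hA2]; exact hq₁.1) (by rw [hB2]; exact hq₂.1)
    (mul_nonneg (Finset.sum_nonneg fun e _ => hv.1 e) (Finset.sum_nonneg fun e _ => hv.2.1 e))
    hQ hnoise (by rw [hT2]; exact hbasic)

lemma divergence_smul_smul_inv {t : ℝ} (ht : t ≠ 0) :
    divergence w₁ (t • v₁) w₂ (t⁻¹ • v₂) = divergence w₁ v₁ w₂ v₂ := by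
  simp only [divergence, kronLaplacian_smul_smul_inv ht]

lemma Feasible.smul_smul_inv {t : ℝ} (ht : 0 < t) (hv : Feasible v₁ v₂) :
    Feasible (t • v₁) (t⁻¹ • v₂) :=
  ⟨fun e => mul_nonneg ht.le (hv.1 e), fun e => mul_nonneg (inv_pos.2 ht).le (hv.2.1 e), by
    rw [kronLaplacian_smul_smul_inv ht.ne']; exact hv.2.2⟩

/-- A small divergence bounds the Frobenius distance. -/
lemma TrueGraphs.frobNorm_sq_le (h : TrueGraphs s s d z w₁ w₂) (hd : 1 < d)
    (hz : 1 < z) (hs : 1 ≤ s) (hv : Feasible v₁ v₂) {β k : ℝ} (hβ : β = 1 / (4 * d ^ 2 * s))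
    (hk : k = 1 / (4 * z ^ 2 * d ^ 2))
    (hD : divergence w₁ v₁ w₂ v₂ ≤ β ^ 2 * (p₁ * p₂) / (16 * z ^ 2 * d ^ 4))
    (hD₁ : divergence w₁ v₁ w₂ v₂ < k / 4 * (β * p₁))
    (hD₂ : divergence w₁ v₁ w₂ v₂ < k / 4 * (β * p₂)) :
    frobNorm (kronLaplacian v₁ v₂ - kronLaplacian w₁ w₂) ^ 2 ≤
      10 * ((24 + 16 * (1 / β)) / k) * divergence w₁ v₁ w₂ v₂ := by
  obtain ⟨hp₁, hp₂⟩ := h.one_lt (by linarith)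
  have hp₁' : (1 : ℝ) ≤ p₁ := by exact_mod_cast hp₁.le
  have hp₂' : (1 : ℝ) ≤ p₂ := by exact_mod_cast hp₂.le
  obtain ⟨-, -, hW₁, hV₁⟩ :=
    factor_bounds (by omega) hd (by linarith) h.nonneg₁ h.sparse₁ h.degree₁
  obtain ⟨-, -, hW₂, hV₂⟩ :=
    factor_bounds (by omega) hd (by linarith) h.nonneg₂ h.sparse₂ h.degree₂
  rw [← hβ] at hW₁ hW₂
  simp only [← sq] at hW₁ hW₂
  have hd0 : 0 < d := by linarith
  have hz0 : 0 < z := by linarith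
  have hs0 : 0 < s := by linarith
  have hβ0 : 0 < β := by rw [hβ]; positivity
  have hβd : β ≤ 1 / d ^ 2 := by
    rw [hβ]
    refine one_div_le_one_div_of_le (by positivity) ?_
    have : 0 < d ^ 2 := by positivity
    nlinarith
  have hV₁' : β * p₁ ≤ ∑ i, degree w₁ i ^ 2 := by
    refine le_trans ?_ hV₁
    rw [div_eq_mul_one_div, mul_comm]; gcongr
  have hV₂' : β * p₂ ≤ ∑ i, degree w₂ i ^ 2 := by
    refine le_trans ?_ hV₂
    rw [div_eq_mul_one_div, mul_comm]; gcongr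
  have hkpos : 0 < k := by rw [hk]; positivity
  have hZk : z ^ 2 * k ≤ 1 / 4 := by
    have : z ^ 2 * k = 1 / 4 * (1 / d ^ 2) := by rw [hk]; field_simp
    rw [this]
    have : 1 / d ^ 2 ≤ 1 := by rw [div_le_one (by positivity)]; exact one_le_pow₀ hd.le
    linarith
  have hkd : 2 * k * d ≤ 1 / (2 * z) := by
    have : 2 * k * d = 1 / (2 * z) * (1 / (z * d)) := by rw [hk]; field_simp; norm_num
    rw [this]
    refine mul_le_of_le_one_right (by positivity) ?_
    rw [div_le_one (by positivity)]
    nlinarith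
  have hmono : ∀ {W p : ℝ}, β * p ≤ W → divergence w₁ v₁ w₂ v₂ < k / 4 * (β * p) →
      divergence w₁ v₁ w₂ v₂ < k / 4 * W := fun h1 h2 => h2.trans_le (by gcongr)
  -- Makes `h = 1 / β` a valid constant in `sum_sq_rankOne_sub_le`.
  have hone : ∀ {W : ℝ}, β * p₁ ≤ W → 1 ≤ 1 / β * W := fun {W} h1 => by
    rw [div_mul_eq_mul_div, one_mul, le_div_iff₀ hβ0]
    nlinarith
  have hprod : ∀ {W W' : ℝ}, β * p₁ ≤ W → β * p₂ ≤ W' →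
      divergence w₁ v₁ w₂ v₂ ≤ W * W' / (16 * z ^ 2 * d ^ 4) := fun {W W'} h1 h2 => by
    refine hD.trans (div_le_div_of_nonneg_right ?_ (by positivity))
    calc β ^ 2 * (p₁ * p₂) = (β * p₁) * (β * p₂) := by ring
      _ ≤ _ := mul_le_mul h1 h2 (by positivity) (le_trans (by positivity) h1)
  have hpos₁ : 0 < β * p₁ := by positivity
  have hpos₂ : 0 < β * p₂ := by positivity
  have hinner : ∀ {x y X Y : ℝ}, 0 ≤ y → 0 < X → 0 < Y → X * Y / 2 ≤ x * y → 0 < y := by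
    intro x y X Y hy hX hY hle
    rcases hy.eq_or_lt with h0 | h0
    · rw [← h0, mul_zero] at hle
      have := mul_pos hX hY
      linarith
    · exact h0
  have habs₁ : ∀ e, |w₁ e| ≤ w₁ e := fun e => (abs_of_nonneg (h.nonneg₁ e)).le
  have habs₂ : ∀ e, |w₂ e| ≤ w₂ e := fun e => (abs_of_nonneg (h.nonneg₂ e)).le
  -- An edge vector of ℓ² norm at most `k` has adjacency matrix of Frobenius norm at most `√2 k ≤
  -- 2k`; by `hkd` its Kronecker product with a true graph is then an admissible test.
  have hsmall : ∀ {W : ℝ}, W ≤ k ^ 2 → √(2 * W) ≤ 2 * k := fun {W} hW =>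
    Real.sqrt_le_iff.2 ⟨by positivity, by nlinarith⟩
  have hoff : ∑ e, ∑ f, (v₁ e * v₂ f - w₁ e * w₂ f) ^ 2 ≤
      (24 + 16 * (1 / β)) / k * divergence w₁ v₁ w₂ v₂ := by
    have hR := (inner_close_of_test (D := divergence w₁ v₁ w₂ v₂)
      (R := (∑ e, w₁ e ^ 2) * ∑ e, w₂ e ^ 2)
      (R' := (∑ e, w₁ e * v₁ e) * ∑ e, w₂ e * v₂ e)
      (mul_pos (hpos₁.trans_le hW₁) (hpos₂.trans_le hW₂)) hd hz
      (fun κ hκ => by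
        have := h.weight_test hd hz hv κ w₁ w₂ habs₁ habs₂ hκ
        simpa only [sq] using this) (hprod hW₁ hW₂)).2
    refine sum_sq_rankOne_sub_le (Z := z ^ 2) hkpos hZk (hone hW₁) (hpos₂.trans_le hW₂)
      (hpos₁.trans_le hW₁) (hinner (Finset.sum_nonneg fun e _ =>
        mul_nonneg (h.nonneg₂ e) (hv.2.1 e)) (hpos₁.trans_le hW₁) (hpos₂.trans_le hW₂) hR) hR
      (hmono hW₁ hD₁) (hmono hW₂ hD₂) (fun x hx => ?_) (fun y hy => ?_)
    · exact h.weight_test_le hz hv x w₂ (adj_absFormBound_of_sum_sq x)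
        (adj_absFormBound_of_le habs₂ fun i => (h.degree₂ i).2) hd0.le
        (le_trans (mul_le_mul_of_nonneg_right (hsmall hx) hd0.le) hkd)
    · refine h.weight_test_le hz hv w₁ y (adj_absFormBound_of_le habs₁ fun i => (h.degree₁ i).2)
        (adj_absFormBound_of_sum_sq y) (Real.sqrt_nonneg _) ?_
      rw [mul_comm]
      exact le_trans (mul_le_mul_of_nonneg_right (hsmall hy) hd0.le) hkd
  have habs_le : ∀ {n : ℕ} (x : Fin n → ℝ) (i : Fin n), ∑ i, x i ^ 2 ≤ k ^ 2 → |x i| ≤ k :=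
    fun x i hx => abs_le_of_sq_le_sq
      ((Finset.single_le_sum (f := fun i => x i ^ 2) (fun j _ => sq_nonneg (x j))
        (Finset.mem_univ i)).trans hx) hkpos.le
  have hkd' : k * d ≤ 1 / (2 * z) := by
    have : 0 < k * d := by positivity
    linarith
  have hdiag : ∑ i, ∑ j, (degree v₁ i * degree v₂ j - degree w₁ i * degree w₂ j) ^ 2 ≤
      (24 + 16 * (1 / β)) / k * divergence w₁ v₁ w₂ v₂ := by
    have hR := (inner_close_of_test (D := divergence w₁ v₁ w₂ v₂)
      (R := (∑ i, degree w₁ i ^ 2) * ∑ j, degree w₂ j ^ 2)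
      (R' := (∑ i, degree w₁ i * degree v₁ i) * ∑ j, degree w₂ j * degree v₂ j)
      (mul_pos (hpos₁.trans_le hV₁') (hpos₂.trans_le hV₂')) hd hz
      (h.degree_test hd hz hv) (hprod hV₁' hV₂')).2
    refine sum_sq_rankOne_sub_le (Z := z ^ 2) hkpos hZk (hone hV₁') (hpos₂.trans_le hV₂')
      (hpos₁.trans_le hV₁') (hinner (Finset.sum_nonneg fun e _ =>
        mul_nonneg (degree_nonneg h.nonneg₂ e) (degree_nonneg hv.2.1 e)) (hpos₁.trans_le hV₁')
        (hpos₂.trans_le hV₂') hR) hR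
      (hmono hV₁' hD₁) (hmono hV₂' hD₂) (fun x hx => ?_) (fun y hy => ?_)
    · refine h.degree_test_le hz hv x (degree w₂) fun i j => ?_
      rw [abs_mul, abs_of_nonneg (degree_nonneg h.nonneg₂ j)]
      exact (mul_le_mul (habs_le x i hx) (h.degree₂ j).2 (degree_nonneg h.nonneg₂ j)
        hkpos.le).trans hkd'
    · refine h.degree_test_le hz hv (degree w₁) y fun i j => ?_
      rw [abs_mul, abs_of_nonneg (degree_nonneg h.nonneg₁ i), mul_comm]
      exact (mul_le_mul (habs_le y j hy) (h.degree₁ i).2 (degree_nonneg h.nonneg₁ i)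
        hkpos.le).trans hkd'
  have := frobNorm_sq_sub_le w₁ v₁ w₂ v₂
  linarith

lemma sqrt_mul_penalties_le {a g α₁ α₂ P₁ P₂ : ℝ} (hg : 0 ≤ g) (ha : 0 ≤ a) (hP₁ : 0 ≤ P₁)
    (hP₂ : 0 ≤ P₂) (hα₁' : α₁ ≤ a * (g * √P₂)) (hα₂ : 0 < α₂)
    (hα₂' : α₂ ≤ a * (g * √P₁)) : √(α₁ * α₂) ≤ a * (g * √(P₁ + P₂)) := by
  refine Real.sqrt_le_iff.2 ⟨by positivity, ?_⟩
  have h1 : √P₁ ≤ √(P₁ + P₂) := Real.sqrt_le_sqrt (by linarith)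
  have h2 : √P₂ ≤ √(P₁ + P₂) := Real.sqrt_le_sqrt (by linarith)
  rw [sq]
  refine mul_le_mul (hα₁'.trans ?_) (hα₂'.trans ?_) hα₂.le (by positivity) <;> gcongr

/-- Lets the estimate be normalised against `w₂`: the product of inner products is at least half its
true value, so neither factor vanishes. -/
lemma TrueGraphs.sum_mul_pos (h : TrueGraphs s s d z w₁ w₂) (hd : 1 < d) (hz : 1 < z)
    (hs : 1 ≤ s) (hv : Feasible v₁ v₂) {β : ℝ} (hβ : β = 1 / (4 * d ^ 2 * s))
    (hD : divergence w₁ v₁ w₂ v₂ ≤ β ^ 2 * (p₁ * p₂) / (16 * z ^ 2 * d ^ 4)) :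
    0 < ∑ e, w₂ e * v₂ e ∧ 0 < ∑ e, w₂ e * w₂ e := by
  obtain ⟨hp₁, hp₂⟩ := h.one_lt (by linarith)
  have hp₁' : (0 : ℝ) < p₁ := by exact_mod_cast (by omega : 0 < p₁)
  have hp₂' : (0 : ℝ) < p₂ := by exact_mod_cast (by omega : 0 < p₂)
  obtain ⟨-, -, hW₁, -⟩ :=
    factor_bounds (by omega) hd (by linarith) h.nonneg₁ h.sparse₁ h.degree₁
  obtain ⟨-, -, hW₂, -⟩ :=
    factor_bounds (by omega) hd (by linarith) h.nonneg₂ h.sparse₂ h.degree₂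
  rw [← hβ] at hW₁ hW₂
  have hd0 : 0 < d := by linarith
  have hs0 : 0 < s := by linarith
  have hβ0 : 0 < β := by rw [hβ]; positivity
  have hRpos : β ^ 2 * (p₁ * p₂) ≤ (∑ e, w₁ e * w₁ e) * ∑ e, w₂ e * w₂ e := by
    calc β ^ 2 * (p₁ * p₂) = (β * p₁) * (β * p₂) := by ring
      _ ≤ _ := mul_le_mul hW₁ hW₂ (by positivity) (le_trans (by positivity) hW₁)
  have hR0 : 0 < (∑ e, w₁ e * w₁ e) * ∑ e, w₂ e * w₂ e := lt_of_lt_of_le (by positivity) hRpos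
  have hR := (inner_close_of_test (D := divergence w₁ v₁ w₂ v₂)
    (R' := (∑ e, w₁ e * v₁ e) * ∑ e, w₂ e * v₂ e) hR0 hd hz
    (fun κ hκ => by
      have := h.weight_test hd hz hv κ w₁ w₂ (fun e => (abs_of_nonneg (h.nonneg₁ e)).le)
        (fun e => (abs_of_nonneg (h.nonneg₂ e)).le) hκ
      simpa only [sq] using this)
    (hD.trans (div_le_div_of_nonneg_right hRpos (by positivity)))).2
  have h0 : 0 ≤ ∑ e, w₂ e * v₂ e :=
    Finset.sum_nonneg fun e _ => mul_nonneg (h.nonneg₂ e) (hv.2.1 e)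
  refine ⟨h0.lt_of_ne fun heq => ?_, lt_of_lt_of_le (by positivity) hW₂⟩
  rw [← heq, mul_zero] at hR
  linarith

/-- Deterministic error bound for a penalised maximum likelihood estimator in terms of the noise
level on the edge indicators. -/
lemma IsPenalizedMLE.frobNorm_sq_le {S C : Matrix (Fin p₁ × Fin p₂) (Fin p₁ × Fin p₂) ℝ}
    {α₁ α₂ a b g β k c c' : ℝ} (hv : IsPenalizedMLE α₁ α₂ S v₁ v₂)
    (h : TrueGraphs s s d z w₁ w₂) (hd : 1 < d) (hz : 1 < z) (hs : 1 ≤ s)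
    (hC : IsMoorePenroseInverse (kronLaplacian w₁ w₂) C) (ha : 0 ≤ a) (hb : 0 ≤ b) (hg : 0 ≤ g)
    (hβ : β = 1 / (4 * d ^ 2 * s))
    (hk : k = 1 / (4 * z ^ 2 * d ^ 2)) (hc : c = √(24 * s / (k * β)))
    (hc' : c' = z * d / β + d ^ 2 * c / β + 2 * c)
    (hα₁ : 0 < α₁) (hα₁' : α₁ ≤ a * (g * √p₂)) (hα₂ : 0 < α₂) (hα₂' : α₂ ≤ a * (g * √p₁))
    (hN₁ : ∀ e, |(kronLaplacian (Pi.single e 1) w₂ * (S - C)).trace| ≤ b * g * √p₂)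
    (hN₂ : ∀ f, |(kronLaplacian w₁ (Pi.single f 1) * (S - C)).trace| ≤ b * g * √p₁)
    (hN : ∀ e f, |(kronLaplacian (Pi.single e 1) (Pi.single f 1) * (S - C)).trace| ≤ b * g)
    (hsmall : 3 * ((b + 6 * a * d) * g) * (d ^ 2 * z ^ 2) < 1)
    (hsmall_sq : 3 * ((b + 6 * a * d) * g) * (d ^ 2 / 4) ≤ β ^ 2 / (16 * z ^ 2 * d ^ 4))
    (hsmall_noise : b * g * c' ^ 2 ≤ 1 / 2)
    (hθ₁ : (4 * (b * c' + z * d * a)) ^ 2 * (g ^ 2 * (p₁ + p₂)) < k / 4 * (β * p₁))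
    (hθ₂ : (4 * (b * c' + z * d * a)) ^ 2 * (g ^ 2 * (p₁ + p₂)) < k / 4 * (β * p₂)) :
    frobNorm (kronLaplacian v₁ v₂ - kronLaplacian w₁ w₂) ^ 2 ≤
      10 * ((24 + 16 * (1 / β)) / k) *
        ((4 * (b * c' + z * d * a)) ^ 2 * (g ^ 2 * (p₁ + p₂))) := by
  obtain ⟨hp₁, hp₂⟩ := h.one_lt (by linarith)
  have hp₁' : (0 : ℝ) < p₁ := by exact_mod_cast (by omega : 0 < p₁)
  have hp₂' : (0 : ℝ) < p₂ := by exact_mod_cast (by omega : 0 < p₂)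
  have hd0 : 0 < d := by linarith
  have hs0 : 0 < s := by linarith
  obtain ⟨-, hq₁, -, -⟩ :=
    factor_bounds (by omega) hd hs0 h.nonneg₁ h.sparse₁ h.degree₁
  obtain ⟨-, hq₂, -, -⟩ :=
    factor_bounds (by omega) hd hs0 h.nonneg₂ h.sparse₂ h.degree₂
  have hM₁ : ∀ x, |tracePairing (S - C) x w₂| ≤ b * g * √p₂ * ∑ e, |x e| := fun x =>
    abs_apply_le_mul_sum_abs ((tracePairing (S - C)).flip w₂) hN₁ x
  have hM₂ : ∀ y, |tracePairing (S - C) w₁ y| ≤ b * g * √p₁ * ∑ e, |y e| := fun y =>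
    abs_apply_le_mul_sum_abs (tracePairing (S - C) w₁) hN₂ y
  have hM : ∀ x y, |tracePairing (S - C) x y| ≤ b * g * ((∑ e, |x e|) * ∑ e, |y e|) := by
    intro x y
    rw [← mul_assoc]
    exact abs_apply_le_mul_sum_abs (tracePairing (S - C) x) (fun f =>
      abs_apply_le_mul_sum_abs ((tracePairing (S - C)).flip (Pi.single f 1))
        (fun e => hN e f) x) y
  have hbasic := hv.divergence_le hα₁ hα₂ h hz hC
    (lt_of_lt_of_le (by positivity) hq₁.1) (lt_of_lt_of_le (by positivity) hq₂.1)
  have hρ := sqrt_mul_penalties_le hg ha hp₁'.le hp₂'.le hα₁' hα₂ hα₂'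
  have hD : divergence w₁ v₁ w₂ v₂ ≤ β ^ 2 * (p₁ * p₂) / (16 * z ^ 2 * d ^ 4) := by
    refine (h.divergence_le_mul_card hd hz hs hv.1 ha hb hg hM (Real.sqrt_nonneg _) hρ hbasic
      hsmall).trans ?_
    have := mul_le_mul_of_nonneg_right hsmall_sq (mul_nonneg hp₁'.le hp₂'.le)
    rw [mul_div_right_comm]
    linarith
  obtain ⟨hvv, hww⟩ := h.sum_mul_pos hd hz hs hv.1 hβ hD
  -- The normalising scale; divergence, feasibility and the basic inequality are all invariant under
  -- it.
  have ht0 : 0 < (∑ e, w₂ e * v₂ e) / ∑ e, w₂ e * w₂ e := div_pos hvv hww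
  obtain ⟨t, ht⟩ : ∃ t, t = (∑ e, w₂ e * v₂ e) / ∑ e, w₂ e * w₂ e := ⟨_, rfl⟩
  rw [← ht] at ht0
  have hnorm : ∑ e, w₂ e * (t⁻¹ • v₂) e = ∑ e, w₂ e * w₂ e := by
    have : ∑ e, w₂ e * (t⁻¹ • v₂) e = t⁻¹ * ∑ e, w₂ e * v₂ e := by
      rw [Finset.mul_sum]
      exact Finset.sum_congr rfl fun e _ => by simp only [Pi.smul_apply, smul_eq_mul]; ring
    rw [this, ht, inv_div, div_mul_cancel₀ _ hvv.ne']
  have hsum : (∑ e, (t • v₁) e) * ∑ e, (t⁻¹ • v₂) e = (∑ e, v₁ e) * ∑ e, v₂ e := by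
    simp only [Pi.smul_apply, smul_eq_mul, ← Finset.mul_sum]
    field_simp
  have hT := h.sqrt_divergence_le_of_normalized hd hz hs (hv.1.smul_smul_inv ht0)
    (Z := S - C) (a := a) (ρ := √(α₁ * α₂)) hb hg hβ hk hc hc'
    hsmall_noise hM₁ hM₂ hM (Real.sqrt_nonneg _) hρ (by
      rw [divergence_smul_smul_inv ht0.ne', hsum, tracePairing_apply, tracePairing_apply,
        kronLaplacian_smul_smul_inv ht0.ne']
      exact hbasic) (by rw [divergence_smul_smul_inv ht0.ne']; exact hD) hnorm
  rw [divergence_smul_smul_inv ht0.ne'] at hT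
  have hD' : divergence w₁ v₁ w₂ v₂ ≤
      (4 * (b * c' + z * d * a)) ^ 2 * (g ^ 2 * (p₁ + p₂)) := by
    have h1 := Real.sq_sqrt (h.divergence_nonneg hz hv.1)
    have h2 := pow_le_pow_left₀ (Real.sqrt_nonneg _) hT 2
    rwa [h1, mul_pow _ (g * √(p₁ + p₂)), mul_pow g, Real.sq_sqrt (by positivity)] at h2
  refine (h.frobNorm_sq_le hd hz hs hv.1 hβ hk hD (hD'.trans_lt hθ₁) (hD'.trans_lt hθ₂)).trans ?_
  refine mul_le_mul_of_nonneg_left hD' ?_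
  rw [hβ, hk]
  positivity

/-- Deterministic consistency with constants depending only on the model parameters. -/
lemma exists_forall_frobNorm_le {s d z a b : ℝ} (hs : 1 ≤ s) (hd : 1 < d) (hz : 1 < z)
    (ha : 0 ≤ a) (hb : 0 ≤ b) :
    ∃ g₀ > 0, ∃ θ > 0, ∃ c > 0, ∀ {p₁ p₂ : ℕ} {w₁ : Edge p₁ → ℝ} {w₂ : Edge p₂ → ℝ}
      {S C : Matrix (Fin p₁ × Fin p₂) (Fin p₁ × Fin p₂) ℝ} {α₁ α₂ g : ℝ},
      TrueGraphs s s d z w₁ w₂ → IsMoorePenroseInverse (kronLaplacian w₁ w₂) C → 0 ≤ g → g ≤ g₀ →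
      g ^ 2 * (p₁ + p₂) ≤ θ * p₁ → g ^ 2 * (p₁ + p₂) ≤ θ * p₂ →
      0 < α₁ → α₁ ≤ a * (g * √p₂) → 0 < α₂ → α₂ ≤ a * (g * √p₁) →
      (∀ e, |(kronLaplacian (Pi.single e 1) w₂ * (S - C)).trace| ≤ b * g * √p₂) →
      (∀ f, |(kronLaplacian w₁ (Pi.single f 1) * (S - C)).trace| ≤ b * g * √p₁) →
      (∀ e f, |(kronLaplacian (Pi.single e 1) (Pi.single f 1) * (S - C)).trace| ≤ b * g) →
      ∀ {v₁ v₂}, IsPenalizedMLE α₁ α₂ S v₁ v₂ →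
        frobNorm (kronLaplacian v₁ v₂ - kronLaplacian w₁ w₂) ≤ c * (g * √(p₁ + p₂)) := by
  have hd0 : 0 < d := by linarith
  have hz0 : 0 < z := by linarith
  have hs0 : 0 < s := by linarith
  obtain ⟨β, hβ⟩ : ∃ β, β = 1 / (4 * d ^ 2 * s) := ⟨_, rfl⟩
  obtain ⟨k, hk⟩ : ∃ k, k = 1 / (4 * z ^ 2 * d ^ 2) := ⟨_, rfl⟩
  obtain ⟨c, hc⟩ : ∃ c, c = √(24 * s / (k * β)) := ⟨_, rfl⟩
  obtain ⟨c', hc'⟩ : ∃ c', c' = z * d / β + d ^ 2 * c / β + 2 * c := ⟨_, rfl⟩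
  have hβ0 : 0 < β := by rw [hβ]; positivity
  have hk0 : 0 < k := by rw [hk]; positivity
  have hsmall : ∀ x y : ℝ, 0 ≤ x → 0 < y → ∃ g₀ > 0, ∀ g, 0 ≤ g → g ≤ g₀ → x * g < y := by
    intro x y hx hy
    refine ⟨y / (x + 1), by positivity, fun g hg hle => ?_⟩
    rw [le_div_iff₀ (by linarith)] at hle
    rcases hg.eq_or_lt with h0 | h0
    · rw [← h0]; simpa using hy
    · linarith
  obtain ⟨g₁, hg₁, h₁⟩ := hsmall (3 * (b + 6 * a * d) * (d ^ 2 * z ^ 2)) 1 (by positivity) one_pos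
  obtain ⟨g₂, hg₂, h₂⟩ := hsmall (3 * (b + 6 * a * d) * (d ^ 2 / 4)) (β ^ 2 / (16 * z ^ 2 * d ^ 4))
    (by positivity) (by positivity)
  obtain ⟨g₃, hg₃, h₃⟩ := hsmall (b * c' ^ 2) (1 / 2) (by positivity) (by positivity)
  obtain ⟨θ, hθ, h₄⟩ := hsmall ((4 * (b * c' + z * d * a)) ^ 2) (k / 4 * β) (by positivity)
    (by positivity)
  -- The added 1 keeps the constant positive when `a` and `b` vanish.
  have hK : 0 < 10 * ((24 + 16 * (1 / β)) / k) * (4 * (b * c' + z * d * a)) ^ 2 + 1 := by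
    positivity
  refine ⟨min g₁ (min g₂ g₃), by positivity, θ, hθ,
    √(10 * ((24 + 16 * (1 / β)) / k) * (4 * (b * c' + z * d * a)) ^ 2 + 1), by positivity, ?_⟩
  intro p₁ p₂ w₁ w₂ S C α₁ α₂ g h hC hg hgle hθ₁ hθ₂ hα₁ hα₁' hα₂ hα₂' hN₁ hN₂ hN v₁ v₂ hv
  obtain ⟨hp₁, hp₂⟩ := h.one_lt (by linarith)
  have hp₁' : (0 : ℝ) < p₁ := by exact_mod_cast (by omega : 0 < p₁)
  have hp₂' : (0 : ℝ) < p₂ := by exact_mod_cast (by omega : 0 < p₂)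
  have hle₁ := hgle.trans (min_le_left _ _)
  have hle₂ := hgle.trans ((min_le_right _ _).trans (min_le_left _ _))
  have hle₃ := hgle.trans ((min_le_right _ _).trans (min_le_right _ _))
  have hθ' : ∀ p : ℝ, 0 < p → g ^ 2 * (p₁ + p₂) ≤ θ * p →
      (4 * (b * c' + z * d * a)) ^ 2 * (g ^ 2 * (p₁ + p₂)) < k / 4 * (β * p) := by
    intro p hp hle
    have h5 := mul_lt_mul_of_pos_right (h₄ θ hθ.le le_rfl) hp
    have h6 := mul_le_mul_of_nonneg_left hle (sq_nonneg (4 * (b * c' + z * d * a)))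
    linarith
  have hmain := hv.frobNorm_sq_le h hd hz hs hC ha hb hg hβ hk hc hc' hα₁ hα₁' hα₂ hα₂' hN₁ hN₂ hN
    (by linarith [h₁ g hg hle₁]) (by linarith [h₂ g hg hle₂]) (by linarith [h₃ g hg hle₃])
    (hθ' _ hp₁' hθ₁) (hθ' _ hp₂' hθ₂)
  refine le_of_sq_le_sq (hmain.trans ?_) (by positivity)
  rw [mul_pow _ (g * √(p₁ + p₂)), mul_pow g, Real.sq_sqrt hK.le, Real.sq_sqrt (by positivity), ← mul_assoc]
  exact mul_le_mul_of_nonneg_right (by linarith) (by positivity)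

end Deterministic

/-! ### Noise bounds with high probability and the conclusion. -/

section Probability

/-- Chernoff at `t = g / √P`: the variance proxy grows like `P` and the threshold like `g√P`, so the
exponent is `-κ n g² = -κ log p`. -/
lemma measureReal_abs_trace_sampleCov_sub_ge_le_rpow {ι : Type*} [Fintype ι] [DecidableEq ι] {n : ℕ}
    (hn : 0 < n) {Ω : Type*} [MeasurableSpace Ω] (μ : Measure Ω) [IsProbabilityMeasure μ]
    {X : Fin n → Ω → EuclideanSpace ℝ ι} {A C : Matrix ι ι ℝ} {z d κ g P p : ℝ}
    (hX : iIndepFun X μ) (hlaw : ∀ k, HasLaw (X k) (multivariateGaussian 0 C) μ) (hz : 0 < z)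
    (hd : 0 < d) (hA : A.PosSemidef) (hC : C.PosSemidef)
    (hAd : ∀ ξ : ι → ℝ, ξ ⬝ᵥ A *ᵥ ξ ≤ 8 * d * (ξ ⬝ᵥ ξ)) (htr : A.trace ≤ 4 * d * P)
    (hCz : ∀ ξ : ι → ℝ, ξ ⬝ᵥ C *ᵥ ξ ≤ z * (ξ ⬝ᵥ ξ)) (hg : 0 ≤ g) (hp : 0 < p) (hP : 1 ≤ P)
    (hgn : n * g ^ 2 = Real.log p) (hgz : g * (32 * d * z) ≤ 1) :
    μ.real {ω | (64 * d ^ 2 * z ^ 2 + κ) * g * √P ≤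
      |(A * (sampleCov (fun k => X k ω) - C)).trace|} ≤ 2 * p ^ (-κ) := by
  have hP0 : 0 < P := by linarith
  have hsP : 1 ≤ √P := Real.one_le_sqrt.2 hP
  have hsP0 : 0 < √P := by linarith
  have hsq : √P ^ 2 = P := Real.sq_sqrt hP0.le
  have hle : g / √P ≤ g := div_le_self hg hsP
  refine (measure_abs_trace_sampleCov_sub_ge hn μ (t := g / √P) hX hlaw hz.le
    (by positivity : 0 ≤ 8 * d) hA hC hAd hCz (by positivity) ?_).trans ?_
  · have := mul_le_mul_of_nonneg_right hle (by positivity : 0 ≤ 8 * d * z)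
    linarith
  · rw [Real.rpow_def_of_pos hp]
    refine mul_le_mul_of_nonneg_left (Real.exp_le_exp.2 ?_) zero_le_two
    have e1 : g / √P * ((64 * d ^ 2 * z ^ 2 + κ) * g * √P) = (64 * d ^ 2 * z ^ 2 + κ) * g ^ 2 := by
      field_simp
    have e2 : 2 * (g / √P) ^ 2 * (8 * d * z * (z * A.trace)) ≤ 64 * d ^ 2 * z ^ 2 * g ^ 2 := by
      calc 2 * (g / √P) ^ 2 * (8 * d * z * (z * A.trace))
          ≤ 2 * (g / √P) ^ 2 * (8 * d * z * (z * (4 * d * P))) := by gcongr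
        _ = _ := by rw [div_pow, hsq]; field_simp; ring
    rw [e1, ← hgn]
    calc _ ≤ (n : ℝ) * (-((64 * d ^ 2 * z ^ 2 + κ) * g ^ 2) + 64 * d ^ 2 * z ^ 2 * g ^ 2) := by
          gcongr
      _ = _ := by ring

lemma single_one_nonneg {p : ℕ} (e : Edge p) : ∀ f, 0 ≤ (Pi.single e 1 : Edge p → ℝ) f := by
  intro f
  rw [Pi.single_apply]
  split_ifs <;> norm_num

lemma degree_single_le {p : ℕ} (e : Edge p) (i : Fin p) : degree (Pi.single e 1) i ≤ 2 := by
  have h1 := sum_degree (Pi.single e (1 : ℝ))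
  rw [Finset.sum_pi_single'] at h1
  simp only [Finset.mem_univ, if_true, mul_one] at h1
  rw [← h1]
  exact Finset.single_le_sum (fun j _ => degree_nonneg (single_one_nonneg e) j)
    (Finset.mem_univ i)

lemma card_edge_le (p : ℕ) : (Fintype.card (Edge p) : ℝ) ≤ (p : ℝ) ^ 2 := by
  have h := Fintype.card_subtype_le (fun e : Fin p × Fin p => e.2 < e.1)
  rw [Fintype.card_prod, Fintype.card_fin, ← sq] at h
  exact_mod_cast h

/-- At most `3p²` events, each with a two-sided tail; the 5 extra powers absorb `6p²` because `p ≥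
4`. -/
lemma union_bound_rpow_le {p₁ p₂ τ : ℝ} (hp₁ : 2 ≤ p₁) (hp₂ : 2 ≤ p₂) :
    (p₁ ^ 2 + (p₂ ^ 2 + p₁ ^ 2 * p₂ ^ 2)) * (2 * (p₁ * p₂) ^ (-(τ + 5))) ≤
      (p₁ * p₂) ^ (-τ) := by
  have hp : 0 < p₁ * p₂ := by positivity
  have h4 : 4 ≤ p₁ * p₂ := by nlinarith
  have e : (p₁ * p₂) ^ (-(τ + 5)) = (p₁ * p₂) ^ (-τ) / (p₁ * p₂) ^ 5 := by
    rw [← Real.rpow_natCast, ← Real.rpow_sub hp]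
    norm_num
    ring_nf
  have h1 : p₁ ^ 2 + (p₂ ^ 2 + p₁ ^ 2 * p₂ ^ 2) ≤ 3 * (p₁ * p₂) ^ 2 := by
    have f1 : p₁ ^ 2 * 1 ≤ p₁ ^ 2 * p₂ ^ 2 := by gcongr; nlinarith
    have f2 : 1 * p₂ ^ 2 ≤ p₁ ^ 2 * p₂ ^ 2 := by gcongr; nlinarith
    rw [mul_pow]
    linarith
  have h2 : 6 * (p₁ * p₂) ^ 2 ≤ (p₁ * p₂) ^ 5 := by
    have : 4 ^ 3 ≤ (p₁ * p₂) ^ 3 := by gcongr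
    calc 6 * (p₁ * p₂) ^ 2 ≤ (p₁ * p₂) ^ 3 * (p₁ * p₂) ^ 2 := by gcongr; linarith
      _ = _ := by ring
  have h3 : 0 < (p₁ * p₂) ^ (-τ) := Real.rpow_pos_of_pos hp _
  rw [e]
  calc _ ≤ 3 * (p₁ * p₂) ^ 2 * (2 * ((p₁ * p₂) ^ (-τ) / (p₁ * p₂) ^ 5)) := by gcongr
    _ = (6 * (p₁ * p₂) ^ 2) * ((p₁ * p₂) ^ (-τ) / (p₁ * p₂) ^ 5) := by ring
    _ ≤ (p₁ * p₂) ^ 5 * ((p₁ * p₂) ^ (-τ) / (p₁ * p₂) ^ 5) := by gcongr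
    _ = _ := by field_simp

variable {p₁ p₂ : ℕ} {s₁ s₂ d z : ℝ} {w₁ : Edge p₁ → ℝ} {w₂ : Edge p₂ → ℝ}

/-- With high probability the noise is uniformly small on all edge indicators. -/
lemma TrueGraphs.measureReal_noise_le (h : TrueGraphs s₁ s₂ d z w₁ w₂) (hd : 1 < d) (hz : 1 < z)
    {n : ℕ} (hn : 0 < n) {Ω : Type*} [MeasurableSpace Ω] (μ : Measure Ω) [IsProbabilityMeasure μ]
    {X : Fin n → Ω → EuclideanSpace ℝ (Fin p₁ × Fin p₂)}
    {C : Matrix (Fin p₁ × Fin p₂) (Fin p₁ × Fin p₂) ℝ} {τ g b : ℝ}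
    (hC : IsMoorePenroseInverse (kronLaplacian w₁ w₂) C) (hX : iIndepFun X μ)
    (hlaw : ∀ k, HasLaw (X k) (multivariateGaussian 0 C) μ) (hg : 0 ≤ g)
    (hgn : n * g ^ 2 = Real.log (p₁ * p₂)) (hgz : g * (32 * d * z) ≤ 1)
    (hb : b = 64 * d ^ 2 * z ^ 2 + (τ + 5)) :
    μ.real {ω | ¬ ((∀ e, |(kronLaplacian (Pi.single e 1) w₂ *
          (sampleCov (fun k => X k ω) - C)).trace| ≤ b * g * √p₂) ∧
        (∀ f, |(kronLaplacian w₁ (Pi.single f 1) *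
          (sampleCov (fun k => X k ω) - C)).trace| ≤ b * g * √p₁) ∧
        ∀ e f, |(kronLaplacian (Pi.single e 1) (Pi.single f 1) *
          (sampleCov (fun k => X k ω) - C)).trace| ≤ b * g)} ≤
      ((p₁ : ℝ) * p₂) ^ (-τ) := by
  obtain ⟨hp₁, hp₂⟩ := h.one_lt (by linarith)
  have hp₁' : (2 : ℝ) ≤ p₁ := by exact_mod_cast hp₁
  have hp₂' : (2 : ℝ) ≤ p₂ := by exact_mod_cast hp₂
  have hd0 : 0 < d := by linarith
  have hz0 : 0 < z := by linarith
  have hq₁ : ∑ e, w₁ e ≤ d * p₁ / 2 := by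
    have := Finset.sum_le_sum fun i (_ : i ∈ Finset.univ) => (h.degree₁ i).2
    rw [sum_degree, Finset.sum_const, Finset.card_univ, Fintype.card_fin, nsmul_eq_mul] at this
    linarith
  have hq₂ : ∑ e, w₂ e ≤ d * p₂ / 2 := by
    have := Finset.sum_le_sum fun i (_ : i ∈ Finset.univ) => (h.degree₂ i).2
    rw [sum_degree, Finset.sum_const, Finset.card_univ, Fintype.card_fin, nsmul_eq_mul] at this
    linarith
  have hs : ∀ {p : ℕ} (e : Edge p), ∑ f, (Pi.single e 1 : Edge p → ℝ) f = 1 := fun e => by simp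
  -- One tail bound serves all three families, with `P = p₂`, `p₁` and 1; an edge indicator has
  -- total weight 1 and degrees at most 2.
  have htail : ∀ (x : Edge p₁ → ℝ) (y : Edge p₂ → ℝ) (P : ℝ), (∀ e, 0 ≤ x e) → (∀ e, 0 ≤ y e) →
      (∀ i j, degree x i * degree y j ≤ 4 * d) → (∑ e, x e) * ∑ e, y e ≤ d * P → 1 ≤ P →
      μ.real {ω | b * g * √P ≤ |(kronLaplacian x y * (sampleCov (fun k => X k ω) - C)).trace|} ≤
        2 * ((p₁ : ℝ) * p₂) ^ (-(τ + 5)) := by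
    intro x y P hx hy hdeg hsum hP
    rw [hb]
    refine measureReal_abs_trace_sampleCov_sub_ge_le_rpow hn μ hX hlaw hz0 hd0
      (kronLaplacian_posSemidef hx hy) (h.moorePenrose_posSemidef hz hC) (fun ξ => ?_) ?_
      (h.moorePenrose_form_le hz hC) hg (by positivity) hP hgn hgz
    · have := kronLaplacian_form_le hx hy hdeg ξ
      linarith
    · rw [trace_kronLaplacian]
      linarith
  have hfst : ∀ e, μ.real {ω | b * g * √p₂ ≤ |(kronLaplacian (Pi.single e 1) w₂ *
      (sampleCov (fun k => X k ω) - C)).trace|} ≤ 2 * ((p₁ : ℝ) * p₂) ^ (-(τ + 5)) := fun e => by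
    refine htail _ _ _ (single_one_nonneg e) h.nonneg₂ (fun i j => ?_) ?_ (by linarith)
    · have := mul_le_mul (degree_single_le e i) (h.degree₂ j).2 (degree_nonneg h.nonneg₂ j)
        zero_le_two
      linarith
    · rw [hs, one_mul]
      have : 0 ≤ d * p₂ := by positivity
      linarith
  have hsnd : ∀ f, μ.real {ω | b * g * √p₁ ≤ |(kronLaplacian w₁ (Pi.single f 1) *
      (sampleCov (fun k => X k ω) - C)).trace|} ≤ 2 * ((p₁ : ℝ) * p₂) ^ (-(τ + 5)) := fun f => by
    refine htail _ _ _ h.nonneg₁ (single_one_nonneg f) (fun i j => ?_) ?_ (by linarith)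
    · have := mul_le_mul (h.degree₁ i).2 (degree_single_le f j)
        (degree_nonneg (single_one_nonneg f) j) hd0.le
      linarith
    · rw [hs, mul_one]
      have : 0 ≤ d * p₁ := by positivity
      linarith
  have hboth : ∀ ef : Edge p₁ × Edge p₂,
      μ.real {ω | b * g * √1 ≤ |(kronLaplacian (Pi.single ef.1 1) (Pi.single ef.2 1) *
        (sampleCov (fun k => X k ω) - C)).trace|} ≤ 2 * ((p₁ : ℝ) * p₂) ^ (-(τ + 5)) := fun ef => by
    refine htail _ _ _ (single_one_nonneg _) (single_one_nonneg _) (fun i j => ?_) ?_ le_rfl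
    · have := mul_le_mul (degree_single_le ef.1 i) (degree_single_le ef.2 j)
        (degree_nonneg (single_one_nonneg _) j) zero_le_two
      linarith
    · rw [hs, hs]
      linarith
  have hunion : ∀ {ι : Type} [Fintype ι] (A : ι → Set Ω) (q : ℝ) (N : ℝ), 0 ≤ q →
      (Fintype.card ι : ℝ) ≤ N → (∀ i, μ.real (A i) ≤ q) → μ.real (⋃ i, A i) ≤ N * q := by
    intro ι _ A q N hq hN hA
    calc μ.real (⋃ i, A i) ≤ ∑ i, μ.real (A i) := measureReal_iUnion_fintype_le A
      _ ≤ ∑ _i : ι, q := Finset.sum_le_sum fun i _ => hA i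
      _ = Fintype.card ι * q := by simp
      _ ≤ _ := mul_le_mul_of_nonneg_right hN hq
  have hq0 : 0 ≤ 2 * ((p₁ : ℝ) * p₂) ^ (-(τ + 5)) := by positivity
  have hcard : (Fintype.card (Edge p₁ × Edge p₂) : ℝ) ≤ (p₁ : ℝ) ^ 2 * (p₂ : ℝ) ^ 2 := by
    rw [Fintype.card_prod, Nat.cast_mul]
    exact mul_le_mul (card_edge_le p₁) (card_edge_le p₂) (by positivity) (by positivity)
  have u₁ := hunion _ _ _ hq0 (card_edge_le p₁) hfst
  have u₂ := hunion _ _ _ hq0 (card_edge_le p₂) hsnd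
  have u₃ := hunion _ _ _ hq0 hcard hboth
  refine le_trans ?_ (union_bound_rpow_le (τ := τ) hp₁' hp₂')
  rw [add_mul, add_mul]
  refine le_trans ?_ (add_le_add u₁ (add_le_add u₂ u₃))
  refine le_trans (measureReal_mono ?_) ((measureReal_union_le _ _).trans
    (add_le_add_right (measureReal_union_le _ _) _))
  intro ω hω
  by_contra hcon
  simp only [Set.mem_union, Set.mem_iUnion, Set.mem_ofPred_eq, not_or, not_exists, not_le,
    Real.sqrt_one, mul_one, Prod.forall] at hcon
  exact hω ⟨fun e => (hcon.1 e).le, fun f => (hcon.2.1 f).le, fun e f => (hcon.2.2 e f).le⟩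

/-- High-probability error bound for the penalised maximum likelihood estimator. -/
theorem exists_measure_failureEvent_le {s₁ s₂ d z a τ : ℝ} (hd : 1 < d) (hz : 1 < z) (ha : 0 < a)
    (hτ : 0 < τ) : ∃ c : ℝ, 0 < c ∧ ∃ C : ℝ, 0 < C ∧
      ∀ (p₁ p₂ n : ℕ) (w₁ : Edge p₁ → ℝ) (w₂ : Edge p₂ → ℝ),
        TrueGraphs s₁ s₂ d z w₁ w₂ →
        C * ((p₁ : ℝ) / p₂ + (p₂ : ℝ) / p₁) * Real.log (p₁ * p₂) ≤ n →
        ∀ α₁ α₂ : ℝ, ProperPenalty a p₁ p₂ n α₁ α₂ →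
        ∀ (Ω : Type u) [MeasurableSpace Ω] (μ : Measure Ω) [IsProbabilityMeasure μ]
          (X : Fin n → Ω → EuclideanSpace ℝ (Fin p₁ × Fin p₂)),
          IsIGMRFSample μ (kronLaplacian w₁ w₂) X →
          μ (failureEvent α₁ α₂ X w₁ w₂
              (c * Real.sqrt (((p₁ : ℝ) + p₂) * Real.log (p₁ * p₂) / n)))
            ≤ ENNReal.ofReal (((p₁ : ℝ) * p₂) ^ (-τ)) := by
  have hd0 : 0 < d := by linarith
  have hz0 : 0 < z := by linarith
  obtain ⟨b, hb⟩ : ∃ b, b = 64 * d ^ 2 * z ^ 2 + (τ + 5) := ⟨_, rfl⟩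
  have hb0 : 0 ≤ b := by rw [hb]; positivity
  obtain ⟨g₀, hg₀, θ, hθ, c, hc, hdet⟩ :=
    exists_forall_frobNorm_le (s := max 1 (max s₁ s₂)) (le_max_left _ _) hd hz ha.le hb0
  -- The upper bound for `g² (p₁/p₂ + p₂/p₁)`. Its three terms serve the deterministic threshold,
  -- the Chernoff range, and `g² (p₁ + p₂) ≤ θ pᵢ`, where half of `θ` goes to each summand.
  obtain ⟨η, hη⟩ : ∃ η, η = min (g₀ ^ 2) (min ((1 / (32 * d * z)) ^ 2) (θ / 2)) := ⟨_, rfl⟩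
  have hη0 : 0 < η := by rw [hη]; positivity
  have hη₁ : η ≤ g₀ ^ 2 := hη ▸ min_le_left _ _
  have hη₂ : η ≤ (1 / (32 * d * z)) ^ 2 := hη ▸ (min_le_right _ _).trans (min_le_left _ _)
  have hη₃ : η ≤ θ / 2 := hη ▸ (min_le_right _ _).trans (min_le_right _ _)
  refine ⟨c, hc, 1 / η, by positivity, ?_⟩
  intro p₁ p₂ n w₁ w₂ h hn α₁ α₂ hα Ω _ μ _ X hX
  obtain ⟨⟨hα₁, hα₁'⟩, hα₂, hα₂'⟩ := hα
  obtain ⟨hXi, C, hC, hlaw⟩ := hX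
  obtain ⟨hp₁, hp₂⟩ := h.one_lt hd0
  have hp₁' : (1 : ℝ) < p₁ := by exact_mod_cast hp₁
  have hp₂' : (1 : ℝ) < p₂ := by exact_mod_cast hp₂
  have hlog : 0 < Real.log (p₁ * p₂) := Real.log_pos (by nlinarith)
  -- Division by zero gives 0, so `n = 0` would leave no positive penalty in the allowed range.
  have hn0 : 0 < n := by
    rcases Nat.eq_zero_or_pos n with h0 | h0
    · rw [h0] at hα₁'
      simp at hα₁'
      linarith
    · exact h0
  have hn0' : (0 : ℝ) < n := by exact_mod_cast hn0
  obtain ⟨g, hg⟩ : ∃ g, g = √(Real.log (p₁ * p₂) / n) := ⟨_, rfl⟩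
  have hg0 : 0 ≤ g := by rw [hg]; positivity
  have hg2 : g ^ 2 = Real.log (p₁ * p₂) / n := by rw [hg, Real.sq_sqrt (by positivity)]
  have hgn : n * g ^ 2 = Real.log (p₁ * p₂) := by rw [hg2]; field_simp
  have hsplit : ∀ P : ℝ, 0 ≤ P → √(P * Real.log (p₁ * p₂) / n) = g * √P := fun P hP => by
    rw [mul_div_assoc, Real.sqrt_mul hP, hg, mul_comm]
  rw [hsplit _ (by positivity)] at hα₁' hα₂' ⊢
  have hratio : g ^ 2 * ((p₁ : ℝ) / p₂ + (p₂ : ℝ) / p₁) ≤ η := by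
    rw [hg2, div_mul_eq_mul_div, div_le_iff₀ hn0']
    have := mul_le_mul_of_nonneg_left hn hη0.le
    calc _ = η * (1 / η * ((p₁ : ℝ) / p₂ + (p₂ : ℝ) / p₁) * Real.log (p₁ * p₂)) := by field_simp
      _ ≤ _ := this
  have hx₁ : 0 < (p₁ : ℝ) / p₂ := by positivity
  have hx₂ : 0 < (p₂ : ℝ) / p₁ := by positivity
  have hone : 1 ≤ (p₁ : ℝ) / p₂ + (p₂ : ℝ) / p₁ := by
    rcases le_total (p₁ : ℝ) p₂ with hle | hle
    · have : 1 ≤ (p₂ : ℝ) / p₁ := by rwa [one_le_div (by linarith)]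
      linarith
    · have : 1 ≤ (p₁ : ℝ) / p₂ := by rwa [one_le_div (by linarith)]
      linarith
  have hgη : g ^ 2 ≤ η := (le_mul_of_one_le_right (sq_nonneg g) hone).trans hratio
  have hθ₁ : g ^ 2 * (p₁ + p₂) ≤ θ * p₁ := by
    have e : (p₁ + p₂ : ℝ) = (1 + p₂ / p₁) * p₁ := by field_simp
    have h1 : g ^ 2 * ((p₂ : ℝ) / p₁) ≤ η :=
      (mul_le_mul_of_nonneg_left (by linarith) (sq_nonneg g)).trans hratio
    rw [e, ← mul_assoc]
    exact mul_le_mul_of_nonneg_right (by linarith) (by linarith)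
  have hθ₂ : g ^ 2 * (p₁ + p₂) ≤ θ * p₂ := by
    have e : (p₁ + p₂ : ℝ) = (1 + p₁ / p₂) * p₂ := by field_simp; ring
    have h1 : g ^ 2 * ((p₁ : ℝ) / p₂) ≤ η :=
      (mul_le_mul_of_nonneg_left (by linarith) (sq_nonneg g)).trans hratio
    rw [e, ← mul_assoc]
    exact mul_le_mul_of_nonneg_right (by linarith) (by linarith)
  have hgz : g * (32 * d * z) ≤ 1 := by
    rw [← le_div_iff₀ (by positivity)]
    exact le_of_sq_le_sq (hgη.trans hη₂) (by positivity)
  have hne := h.nonempty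
  have hnoise := h.measureReal_noise_le hd hz hn0 μ hC hXi hlaw hg0 hgn hgz hb
  refine le_trans (measure_mono fun ω hω => ?_) ((ofReal_measureReal (μ := μ)).symm.le.trans
    (ENNReal.ofReal_le_ofReal hnoise))
  intro hgood
  refine hω ⟨exists_isPenalizedMLE hα₁ hα₂ (sampleCov_posSemidef _) (h.feasible hz),
    fun v₁ v₂ hv => ?_⟩
  exact hdet (h.mono ((le_max_left _ _).trans (le_max_right _ _))
    ((le_max_right _ _).trans (le_max_right _ _))) hC hg0
    (le_of_sq_le_sq (hgη.trans hη₁) hg₀.le) hθ₁ hθ₂ hα₁ hα₁' hα₂ hα₂' hgood.1 hgood.2.1 hgood.2.2 hv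

lemma failureEvent_anti {n : ℕ} {Ω : Type*} {α₁ α₂ r r' : ℝ}
    {X : Fin n → Ω → EuclideanSpace ℝ (Fin p₁ × Fin p₂)} (hr : r ≤ r') :
    failureEvent α₁ α₂ X w₁ w₂ r' ⊆ failureEvent α₁ α₂ X w₁ w₂ r :=
  fun _ hω hgood => hω ⟨hgood.1, fun v₁ v₂ hv => (hgood.2 v₁ v₂ hv).trans hr⟩

lemma exists_two_rpow_neg_le {δ : ℝ} (hδ : 0 < δ) : ∃ τ : ℝ, 0 < τ ∧ (2 : ℝ) ^ (-τ) ≤ δ := by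
  obtain ⟨m, hm⟩ := exists_pow_lt_of_lt_one hδ (by norm_num : (1 / 2 : ℝ) < 1)
  refine ⟨m + 1, by positivity, le_trans ?_ hm.le⟩
  rw [Real.rpow_neg zero_le_two, ← Real.inv_rpow zero_le_two, ← Nat.cast_add_one,
    Real.rpow_natCast, one_div]
  exact pow_le_pow_of_le_one (by norm_num) (by norm_num) (Nat.le_succ m)

end Probability

end KSGL

theorem theorem3 (s₁ s₂ d z a : ℝ) (hs₁ : 0 < s₁) (hs₂ : 0 < s₂) (hd : 1 < d) (hz : 1 < z)
    (ha : 0 < a) :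
    (∀ τ : ℝ, 0 < τ → ∃ c : ℝ, 0 < c ∧ ∃ C : ℝ, 0 < C ∧
      ∀ (p₁ p₂ n : ℕ) (w₁ : KSGL.Edge p₁ → ℝ) (w₂ : KSGL.Edge p₂ → ℝ),
        KSGL.TrueGraphs s₁ s₂ d z w₁ w₂ →
        C * ((p₁ : ℝ) / p₂ + (p₂ : ℝ) / p₁) * Real.log (p₁ * p₂) ≤ n →
        ∀ α₁ α₂ : ℝ, KSGL.ProperPenalty a p₁ p₂ n α₁ α₂ →
        ∀ (Ω : Type u) [MeasurableSpace Ω] (μ : Measure Ω) [IsProbabilityMeasure μ]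
          (X : Fin n → Ω → EuclideanSpace ℝ (Fin p₁ × Fin p₂)),
          KSGL.IsIGMRFSample μ (KSGL.kronLaplacian w₁ w₂) X →
          μ (KSGL.failureEvent α₁ α₂ X w₁ w₂
              (c * Real.sqrt (((p₁ : ℝ) + p₂) * Real.log (p₁ * p₂) / n)))
            ≤ ENNReal.ofReal (((p₁ : ℝ) * p₂) ^ (-τ))) ∧
    (∀ ε δ : ℝ, 0 < ε → 0 < δ → ∃ ρ : ℝ, 0 < ρ ∧
      ∀ (p₁ p₂ n : ℕ) (w₁ : KSGL.Edge p₁ → ℝ) (w₂ : KSGL.Edge p₂ → ℝ),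
        KSGL.TrueGraphs s₁ s₂ d z w₁ w₂ →
        ((p₁ : ℝ) + p₂) * Real.log (p₁ * p₂) ≤ ρ * n →
        ∀ α₁ α₂ : ℝ, KSGL.ProperPenalty a p₁ p₂ n α₁ α₂ →
        ∀ (Ω : Type u) [MeasurableSpace Ω] (μ : Measure Ω) [IsProbabilityMeasure μ]
          (X : Fin n → Ω → EuclideanSpace ℝ (Fin p₁ × Fin p₂)),
          KSGL.IsIGMRFSample μ (KSGL.kronLaplacian w₁ w₂) X →
          μ (KSGL.failureEvent α₁ α₂ X w₁ w₂ ε) ≤ ENNReal.ofReal δ) := by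

  refine ⟨fun τ hτ => KSGL.exists_measure_failureEvent_le hd hz ha hτ, fun ε δ hε hδ => ?_⟩
  obtain ⟨τ, hτ, hτδ⟩ := KSGL.exists_two_rpow_neg_le hδ
  obtain ⟨c, hc, C, hC, hmain⟩ := KSGL.exists_measure_failureEvent_le (s₁ := s₁) (s₂ := s₂)
    hd hz ha hτ
  -- `1 / C` yields the sample-size condition, since `p₁/p₂ + p₂/p₁ ≤ p₁ + p₂`; `(ε / c)²` brings
  -- the rate below `ε`.
  refine ⟨min (1 / C) ((ε / c) ^ 2), by positivity, ?_⟩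
  intro p₁ p₂ n w₁ w₂ h hn α₁ α₂ hα Ω _ μ _ X hX
  obtain ⟨hp₁, hp₂⟩ := h.one_lt (by linarith)
  have hp₁' : (1 : ℝ) < p₁ := by exact_mod_cast hp₁
  have hp₂' : (1 : ℝ) < p₂ := by exact_mod_cast hp₂
  have hp : (2 : ℝ) ≤ p₁ * p₂ := by
    have : 2 ≤ p₁ * p₂ := by nlinarith
    exact_mod_cast this
  have hlog : 0 < Real.log (p₁ * p₂) := Real.log_pos (by linarith)
  have hn0 : (0 : ℝ) ≤ n := n.cast_nonneg
  have hratio : (p₁ : ℝ) / p₂ + (p₂ : ℝ) / p₁ ≤ p₁ + p₂ :=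
    add_le_add (div_le_self (by linarith) hp₂'.le) (div_le_self (by linarith) hp₁'.le)
  have hsample : C * ((p₁ : ℝ) / p₂ + (p₂ : ℝ) / p₁) * Real.log (p₁ * p₂) ≤ n := by
    calc C * ((p₁ : ℝ) / p₂ + (p₂ : ℝ) / p₁) * Real.log (p₁ * p₂)
        ≤ C * (p₁ + p₂) * Real.log (p₁ * p₂) := by gcongr
      _ = C * ((p₁ + p₂) * Real.log (p₁ * p₂)) := by ring
      _ ≤ C * (1 / C * n) := mul_le_mul_of_nonneg_left
          (hn.trans (mul_le_mul_of_nonneg_right (min_le_left _ _) hn0)) hC.le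
      _ = n := by field_simp
  have hrate : c * Real.sqrt (((p₁ : ℝ) + p₂) * Real.log (p₁ * p₂) / n) ≤ ε := by
    rw [← le_div_iff₀' hc]
    refine Real.sqrt_le_iff.2 ⟨by positivity, div_le_of_le_mul₀ hn0 (by positivity) ?_⟩
    exact hn.trans (mul_le_mul_of_nonneg_right (min_le_right _ _) hn0)
  refine (measure_mono (KSGL.failureEvent_anti hrate)).trans
    ((hmain p₁ p₂ n w₁ w₂ h hsample α₁ α₂ hα Ω μ X hX).trans (ENNReal.ofReal_le_ofReal ?_))
  -- Since `p ≥ 2`, the tail `p^(-τ)` is at most `2^(-τ)` uniformly, so no growth of `p` is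
  -- required.
  exact (Real.rpow_le_rpow_of_nonpos two_pos hp (by linarith)).trans hτδ
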